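/- **Setting.** Let $V=\{0,\dots,N\}$ $(N\ge 0)$ or $V=\mathbb Z_{\ge0}$. A *reversible chain* on $V$ is a real matrix $K(x,y)\ge 0$ (transition from $y$ to $x$) with $\sum_{x}K(x,y)=1$, connected, with a distribution $\pi(x)>0$, $\sum_x\pi(x)=1$, such that $K(x,y)\pi(y)=K(y,x)\pi(x)$. It is *exactly solvable* if real $\kappa(n)$, real functions $v_n$ on $V$ and constants $d_n>0$ $(n\in V)$ are known with $\sum_yK(y,x)v_n(y)=\kappa(n)v_n(x)$, $\sum_x\pi(x)v_n(x)v_m(x)=\delta_{nm}/d_n^2$, and such that $\hat\phi_n(x)=\sqrt{\pi(x)}\,d_nv_n(x)$ is complete: $\sum_n\hat\phi_n(x)\hat\phi_n(y)=\delta_{xy}$. Its coinless quantum version on $\ell^2(V)$ has the Hamiltonian $\mathcal H(x,y)=\delta_{xy}-\pi(x)^{-1/2}K(x,y)\pi(y)^{1/2}$, the step operator $U=e^{-i\mathcal H}$ and the amplitudes $\Psi(x,y;\ell)=\langle x|U^\ell|y\rangle$. **(A)** For every exactly solvable reversible chain, $\mathcal H$ is the matrix of a unique bounded operator; it is positive semi-definite,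 $U$ is unitary, $(\hat\phi_n)$ is an orthonormal basis of $\ell^2(V)$, $\mathcal H\hat\phi_n=(1-\kappa(n))\hat\phi_n$ with $0\le1-\kappa(n)\le2$, $\sum_yK(x,y)\sqrt{\pi(y)}\hat\phi_n(y)=\kappa(n)\sqrt{\pi(x)}\hat\phi_n(x)$, $\mathcal H(x,y)=\sum_n(1-\kappa(n))\hat\phi_n(x)\hat\phi_n(y)$ and $K(x,y)=\sqrt{\pi(x)/\pi(y)}\sum_n\kappa(n)\hat\phi_n(x)\hat\phi_n(y)$. If $\psi(\ell+1)=U\psi(\ell)$, then $\psi(\ell)=U^\ell\psi(0)=\sum_ne^{-i(1-\kappa(n))\ell}(\hat\phi_n,\psi(0))\,\hat\phi_n$ with $(\hat\phi_n,\psi(0))=\sum_z\hat\phi_n(z)\psi(0)(z)$. Moreover $$\Psi(x,y;\ell)=\sum_ne^{-i(1-\kappa(n))\ell}\hat\phi_n(x)\hat\phi_n(y),$$ $$|\Psi(x,y;\ell)|^2=\sum_n\hat\phi_n(x)^2\hat\phi_n(y)^2+2\sum_{n>m}\cos[(\kappa(n)-\kappa(m))\ell]\,\hat\phi_n(x)\hat\phi_m(x)\hat\phi_n(y)\hat\phi_m(y),$$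 and $\frac1T\sum_{\ell=0}^{T}|\Psi(x,y;\ell)|^2$ tends, as $T\to\infty$, to $\sum_{n,m:\,\kappa(n)=\kappa(m)}\hat\phi_n(x)\hat\phi_m(x)\hat\phi_n(y)\hat\phi_m(y)$, which is $\sum_n\hat\phi_n(x)^2\hat\phi_n(y)^2$ if the $\kappa(n)$ are pairwise different. If $V$ has at least two points, $|\Psi(y,y;\ell)|^2$ has no limit as $\ell\to\infty$, for any $y$. **(B)** The following chains, built by convolution from orthogonality measures of polynomials of the Askey scheme, have $K(x,y)>0$ and are reversible and exactly solvable, with the stated reversible distribution $\pi$, eigenvalues $\kappa(n)$, $v_n=\check P_n$ and $d_n$; $\kappa(0)=1$, $\check P_0\equiv1$ and $\check P_n(0)=1$. So (A) applies to them, and $$\Psi(x,0;\ell)=\sqrt{\pi(x)\pi(0)}\sum_{n\in V}e^{-i(1-\kappa(n))\ell}d_n^2\check P_n(x).$$ Notation: $(a)_n=\prod_{k<n}(a+k)$, $(a;q)_n=\prod_{k<n}(1-aq^k)$, ${N\brack x}=\frac{(q;q)_N}{(q;q)_x(q;q)_{N-x}}$; ${}_rF_s$ and ${}_r\phi_s$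 are the usual (basic) hypergeometric series, which terminate here. *Families.* - Krawtchouk $(0<a<1)$: $\pi_K(x,N,a)=\binom Nxa^x(1-a)^{N-x}$, $\check P_n(x,a)={}_2F_1\left({-n,-x\atop -N}\Big|a^{-1}\right)$, $d_n(a)^2=\binom Nn\left(\frac a{1-a}\right)^n$. - Hahn $(a,b>0)$: $\pi_H(x,N,a,b)=\binom Nx\frac{(a)_x(b)_{N-x}}{(a+b)_N}$, $\check P_n(x,a,b)={}_3F_2\left({-n,\,n+a+b-1,\,-x\atop a,\,-N}\Big|1\right)$, $d_n(a,b)^2=\binom Nn\frac{(a)_n(2n+a+b-1)(a+b)_N}{(b)_n(n+a+b-1)_{N+1}}$. - $q$-Hahn $(0<q<1,\ 0<a<1,\ b<1)$: $\pi_{qH}(x,N,a,b)={N\brack x}\frac{(a;q)_x(b;q)_{N-x}a^{N-x}}{(ab;q)_N}$, $\check P_n(x,a,b)={}_3\phi_2\left({q^{-n},\,abq^{n-1},\,q^{-x}\atop a,\,q^{-N}}\Big|q;q\right)$, $d_n(a,b)^2={N\brack n}\frac{(a;q)_n(abq^{-1};q)_n}{(abq^N;q)_n(b;q)_na^n}\,\frac{1-abq^{2n-1}}{1-abq^{-1}}$.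 - Charlier $(a>0)$: $\pi_C(x,a)=a^xe^{-a}/x!$, $\check P_n(x,a)={}_2F_0\left({-n,-x\atop -}\Big|-a^{-1}\right)$, $d_n(a)^2=a^n/n!$. - Meixner $(a>0,\ 0<b<1)$: $\pi_M(x,a,b)=(a)_xb^x(1-b)^a/x!$, $\check P_n(x,a,b)={}_2F_1\left({-n,-x\atop a}\Big|1-b^{-1}\right)$, $d_n(a,b)^2=(a)_nb^n/n!$. (In $d_n^2$ for Hahn and $q$-Hahn, common factors are cancelled before evaluation; $d_0^2=1$.) *The five worked examples.* 1. $q$-Hahn, type (i), $0<q,a,b<1$, $c<1$: $K(x,y)=\sum_{z=0}^{\min(x,y)}\pi_{qH}(x-z,N-z,b,c)\,\pi_{qH}(z,y,a,b)$; $\pi=\pi_{qH}(\cdot,N,ab,c)$; $\kappa(n)=\frac{b^n(a;q)_n(c;q)_n}{(ab;q)_n(bc;q)_n}$, pairwise different; $\check P_n(x,ab,c)$, $d_n(ab,c)$. Also $\pi(0)=\frac{(c;q)_N(ab)^N}{(abc;q)_N}$, $\pi(N)=\frac{(ab;q)_N}{(abc;q)_N}$, $\check P_n(N)=(-ab)^nq^{n(n-1)/2}\frac{(c;q)_n}{(ab;q)_n}$.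 2. Hahn, type (ii), $a,b,c>0$: $K(x,y)=\sum_{z=\max(0,x+y-N)}^{\min(x,y)}\pi_H(x-z,N-y,b,c)\,\pi_H(z,y,a,b)$; $\pi=\pi_H(\cdot,N,a+b,b+c)$; $\kappa(n)={}_3F_2\left({-n,\,n+a+2b+c-1,\,b\atop a+b,\,b+c}\Big|1\right)=\sum_{k=0}^n\binom nk(-1)^k\frac{(b)_k(n+a+2b+c-1)_k}{(a+b)_k(b+c)_k}$; $\check P_n(x,a+b,b+c)$, $d_n(a+b,b+c)$. Also $\pi(0)=\frac{(b+c)_N}{(a+2b+c)_N}$, $\pi(N)=\frac{(a+b)_N}{(a+2b+c)_N}$, $\check P_n(N)=(-1)^n\frac{(b+c)_n}{(a+b)_n}$. 3. Krawtchouk, type (iii), $0<a,b<1$, $p=\frac{ab}{1-b+ab}$: $K(x,y)=\sum_{z=\max(x,y)}^N\pi_K(x,z,b)\,\pi_K(z-y,N-y,a)$; $\pi=\pi_K(\cdot,N,p)$; $\kappa(n)=(1-a)^nb^n$, pairwise different; $\check P_n(x,p)$, $d_n(p)$. Also $\pi(0)=(1-p)^N$, $\pi(N)=p^N$, $\check P_n(N)=(-1)^n(p^{-1}-1)^n$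 and $\Psi(N,0;\ell)=\frac{(ab(1-b))^{N/2}}{(1-b+ab)^N}\sum_{n=0}^N(-1)^ne^{-i(1-(1-a)^nb^n)\ell}\binom Nn$. 4. Charlier, type (i), $0<a<1$, $b>0$, $p=\frac b{1-a}$: $K(x,y)=\sum_{z=0}^{\min(x,y)}\pi_C(x-z,b)\,\pi_K(z,y,a)$; $\pi=\pi_C(\cdot,p)$; $\kappa(n)=a^n$, pairwise different; $\check P_n(x,p)$, $d_n(p)$; $\pi(0)=e^{-p}$. 5. Meixner, type (ii), $a,b>0$, $0<c<1$: $K(x,y)=\sum_{z=0}^{\min(x,y)}\pi_M(x-z,b,c)\,\pi_H(z,y,a,b)$; $\pi=\pi_M(\cdot,a+b,c)$; $\kappa(n)=\frac{(a)_n}{(a+b)_n}$, pairwise different; $\check P_n(x,a+b,c)$, $d_n(a+b,c)$; $\pi(0)=(1-c)^{a+b}$. *Further chains of the same types*, with the parameter ranges and sums as above ($\check P_n$ and $d_n$ always with the parameters of $\pi$). 6. Krawtchouk, type (i), $K=\sum_z\pi_K(x-z,N-z,b)\,\pi_K(z,y,a)$: $\pi=\pi_K(\cdot,N,p)$, $p=\frac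 b{1-a+ab}$, $\kappa(n)=a^n(1-b)^n$. 7. Krawtchouk, type (ii), $K=\sum_z\pi_K(x-z,N-y,b)\,\pi_K(z,y,a)$: $\pi=\pi_K(\cdot,N,p)$, $p=\frac b{1-a+b}$, $\kappa(n)=(a-b)^n$. 8. Hahn, type (i), $K=\sum_z\pi_H(x-z,N-z,b,c)\,\pi_H(z,y,a,b)$: $\pi=\pi_H(\cdot,N,a+b,c)$, $\kappa(n)=\frac{(a)_n(c)_n}{(a+b)_n(b+c)_n}$. 9. Hahn, type (iii), $K=\sum_z\pi_H(x,z,a,b)\,\pi_H(z-y,N-y,b,c)$: $\pi=\pi_H(\cdot,N,a,b+c)$, the same $\kappa(n)$ as in 8. 10. $q$-Hahn, type (iii), $K=\sum_z\pi_{qH}(x,z,a,b)\,\pi_{qH}(z-y,N-y,b,c)$: $\pi=\pi_{qH}(\cdot,N,a,bc)$, the same $\kappa(n)$ as in 1. -/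

import Mathlib

noncomputable section

namespace QMC

/-! ### Classical reversible chains and their polynomial eigenbases -/

/-- `K x y` is the probability of the transition from `y` to `x`. The chain is connected and
reversible with respect to the strictly positive probability distribution `π`. -/
structure IsReversibleChain {V : Type*} (K : V → V → ℝ) (π : V → ℝ) : Prop where
  nonneg : ∀ x y, 0 ≤ K x y
  conservation : ∀ y, HasSum (fun x => K x y) 1
  connected : ∀ x y, Relation.ReflTransGen (fun u v => 0 < K v u) y x
  balance : ∀ x y, K x y * π y = K y x * π x
  pos : ∀ x, 0 < π x
  total : HasSum π 1

/-- The eigenvalues `κ n` and the left eigenvectors `v n` of `K` are known: the `v n` are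
orthogonal with respect to `π` with squared norm `1 / (d n) ^ 2`, and the normalised vectors
`√(π x) * d n * v n x` are complete. -/
structure HasEigenbasis {V : Type*} [DecidableEq V] (K : V → V → ℝ) (π κ : V → ℝ)
    (v : V → V → ℝ) (d : V → ℝ) : Prop where
  norm_pos : ∀ n, 0 < d n
  left_eigen : ∀ n x, HasSum (fun y => K y x * v n y) (κ n * v n x)
  orthogonal : ∀ n m, HasSum (fun x => π x * v n x * v m x) (if n = m then 1 / d n ^ 2 else 0)
  complete : ∀ x y, HasSum
    (fun n => (Real.sqrt (π x) * d n * v n x) * (Real.sqrt (π y) * d n * v n y))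
    (if x = y then 1 else 0)

/-- The normalised eigenvectors. -/
def phiHat {V : Type*} (π : V → ℝ) (v : V → V → ℝ) (d : V → ℝ) (n x : V) : ℝ :=
  Real.sqrt (π x) * d n * v n x

/-! ### The quantum chain -/

/-- The Hilbert space of square summable complex functions on `V`. -/
abbrev L2 (V : Type*) : Type _ := lp (fun _ : V => ℂ) 2

/-- The basis vector `|x⟩`. -/
def ket {V : Type*} [DecidableEq V] (x : V) : L2 V := lp.single 2 x (1 : ℂ)

/-- The matrix `1 - Φ⁻¹ K Φ`, where `Φ` is the diagonal matrix with entries `√(π x)`. -/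
def hamiltonianMatrix {V : Type*} [DecidableEq V] (K : V → V → ℝ) (π : V → ℝ) (x y : V) : ℝ :=
  (if x = y then 1 else 0) - 1 / Real.sqrt (π x) * K x y * Real.sqrt (π y)

/-- `H` is the bounded operator on the Hilbert space with the above matrix. -/
def IsHamiltonian {V : Type*} [DecidableEq V] (K : V → V → ℝ) (π : V → ℝ)
    (H : L2 V →L[ℂ] L2 V) : Prop :=
  ∀ x y, (H (ket y) : V → ℂ) x = (hamiltonianMatrix K π x y : ℂ)

/-- The one-step evolution operator `U = e^{-iH}`. -/
def evolution {V : Type*} (H : L2 V →L[ℂ] L2 V) : L2 V →L[ℂ] L2 V :=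
  NormedSpace.exp ((-Complex.I) • H)

/-- The amplitude `Ψ(x, y; ℓ) = ⟨x| U ^ ℓ |y⟩`. -/
def amplitude {V : Type*} [DecidableEq V] (H : L2 V →L[ℂ] L2 V) (x y : V) (ℓ : ℕ) : ℂ :=
  ((evolution H ^ ℓ) (ket y) : V → ℂ) x

/-- The phase `e^{-i (1 - k) ℓ}`. -/
def phase (k : ℝ) (ℓ : ℕ) : ℂ := Complex.exp (-Complex.I * ((1 - k : ℝ) : ℂ) * (ℓ : ℂ))

/-- The spectral solution of the quantum chain with Hamiltonian `H`, in terms of the eigenvalues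
`κ n` and of the orthonormal basis `b` whose coordinates are the real numbers `φ n x`. -/
structure SpectralSolution {V : Type*} [LinearOrder V] (K : V → V → ℝ) (π κ : V → ℝ)
    (φ : V → V → ℝ) (H : L2 V →L[ℂ] L2 V) (b : HilbertBasis V ℂ (L2 V)) : Prop where
  positive : H.IsPositive
  unitary : evolution H ∈ unitary (L2 V →L[ℂ] L2 V)
  basis_apply : ∀ n x, (b n : V → ℂ) x = (φ n x : ℂ)
  eigen : ∀ n, H (b n) = ((1 - κ n : ℝ) : ℂ) • b n
  energy : ∀ n, 0 ≤ 1 - κ n ∧ 1 - κ n ≤ 2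
  right_eigen : ∀ n x, HasSum (fun y => K x y * (Real.sqrt (π y) * φ n y))
    (κ n * (Real.sqrt (π x) * φ n x))
  hamiltonian_spectral : ∀ x y, HasSum (fun n => (1 - κ n) * φ n x * φ n y)
    (hamiltonianMatrix K π x y)
  transition_spectral : ∀ x y, HasSum
    (fun n => Real.sqrt (π x) * (Real.sqrt (π y))⁻¹ * (κ n * φ n x * φ n y)) (K x y)
  /-- The coefficients of a state in the eigenbasis. -/
  coefficient : ∀ (n : V) (ψ : L2 V),
    HasSum (fun z => (φ n z : ℂ) * (ψ : V → ℂ) z) (inner ℂ (b n) ψ)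
  /-- The solution of the initial value problem. -/
  solution : ∀ ψ : ℕ → L2 V, (∀ ℓ, ψ (ℓ + 1) = evolution H (ψ ℓ)) →
    ∀ ℓ, ψ ℓ = (evolution H ^ ℓ) (ψ 0) ∧
      HasSum (fun n => (phase (κ n) ℓ * inner ℂ (b n) (ψ 0)) • b n) (ψ ℓ)
  amplitude_formula : ∀ (x y : V) (ℓ : ℕ),
    HasSum (fun n => phase (κ n) ℓ * (φ n x : ℂ) * (φ n y : ℂ)) (amplitude H x y ℓ)
  /-- The probability of measuring `x` after `ℓ` steps from `y`. -/
  probability : ∀ (x y : V) (ℓ : ℕ),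
    Summable (fun n => φ n x ^ 2 * φ n y ^ 2) ∧
    Summable (fun p : {p : V × V // p.2 < p.1} =>
      Real.cos ((κ p.1.1 - κ p.1.2) * ℓ) *
        (φ p.1.1 x * φ p.1.2 x * φ p.1.1 y * φ p.1.2 y)) ∧
    ‖amplitude H x y ℓ‖ ^ 2 = (∑' n, φ n x ^ 2 * φ n y ^ 2) +
      2 * ∑' p : {p : V × V // p.2 < p.1}, Real.cos ((κ p.1.1 - κ p.1.2) * ℓ) *
        (φ p.1.1 x * φ p.1.2 x * φ p.1.1 y * φ p.1.2 y)
  /-- The long time average for simple spectrum. -/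
  time_average : Function.Injective κ → ∀ x y, Filter.Tendsto
    (fun T : ℕ => 1 / (T : ℝ) * ∑ ℓ ∈ Finset.range (T + 1), ‖amplitude H x y ℓ‖ ^ 2)
    Filter.atTop (nhds (∑' n, φ n x ^ 2 * φ n y ^ 2))
  /-- The long time average when eigenvalues may be repeated. -/
  time_average_degenerate : ∀ x y,
    Summable (fun p : {p : V × V // κ p.1 = κ p.2} =>
      φ p.1.1 x * φ p.1.2 x * φ p.1.1 y * φ p.1.2 y) ∧
    Filter.Tendsto
      (fun T : ℕ => 1 / (T : ℝ) * ∑ ℓ ∈ Finset.range (T + 1), ‖amplitude H x y ℓ‖ ^ 2)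
      Filter.atTop (nhds (∑' p : {p : V × V // κ p.1 = κ p.2},
        φ p.1.1 x * φ p.1.2 x * φ p.1.1 y * φ p.1.2 y))
  /-- There is no limiting distribution. -/
  no_limit : Nontrivial V → ∀ y, ¬ ∃ L : ℝ,
    Filter.Tendsto (fun ℓ : ℕ => ‖amplitude H y y ℓ‖ ^ 2) Filter.atTop (nhds L)

/-- The quantum chain of `K` is well defined (there is exactly one bounded Hamiltonian with the
required matrix) and is solved by the eigenvalues `κ n` and the eigenvectors `φ n`. -/
def QuantumSolvable {V : Type*} [LinearOrder V] (K : V → V → ℝ) (π κ : V → ℝ)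
    (φ : V → V → ℝ) : Prop :=
  (∃! H : L2 V →L[ℂ] L2 V, IsHamiltonian K π H) ∧
  ∀ H : L2 V →L[ℂ] L2 V, IsHamiltonian K π H →
    ∃ b : HilbertBasis V ℂ (L2 V), SpectralSolution K π κ φ H b

/-- An exactly solvable chain with positive `K` and polynomial eigenvectors `P n`, normalised by
`P n 0 = 1`, together with its solved quantum version and the simplified amplitudes from `0`. -/
structure SolvableChain {V : Type*} [LinearOrder V] [Zero V] (K : V → V → ℝ) (π κ : V → ℝ)
    (P : V → V → ℝ) (d : V → ℝ) : Prop where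
  positive : ∀ x y, 0 < K x y
  reversible : IsReversibleChain K π
  eigenvalue_zero : κ 0 = 1
  eigenvector_zero : ∀ x, P 0 x = 1
  poly_zero : ∀ n, P n 0 = 1
  eigenbasis : HasEigenbasis K π κ P d
  quantum : QuantumSolvable K π κ (phiHat π P d)
  amplitude_from_zero : ∀ H : L2 V →L[ℂ] L2 V, IsHamiltonian K π H → ∀ (x : V) (ℓ : ℕ),
    Summable (fun n => phase (κ n) ℓ * ((d n ^ 2 * P n x : ℝ) : ℂ)) ∧
    amplitude H x 0 ℓ = (Real.sqrt (π x * π 0) : ℂ) *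
      ∑' n, phase (κ n) ℓ * ((d n ^ 2 * P n x : ℝ) : ℂ)

/-- The chain on `{0, …, N}` given by the restrictions of functions of natural numbers; `dsq`
is the square of the normalisation constant. -/
def SolvableFinite (N : ℕ) (K : ℕ → ℕ → ℝ) (π κ : ℕ → ℝ) (P : ℕ → ℕ → ℝ) (dsq : ℕ → ℝ) : Prop :=
  SolvableChain (V := Fin (N + 1)) (fun x y => K x y) (fun x => π x) (fun n => κ n)
    (fun n x => P n x) (fun n => Real.sqrt (dsq n))

/-- The chain on the non-negative integers. -/
def SolvableInfinite (K : ℕ → ℕ → ℝ) (π κ : ℕ → ℝ) (P : ℕ → ℕ → ℝ) (dsq : ℕ → ℝ) : Prop :=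
  SolvableChain (V := ℕ) K π κ P (fun n => Real.sqrt (dsq n))

/-! ### Shifted factorials and hypergeometric series -/

/-- The shifted factorial `(a)_n`. -/
abbrev poch (a : ℝ) (n : ℕ) : ℝ := (ascPochhammer ℝ n).eval a

/-- The `q`-shifted factorial `(a; q)_n`. -/
def qPoch (a q : ℝ) (n : ℕ) : ℝ := ∏ k ∈ Finset.range n, (1 - a * q ^ k)

/-- The `q`-binomial coefficient. -/
def qBinom (q : ℝ) (N x : ℕ) : ℝ := qPoch q q N / (qPoch q q x * qPoch q q (N - x))

/-- The hypergeometric series; it is used below only where it terminates. -/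
def hyper (as bs : List ℝ) (z : ℝ) : ℝ :=
  ∑' k : ℕ, (as.map fun a => poch a k).prod / (bs.map fun b => poch b k).prod *
    (z ^ k / (k.factorial : ℝ))

/-- The basic hypergeometric series; it is used below only where it terminates. -/
def qHyper (as bs : List ℝ) (q z : ℝ) : ℝ :=
  ∑' k : ℕ, (as.map fun a => qPoch a q k).prod / (bs.map fun b => qPoch b q k).prod *
    ((-1) ^ k * q ^ (k * (k - 1) / 2)) ^ (1 + (bs.length : ℤ) - (as.length : ℤ)) *
    (z ^ k / qPoch q q k)

/-! ### Orthogonality measures, polynomials and squared normalisation constants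

For the finite families `N` is the size and `x, n ∈ {0, …, N}`. -/

def krawtchoukMeasure (a : ℝ) (N x : ℕ) : ℝ := (N.choose x : ℝ) * a ^ x * (1 - a) ^ (N - x)

def krawtchoukPoly (a : ℝ) (N n x : ℕ) : ℝ := hyper [-(n : ℝ), -(x : ℝ)] [-(N : ℝ)] a⁻¹

def krawtchoukNormSq (a : ℝ) (N n : ℕ) : ℝ := (N.choose n : ℝ) * (a / (1 - a)) ^ n

def hahnMeasure (a b : ℝ) (N x : ℕ) : ℝ :=
  (N.choose x : ℝ) * (poch a x * poch b (N - x)) / poch (a + b) N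

def hahnPoly (a b : ℝ) (N n x : ℕ) : ℝ :=
  hyper [-(n : ℝ), n + a + b - 1, -(x : ℝ)] [a, -(N : ℝ)] 1

/-- For `n = 0` the general expression is `1`, but of the form `0 / 0` if `a + b = 1`. -/
def hahnNormSq (a b : ℝ) (N n : ℕ) : ℝ :=
  if n = 0 then 1 else
    (N.choose n : ℝ) * (poch a n * (2 * n + a + b - 1) * poch (a + b) N) /
      (poch b n * poch (n + a + b - 1) (N + 1))

def qHahnMeasure (q a b : ℝ) (N x : ℕ) : ℝ :=
  qBinom q N x * (qPoch a q x * qPoch b q (N - x) * a ^ (N - x)) / qPoch (a * b) q N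

def qHahnPoly (q a b : ℝ) (N n x : ℕ) : ℝ :=
  qHyper [q ^ (-(n : ℤ)), a * b * q ^ ((n : ℤ) - 1), q ^ (-(x : ℤ))] [a, q ^ (-(N : ℤ))] q q

/-- The factor `(a b q⁻¹; q)_n (1 - a b q ^ (2 n - 1)) / (1 - a b q⁻¹)`, in which the common
factor `1 - a b q⁻¹` has been cancelled, because it vanishes if `a b = q`. -/
def qHahnFactor (q a b : ℝ) (n : ℕ) : ℝ :=
  if n = 0 then 1 else qPoch (a * b) q (n - 1) * (1 - a * b * q ^ (2 * (n : ℤ) - 1))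

def qHahnNormSq (q a b : ℝ) (N n : ℕ) : ℝ :=
  qBinom q N n * (qPoch a q n / (qPoch (a * b * q ^ N) q n * qPoch b q n * a ^ n)) *
    qHahnFactor q a b n

def charlierMeasure (a : ℝ) (x : ℕ) : ℝ := a ^ x * Real.exp (-a) / (x.factorial : ℝ)

def charlierPoly (a : ℝ) (n x : ℕ) : ℝ := hyper [-(n : ℝ), -(x : ℝ)] [] (-a⁻¹)

def charlierNormSq (a : ℝ) (n : ℕ) : ℝ := a ^ n / (n.factorial : ℝ)

def meixnerMeasure (a b : ℝ) (x : ℕ) : ℝ :=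
  poch a x * b ^ x * (1 - b) ^ a / (x.factorial : ℝ)

def meixnerPoly (a b : ℝ) (n x : ℕ) : ℝ := hyper [-(n : ℝ), -(x : ℝ)] [a] (1 - b⁻¹)

def meixnerNormSq (a b : ℝ) (n : ℕ) : ℝ := poch a n * b ^ n / (n.factorial : ℝ)

theorem hahnNormSq_eq {a b : ℝ} (ha : 0 < a) (hb : 0 < b) (hab : a + b ≠ 1) (N n : ℕ) :
    hahnNormSq a b N n = (N.choose n : ℝ) * (poch a n * (2 * n + a + b - 1) * poch (a + b) N) /
      (poch b n * poch (n + a + b - 1) (N + 1)) := by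
  unfold hahnNormSq
  split_ifs with h
  · subst h
    have h1 : poch (a + b) N ≠ 0 := (ascPochhammer_pos N (a + b) (by linarith)).ne'
    have h2 : a + b - 1 ≠ 0 := sub_ne_zero.mpr hab
    have h3 : poch (a + b - 1) (N + 1) = (a + b - 1) * poch (a + b) N := by
      simp [poch, ascPochhammer_succ_left]
    simp only [Nat.choose_zero_right, Nat.cast_one, Nat.cast_zero, mul_zero, zero_add, h3]
    simp only [poch, ascPochhammer_zero, Polynomial.eval_one, one_mul]
    rw [div_self (mul_ne_zero h2 h1)]
  · rfl

theorem qHahnFactor_eq {q a b : ℝ} (hq : 0 < q) (hab : a * b ≠ q) (n : ℕ) :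
    qHahnFactor q a b n =
      qPoch (a * b * q⁻¹) q n * ((1 - a * b * q ^ (2 * (n : ℤ) - 1)) / (1 - a * b * q⁻¹)) := by
  have h0 : 1 - a * b * q⁻¹ ≠ 0 := by
    intro h
    apply hab
    field_simp at h
    linarith
  cases n with
  | zero => simp [qHahnFactor, qPoch, zpow_neg, h0]
  | succ n =>
    have h1 : qPoch (a * b * q⁻¹) q (n + 1) = (1 - a * b * q⁻¹) * qPoch (a * b) q n := by
      unfold qPoch
      rw [Finset.prod_range_succ', mul_comm]
      congr 1
      · simp
      · refine Finset.prod_congr rfl fun k _ => ?_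
        field_simp
        ring
    rw [h1]
    simp only [qHahnFactor, Nat.add_eq_zero_iff, one_ne_zero, and_false, if_false,
      Nat.add_sub_cancel]
    field_simp

/-! ### Convolutions of orthogonality measures

`μ N x` and `ν N x` are the weights of `x` in distributions on `{0, …, N}`. -/

/-- Type (i). -/
def convI (μ ν : ℕ → ℕ → ℝ) (N x y : ℕ) : ℝ :=
  ∑ z ∈ Finset.Icc 0 (min x y), μ (N - z) (x - z) * ν y z

/-- Type (ii); the truncated difference `x + y - N` is `max 0 (x + y - N)`. -/
def convII (μ ν : ℕ → ℕ → ℝ) (N x y : ℕ) : ℝ :=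
  ∑ z ∈ Finset.Icc (x + y - N) (min x y), μ (N - y) (x - z) * ν y z

/-- Type (iii). -/
def convIII (μ ν : ℕ → ℕ → ℝ) (N x y : ℕ) : ℝ :=
  ∑ z ∈ Finset.Icc (max x y) N, μ z x * ν (N - y) (z - y)

/-- The limit of types (i) and (ii) on the non-negative integers. -/
def convInf (μ : ℕ → ℝ) (ν : ℕ → ℕ → ℝ) (x y : ℕ) : ℝ :=
  ∑ z ∈ Finset.Icc 0 (min x y), μ (x - z) * ν y z

/-! ### Eigenvalues -/

/-- Hahn, types (i) and (iii). -/
def hahnEigenvalue (a b c : ℝ) (n : ℕ) : ℝ :=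
  poch a n * poch c n / (poch (a + b) n * poch (b + c) n)

/-- Hahn, type (ii). -/
def hahnEigenvalueII (a b c : ℝ) (n : ℕ) : ℝ :=
  hyper [-(n : ℝ), n + a + 2 * b + c - 1, b] [a + b, b + c] 1

/-- `q`-Hahn, types (i) and (iii). -/
def qHahnEigenvalue (q a b c : ℝ) (n : ℕ) : ℝ :=
  b ^ n * (qPoch a q n * qPoch c q n) / (qPoch (a * b) q n * qPoch (b * c) q n)

end QMC

end

noncomputable section

namespace QMC

/-! ### Spectral theory of reversible chains -/

namespace IsReversibleChain

variable {V : Type*} {K : V → V → ℝ} {π : V → ℝ}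

/-! General chains. Detailed balance makes the conjugate `Φ⁻¹ K Φ` symmetric, so the completeness of
the normalised eigenvectors turns them into a Hilbert basis of `L2 V` with real coordinates.
Jensen's inequality and stationarity of `π` give `|κ n| ≤ 1`; the Hamiltonian can therefore be
defined as the bounded diagonal operator with entries `1 - κ n`, and Parseval's identity applied to
a row of `Φ⁻¹ K Φ` (square summable by `symmetrized_sq`) shows that it has the prescribed matrix.
Powers of `e^{-iH}` act by phases, which gives the amplitudes, and the probabilities are double
series of cosines that converge absolutely. Frequency differences lie in `[-2, 2]`, inside one
period, so averaging over time annihilates exactly the pairs of different eigenvalues. A limit of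
the return probability is excluded by recurrence of powers in a compact torus
(`normSq_trigSum_of_tendsto`): the probability would be constant, hence only one eigenvalue would be
visible from `y`, and then all off-diagonal entries at `y` would vanish, against connectedness.

Convolution chains. Each measure is a `splitMeasure`, with weights proportional to `α x * β (N -
x)`. Given three sequences `α`, `β`, `γ`, a convolution kernel keeps part of a configuration and
draws the rest from its conditional law; written out, `K x y * π y` is a sum of products symmetric
in `x` and `y`, whence reversibility. One draw is a thinning: it acts diagonally on the Newton basis
of a suitable lattice `u` (`IsThinning`), because multiplication by a Newton polynomial shifts the
parameters of the weights and the Cauchy products of the shifted weights are known. Two draws in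
succession map polynomials in `u x` of degree at most `n` to such polynomials, so `K` is triangular.
A triangular operator that is self-adjoint for `π` has the orthogonal polynomials as eigenvectors
(`IsTriangular.eigen`). The eigenvalue is the diagonal entry, a product of two thinning constants
for types (i) and (iii), a single one in the infinite cases; for type (ii) it is read off at `y =
0`, where the polynomials are `1`.

Orthogonality itself is tested against polynomials which, multiplied into the weight, only shift its
parameters; the sums that remain are Chu–Vandermonde sums, ordinary or `q`, and vanish below the top
degree. The Charlier case uses finite differences instead, and the `q`-Hahn case `b = 0` follows by
continuity. Completeness is linear algebra for finite `V`; for Charlier and Meixner it is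
orthogonality again, since `P n x = P x n` and the squared norming constants are proportional to
`π`. -/

theorem le_one (h : IsReversibleChain K π) (x y : V) : K x y ≤ 1 :=
  le_hasSum (h.conservation y) x fun z _ => h.nonneg z y

/-- Balance and `K ≤ 1` give `K y x ≤ π y / π x`, so square summability for `π` passes to every
transition distribution. -/
theorem summable_mul_sq (h : IsReversibleChain K π) {v : V → ℝ}
    (hv : Summable fun x => π x * v x * v x) (x : V) : Summable fun y => K y x * v y ^ 2 := by
  refine Summable.of_nonneg_of_le (fun y => mul_nonneg (h.nonneg y x) (sq_nonneg _)) (fun y => ?_)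
    (hv.mul_left (π x)⁻¹)
  have hx := h.pos x
  have h1 : K y x = (π x)⁻¹ * (K x y * π y) := by
    rw [h.balance x y]; field_simp
  rw [h1]
  have h2 := mul_le_mul_of_nonneg_right (h.le_one x y) (h.pos y).le
  have h3 : 0 ≤ (π x)⁻¹ * v y ^ 2 := by positivity
  nlinarith [mul_le_mul_of_nonneg_right h2 h3]

/-- Jensen's inequality for the distribution `K · x`: the variance, the sum of `K y x * (v y - m) ^
2`, is nonnegative. -/
theorem sq_le_of_hasSum (h : IsReversibleChain K π) {v : V → ℝ}
    (hv : Summable fun x => π x * v x * v x) {x : V} {m : ℝ}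
    (hm : HasSum (fun y => K y x * v y) m) : m ^ 2 ≤ ∑' y, K y x * v y ^ 2 := by
  have h1 := (h.summable_mul_sq hv x).hasSum
  have h2 := (h1.sub (hm.mul_left (2 * m))).add ((h.conservation x).mul_left (m ^ 2))
  have h3 := h2.nonneg fun y => by
    have := mul_nonneg (h.nonneg y x) (sq_nonneg (v y - m))
    nlinarith
  linarith

/-- Stationarity of `π` applied to `v ^ 2`. All terms are nonnegative, so the double sum may be
taken in either order; one order uses balance and conservation, the other is the claim. -/
theorem hasSum_dirichlet (h : IsReversibleChain K π) {v : V → ℝ} {s : ℝ}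
    (hv : HasSum (fun x => π x * v x * v x) s) :
    HasSum (fun x => π x * ∑' y, K y x * v y ^ 2) s := by
  have hf : ∀ y x, π x * (K y x * v y ^ 2) = K x y * (π y * v y * v y) := fun y x => by
    have := h.balance x y
    linear_combination (-v y ^ 2) * this
  have h1 : ∀ y, HasSum (fun x => π x * (K y x * v y ^ 2)) (π y * v y * v y) := fun y => by
    simpa only [hf, one_mul] using (h.conservation y).mul_right (π y * v y * v y)
  have hs : Summable fun p : V × V => π p.2 * (K p.1 p.2 * v p.1 ^ 2) := by
    rw [summable_prod_of_nonneg]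
    · refine ⟨fun y => (h1 y).summable, ?_⟩
      simpa only [(h1 _).tsum_eq] using hv.summable
    · exact fun p => mul_nonneg (h.pos _).le (mul_nonneg (h.nonneg _ _) (sq_nonneg _))
  have h2 : HasSum (fun p : V × V => π p.2 * (K p.1 p.2 * v p.1 ^ 2)) s := by
    have := hs.hasSum.prod_fiberwise h1
    rw [hv.unique this]
    exact hs.hasSum
  have h3 : HasSum (fun p : V × V => π p.1 * (K p.2 p.1 * v p.2 ^ 2)) s :=
    ((Equiv.prodComm V V).hasSum_iff (f := fun p : V × V => π p.2 * (K p.1 p.2 * v p.1 ^ 2))).mpr h2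
  exact h3.prod_fiberwise fun x => ((h.summable_mul_sq hv.summable x).hasSum.mul_left (π x))

theorem abs_eigenvalue_le_one (h : IsReversibleChain K π) {v : V → ℝ} {s k : ℝ} (hs : 0 < s)
    (hv : HasSum (fun x => π x * v x * v x) s)
    (hk : ∀ x, HasSum (fun y => K y x * v y) (k * v x)) : |k| ≤ 1 := by
  have h1 : k ^ 2 * s ≤ s := by
    refine hasSum_le (fun x => ?_) (hv.mul_left (k ^ 2)) (h.hasSum_dirichlet hv)
    have := mul_le_mul_of_nonneg_left (h.sq_le_of_hasSum hv.summable (hk x)) (h.pos x).le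
    linarith
  rw [← sq_le_one_iff_abs_le_one]
  nlinarith

end IsReversibleChain

/-- The matrix `Φ⁻¹ K Φ`. -/
def symmetrized {V : Type*} (K : V → V → ℝ) (π : V → ℝ) (x y : V) : ℝ :=
  1 / Real.sqrt (π x) * K x y * Real.sqrt (π y)

section

variable {V : Type*} {K : V → V → ℝ} {π : V → ℝ}

theorem symmetrized_eq (h : IsReversibleChain K π) (x y : V) :
    symmetrized K π x y = Real.sqrt (π x) * K y x / Real.sqrt (π y) := by
  have hx := Real.sqrt_pos.mpr (h.pos x)
  have hy := Real.sqrt_pos.mpr (h.pos y)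
  have h1 := Real.sq_sqrt (h.pos x).le
  have h2 := Real.sq_sqrt (h.pos y).le
  have := h.balance x y
  rw [← h1, ← h2] at this
  unfold symmetrized
  field_simp
  linear_combination this

/-- Symmetry gives two expressions for the same entry, in which the square roots cancel on
multiplication. Since `K ≤ 1`, rows are then square summable and define vectors of `L2 V`. -/
theorem symmetrized_sq (h : IsReversibleChain K π) (x y : V) :
    symmetrized K π x y ^ 2 = K x y * K y x := by
  rw [sq]
  nth_rw 2 [symmetrized_eq h]
  have hx := Real.sqrt_pos.mpr (h.pos x)
  have hy := Real.sqrt_pos.mpr (h.pos y)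
  unfold symmetrized
  field_simp

theorem summable_symmetrized_sq (h : IsReversibleChain K π) (x : V) :
    Summable fun y => symmetrized K π x y ^ 2 := by
  refine Summable.of_nonneg_of_le (fun y => sq_nonneg _) (fun y => ?_) (h.conservation x).summable
  rw [symmetrized_sq h]
  exact mul_le_of_le_one_left (h.nonneg _ _) (h.le_one _ _)

end

namespace HasEigenbasis

variable {V : Type*} [DecidableEq V] {K : V → V → ℝ} {π κ : V → ℝ} {v : V → V → ℝ} {d : V → ℝ}

theorem abs_le_one (hE : HasEigenbasis K π κ v d) (h : IsReversibleChain K π) (n : V) :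
    |κ n| ≤ 1 := by
  have := hE.orthogonal n n
  rw [if_pos rfl] at this
  have hd := hE.norm_pos n
  exact h.abs_eigenvalue_le_one (by positivity) this (hE.left_eigen n)

theorem hasSum_phiHat_mul (hE : HasEigenbasis K π κ v d) (h : IsReversibleChain K π) (n m : V) :
    HasSum (fun x => phiHat π v d n x * phiHat π v d m x) (if n = m then 1 else 0) := by
  have := (hE.orthogonal n m).mul_left (d n * d m)
  convert! this using 1
  · ext x
    have h1 := Real.sq_sqrt (h.pos x).le
    unfold phiHat
    linear_combination (d n * v n x * d m * v m x) * h1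
  · have hd := hE.norm_pos n
    split_ifs with hnm
    · subst hnm
      field_simp
    · simp

theorem hasSum_symmetrized (hE : HasEigenbasis K π κ v d) (h : IsReversibleChain K π) (n x : V) :
    HasSum (fun y => symmetrized K π x y * phiHat π v d n y) (κ n * phiHat π v d n x) := by
  have := (hE.left_eigen n x).mul_left (Real.sqrt (π x) * d n)
  convert! this using 1
  · ext y
    have hy := Real.sqrt_pos.mpr (h.pos y)
    rw [symmetrized_eq h, phiHat]
    field_simp
  · rw [phiHat]
    ring

end HasEigenbasis

/-! ### Orthonormal bases of `ℓ²` with real coordinates -/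

section RealBasis

variable {V : Type*}

/-- The square summable real function `f` as an element of `ℓ²`. -/
def realVec (f : V → ℝ) (hf : Summable fun x => f x ^ 2) : L2 V :=
  ⟨fun x => (f x : ℂ), memℓp_gen (by simpa using hf)⟩

theorem realVec_apply (f : V → ℝ) (hf : Summable fun x => f x ^ 2) (x : V) :
    (realVec f hf : V → ℂ) x = (f x : ℂ) := rfl

theorem hasSum_apply {ι : Type*} {f : ι → L2 V} {g : L2 V} (h : HasSum f g) (x : V) :
    HasSum (fun i => (f i : V → ℂ) x) ((g : V → ℂ) x) :=
  h.mapL (lp.evalCLM ℂ (fun _ : V => ℂ) 2 x)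

theorem inner_realVec (f : V → ℝ) (hf : Summable fun x => f x ^ 2) (ψ : L2 V) :
    HasSum (fun x => (f x : ℂ) * (ψ : V → ℂ) x) (inner ℂ (realVec f hf) ψ) := by
  have := lp.hasSum_inner (𝕜 := ℂ) (realVec f hf) ψ
  simpa [realVec_apply, mul_comm] using this

theorem inner_basis {φ : V → V → ℝ} {b : HilbertBasis V ℂ (L2 V)}
    (hb : ∀ n x, (b n : V → ℂ) x = (φ n x : ℂ)) (n : V) (ψ : L2 V) :
    HasSum (fun z => (φ n z : ℂ) * (ψ : V → ℂ) z) (inner ℂ (b n) ψ) := by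
  have := lp.hasSum_inner (𝕜 := ℂ) (b n) ψ
  simpa [hb, mul_comm] using this

variable [DecidableEq V]

theorem inner_ket_left (x : V) (ψ : L2 V) : inner ℂ (ket x) ψ = (ψ : V → ℂ) x := by
  rw [ket, lp.inner_single_left]
  simp

theorem ket_apply (x y : V) : (ket x : V → ℂ) y = if x = y then 1 else 0 := by
  rw [ket, lp.single_apply, Pi.single_apply]
  simp only [eq_comm]

theorem orthonormal_realVec {φ : V → V → ℝ} (hs : ∀ n, Summable fun x => φ n x ^ 2)
    (ho : ∀ n m, HasSum (fun x => φ n x * φ m x) (if n = m then 1 else 0)) :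
    Orthonormal ℂ fun n => realVec (φ n) (hs n) := by
  rw [orthonormal_iff_ite]
  intro n m
  refine (inner_realVec (φ n) (hs n) (realVec (φ m) (hs m))).unique ?_
  simp only [realVec_apply]
  convert! Complex.hasSum_ofReal.mpr (ho n m) using 1
  · ext x
    push_cast
    rfl
  · split_ifs <;> simp

/-- Completeness says that `ket x` is the sum of the vectors `φ n` with coefficients `φ n x`; a
vector orthogonal to all `φ n` is then orthogonal to every `ket x`, hence zero. -/
theorem orthogonal_eq_bot_of_complete {φ : V → V → ℝ} (hs : ∀ n, Summable fun x => φ n x ^ 2)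
    (ho : ∀ n m, HasSum (fun x => φ n x * φ m x) (if n = m then 1 else 0))
    (hc : ∀ x y, HasSum (fun n => φ n x * φ n y) (if x = y then 1 else 0)) :
    (Submodule.span ℂ (Set.range fun n => realVec (φ n) (hs n)))ᗮ = ⊥ := by
  rw [Submodule.eq_bot_iff]
  intro ψ hψ
  rw [Submodule.mem_orthogonal] at hψ
  have hO := orthonormal_realVec hs ho
  have hz : ∀ n, inner ℂ (realVec (φ n) (hs n)) ψ = 0 := fun n =>
    hψ _ (Submodule.subset_span ⟨n, rfl⟩)
  ext x
  have hx : Summable fun n => φ n x ^ 2 := by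
    simpa only [sq] using (hc x x).summable
  -- Completeness at `y = x` makes the coefficients square summable in `n`, so the series converges
  -- in norm; the pointwise identity alone would not allow passing to inner products.
  have hsum := hO.orthogonalFamily.hasSum_linearIsometry (realVec (fun n => φ n x) hx)
  set s := hO.orthogonalFamily.linearIsometry (realVec (fun n => φ n x) hx)
  simp only [LinearIsometry.toSpanSingleton_apply, realVec_apply] at hsum
  have hket : s = ket x := by
    ext y
    refine (hasSum_apply hsum y).unique ?_
    rw [ket_apply]
    convert! Complex.hasSum_ofReal.mpr (hc x y) using 1
    · ext n
      push_cast
      rfl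
    · split_ifs <;> simp
  have h0 : inner ℂ (ket x) ψ = 0 := by
    rw [← hket]
    have h1 := hsum.mapL (innerSL ℂ ψ)
    simp only [innerSL_apply_apply, inner_smul_right] at h1
    have h2 : ∀ n, inner ℂ ψ (realVec (φ n) (hs n)) = 0 := fun n => by
      rw [← inner_conj_symm, hz, map_zero]
    simp only [h2, mul_zero] at h1
    rw [← inner_conj_symm, h1.unique hasSum_zero, map_zero]
  rw [← inner_ket_left, h0]
  rfl

theorem exists_hilbertBasis {φ : V → V → ℝ}
    (ho : ∀ n m, HasSum (fun x => φ n x * φ m x) (if n = m then 1 else 0))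
    (hc : ∀ x y, HasSum (fun n => φ n x * φ n y) (if x = y then 1 else 0)) :
    ∃ b : HilbertBasis V ℂ (L2 V), ∀ n x, (b n : V → ℂ) x = (φ n x : ℂ) := by
  have hs : ∀ n, Summable fun x => φ n x ^ 2 := fun n => by
    simpa only [sq] using (ho n n).summable
  refine ⟨HilbertBasis.mkOfOrthogonalEqBot (orthonormal_realVec hs ho)
    (orthogonal_eq_bot_of_complete hs ho hc), fun n x => ?_⟩
  rw [HilbertBasis.coe_mkOfOrthogonalEqBot]
  rfl

theorem inner_basis_ket {φ : V → V → ℝ} {b : HilbertBasis V ℂ (L2 V)}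
    (hb : ∀ n x, (b n : V → ℂ) x = (φ n x : ℂ)) (n x : V) :
    inner ℂ (b n) (ket x) = (φ n x : ℂ) := by
  rw [← inner_conj_symm, inner_ket_left, hb, Complex.conj_ofReal]

end RealBasis

/-! ### Operators that are diagonal in a Hilbert basis -/

section Diagonal

variable {V E : Type*} [NormedAddCommGroup E] [InnerProductSpace ℂ E] (b : HilbertBasis V ℂ E)

/-- The operator with the bounded eigenvalues `c n` in the basis `b`. -/
def diagonalOperator (c : V → ℂ) {C : ℝ} (hC0 : 0 ≤ C) (hC : ∀ n, ‖c n‖ ≤ C) : E →L[ℂ] E :=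
  (b.repr.symm.toContinuousLinearEquiv : L2 V →L[ℂ] E) ∘L
    (lp.mapCLM 2 (fun n => c n • ContinuousLinearMap.id ℂ ℂ) hC0 (fun n => by
      simpa [norm_smul] using hC n)) ∘L
    (b.repr.toContinuousLinearEquiv : E →L[ℂ] L2 V)

theorem repr_diagonalOperator (c : V → ℂ) {C : ℝ} (hC0 : 0 ≤ C) (hC : ∀ n, ‖c n‖ ≤ C) (ψ : E) (n : V) :
    (b.repr (diagonalOperator b c hC0 hC ψ) : V → ℂ) n = c n * (b.repr ψ : V → ℂ) n := by
  simp [diagonalOperator, lp.mapCLM]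

theorem diagonalOperator_apply (c : V → ℂ) {C : ℝ} (hC0 : 0 ≤ C) (hC : ∀ n, ‖c n‖ ≤ C) (n : V) :
    diagonalOperator b c hC0 hC (b n) = c n • b n := by
  classical
  apply b.repr.injective
  ext m
  rw [repr_diagonalOperator, map_smul, b.repr_self]
  simp only [lp.coeFn_smul, Pi.smul_apply, lp.single_apply, Pi.single_apply, smul_eq_mul]
  split_ifs with h
  · rw [h]
  · simp

variable {b}

/-- Continuity of `T` lets it act termwise on the basis expansion of `ψ`, so self-adjointness, which
is deduced from this later, is not presupposed. -/
theorem inner_eigen {T : E →L[ℂ] E} {e : V → ℝ} (h : ∀ n, T (b n) = (e n : ℂ) • b n) (ψ : E)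
    (n : V) : inner ℂ (b n) (T ψ) = (e n : ℂ) * inner ℂ (b n) ψ := by
  classical
  have h1 := ((b.hasSum_repr ψ).mapL T).mapL (innerSL ℂ (b n))
  simp only [map_smul, h, innerSL_apply_apply, smul_eq_mul,
    orthonormal_iff_ite.mp b.orthonormal] at h1
  rw [← b.repr_apply_apply ψ, mul_comm]
  refine h1.unique ?_
  convert! hasSum_ite_eq n ((b.repr ψ : V → ℂ) n * (e n : ℂ)) using 2 with m
  by_cases hm : m = n
  · simp [hm]
  · simp [hm, Ne.symm hm]

theorem isPositive_of_eigen [CompleteSpace E] {T : E →L[ℂ] E} {e : V → ℝ} (he : ∀ n, 0 ≤ e n)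
    (h : ∀ n, T (b n) = (e n : ℂ) • b n) : T.IsPositive := by
  have key : ∀ ψ χ, HasSum (fun n => (e n : ℂ) * (inner ℂ ψ (b n) * inner ℂ (b n) χ))
      (inner ℂ ψ (T χ)) := fun ψ χ => by
    have := b.hasSum_inner_mul_inner ψ (T χ)
    simp only [inner_eigen h] at this
    convert! this using 2
    ring
  rw [ContinuousLinearMap.isPositive_iff]
  constructor
  · intro ψ χ
    have h1 := (key χ ψ).star
    have h2 := key ψ χ
    simp only [ContinuousLinearMap.coe_coe]
    rw [← inner_conj_symm]
    refine h1.unique ?_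
    convert! h2 using 2 with n
    simp [mul_comm]
  · intro ψ
    have h1 : inner ℂ (T ψ) ψ = starRingEnd ℂ (inner ℂ ψ (T ψ)) := (inner_conj_symm _ _).symm
    have h2 : HasSum (fun n => ((e n * ‖(inner ℂ (b n) ψ : ℂ)‖ ^ 2 : ℝ) : ℂ))
        (inner ℂ ψ (T ψ)) := by
      convert! key ψ ψ using 2 with n
      rw [← inner_conj_symm ψ (b n)]
      rw [mul_comm (starRingEnd ℂ _), Complex.mul_conj, Complex.normSq_eq_norm_sq]
      push_cast
      rfl
    have h3 := Complex.hasSum_re h2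
    have h4 := Complex.hasSum_im h2
    simp only [Complex.ofReal_re, Complex.ofReal_im] at h3 h4
    rw [h1, Complex.nonneg_iff]
    simp only [Complex.conj_re, Complex.conj_im]
    exact ⟨h3.nonneg fun n => mul_nonneg (he n) (sq_nonneg _), by
      rw [h4.unique hasSum_zero, neg_zero]⟩

theorem exp_apply_eigen [CompleteSpace E] {T : E →L[ℂ] E} {ψ : E} {c : ℂ} (h : T ψ = c • ψ) :
    NormedSpace.exp T ψ = Complex.exp c • ψ := by
  have hpow : ∀ k : ℕ, (T ^ k) ψ = c ^ k • ψ := fun k => by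
    induction k with
    | zero => simp
    | succ k ih =>
      rw [pow_succ, mul_apply_eq_comp, h, map_smul, ih, smul_smul, pow_succ']
  have h1 := (NormedSpace.exp_series_hasSum_exp' (𝕂 := ℂ) T).mapL
    (ContinuousLinearMap.apply ℂ E ψ)
  have h2 := (NormedSpace.exp_series_hasSum_exp' (𝕂 := ℂ) c).smul_const ψ
  rw [← Complex.exp_eq_exp_ℂ] at h2
  refine h1.unique ?_
  convert! h2 using 2 with k
  simp [hpow, smul_smul]

end Diagonal

/-! ### Absolutely convergent trigonometric sums -/

theorem phase_eq_exp_mul_I (k : ℝ) (ℓ : ℕ) :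
    phase k ℓ = Complex.exp (((-(1 - k) * ℓ : ℝ) : ℂ) * Complex.I) := by
  unfold phase
  congr 1
  push_cast
  ring

theorem norm_phase (k : ℝ) (ℓ : ℕ) : ‖phase k ℓ‖ = 1 := by
  rw [phase_eq_exp_mul_I, Complex.norm_exp_ofReal_mul_I]

theorem phase_mul_conj_re (k k' : ℝ) (ℓ : ℕ) :
    (phase k ℓ * starRingEnd ℂ (phase k' ℓ)).re = Real.cos ((k - k') * ℓ) := by
  rw [phase_eq_exp_mul_I, phase_eq_exp_mul_I, ← Complex.exp_conj, ← Complex.exp_add,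
    ← Complex.exp_ofReal_mul_I_re]
  congr 2
  simp
  ring

theorem phase_pow (k : ℝ) (ℓ : ℕ) : phase k ℓ = phase k 1 ^ ℓ := by
  unfold phase
  rw [← Complex.exp_nat_mul]
  congr 1
  push_cast
  ring

section TrigSum

variable {V : Type*} {κ w : V → ℝ}

theorem summable_pair (hw : Summable w) (c : V × V → ℝ) (hc : ∀ p, |c p| ≤ 1) :
    Summable fun p : V × V => c p * (w p.1 * w p.2) := by
  have := hw.norm.mul_norm hw.norm
  refine Summable.of_norm_bounded this fun p => ?_
  have h := mul_le_mul_of_nonneg_right (hc p) (abs_nonneg (w p.1 * w p.2))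
  simpa [abs_mul] using h

/-- `A` times its conjugate is an absolutely convergent double series. The total is real, so real
parts may be taken termwise, and they are cosines of frequency differences. -/
theorem normSq_trigSum (hw : Summable w) {A : ℂ} (ℓ : ℕ)
    (hA : HasSum (fun n => phase (κ n) ℓ * (w n : ℂ)) A) :
    HasSum (fun p : V × V => Real.cos ((κ p.1 - κ p.2) * ℓ) * (w p.1 * w p.2)) (‖A‖ ^ 2) := by
  have hn : Summable fun n => ‖phase (κ n) ℓ * (w n : ℂ)‖ := by
    simpa [norm_phase] using hw.norm
  have hn' : Summable fun n => ‖starRingEnd ℂ (phase (κ n) ℓ) * (w n : ℂ)‖ := by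
    simpa [norm_phase] using hw.norm
  have hA' : HasSum (fun n => starRingEnd ℂ (phase (κ n) ℓ) * (w n : ℂ)) (starRingEnd ℂ A) := by
    have := hA.mapL (Complex.conjCLE : ℂ →L[ℝ] ℂ)
    simpa using this
  have h1 : HasSum (fun p : V × V => (phase (κ p.1) ℓ * (w p.1 : ℂ)) *
      (starRingEnd ℂ (phase (κ p.2) ℓ) * (w p.2 : ℂ))) (A * starRingEnd ℂ A) := by
    have := tsum_mul_tsum_of_summable_norm hn hn'
    rw [hA.tsum_eq, hA'.tsum_eq] at this
    rw [this]
    exact (summable_mul_of_summable_norm hn hn').hasSum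
  have h2 := Complex.hasSum_re h1
  rw [Complex.mul_conj, Complex.ofReal_re, Complex.normSq_eq_norm_sq] at h2
  have h3 : ∀ p : V × V, ((phase (κ p.1) ℓ * (w p.1 : ℂ)) *
      (starRingEnd ℂ (phase (κ p.2) ℓ) * (w p.2 : ℂ))).re =
      Real.cos ((κ p.1 - κ p.2) * ℓ) * (w p.1 * w p.2) := fun p => by
    rw [← phase_mul_conj_re, ← Complex.re_mul_ofReal]
    congr 1
    push_cast
    ring
  simpa only [h3] using h2

/-- The square of indices splits into the diagonal and two triangles that the swap interchanges. -/
theorem tsum_pair_eq [LinearOrder V] {f : V × V → ℝ} (hf : Summable f)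
    (hs : ∀ p, f p.swap = f p) :
    ∑' p, f p = ∑' n, f (n, n) + 2 * ∑' p : {p : V × V // p.2 < p.1}, f p := by
  let e : {p : V × V // p.2 < p.1} ≃ {p : V × V // p.1 < p.2} :=
    (Equiv.prodComm V V).subtypeEquiv fun p => by simp
  let g : V ≃ {p : V × V // p.1 = p.2} :=
    ⟨fun n => ⟨(n, n), rfl⟩, fun p => p.1.1, fun n => rfl, fun ⟨⟨a, b⟩, h⟩ => by
      simp only at h
      subst h
      rfl⟩
  have h1 : ∑' p : {p : V × V // p.1 < p.2}, f p = ∑' p : {p : V × V // p.2 < p.1}, f p := by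
    rw [← e.tsum_eq]
    exact tsum_congr fun p => hs p
  have h2 : ∑' p : {p : V × V // p.1 = p.2}, f p = ∑' n, f (n, n) := by
    rw [← g.tsum_eq]
    rfl
  have h3 : f = fun p => Set.indicator {p : V × V | p.1 = p.2} f p +
      (Set.indicator {p : V × V | p.1 < p.2} f p + Set.indicator {p : V × V | p.2 < p.1} f p) := by
    ext p
    simp only [Set.indicator_apply, Set.mem_ofPred_eq]
    rcases lt_trichotomy p.1 p.2 with h | h | h
    · simp [h, h.ne, h.not_gt]
    · simp [h]
    · simp [h, h.ne', h.not_gt]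
  have hi : ∀ s : Set (V × V), Summable (s.indicator f) := fun s => hf.indicator s
  conv_lhs => rw [h3]
  rw [(hi _).tsum_add ((hi _).add (hi _)), (hi _).tsum_add (hi _),
    ← tsum_subtype, ← tsum_subtype, ← tsum_subtype]
  erw [h1, h2]
  rw [two_mul]
  rfl

/-- For `θ ≠ 0` the sums are real parts of geometric sums bounded by `2 / ‖z - 1‖`. The bound on `θ`
excludes nonzero multiples of `2 * π`, which would also give `z = 1`. -/
theorem tendsto_average_cos {θ : ℝ} (hθ : |θ| ≤ 2) :
    Filter.Tendsto
      (fun T : ℕ => 1 / (T : ℝ) * ∑ ℓ ∈ Finset.range (T + 1), Real.cos (θ * ℓ))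
      Filter.atTop (nhds (if θ = 0 then 1 else 0)) := by
  have hinv : Filter.Tendsto (fun T : ℕ => 1 / (T : ℝ)) Filter.atTop (nhds 0) :=
    tendsto_one_div_atTop_nhds_zero_nat
  split_ifs with h
  · subst h
    -- There are `T + 1` summands but the divisor is `T`, so for `θ = 0` the average is `1 + 1 / T`.
    have h1 : Filter.Tendsto (fun T : ℕ => 1 + 1 / (T : ℝ)) Filter.atTop (nhds (1 + 0)) :=
      tendsto_const_nhds.add hinv
    rw [add_zero] at h1
    refine h1.congr' ?_
    filter_upwards [Filter.eventually_gt_atTop 0] with T hT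
    have : (T : ℝ) ≠ 0 := by positivity
    simp
    field_simp
  · set z := Complex.exp (θ * Complex.I) with hz
    have hz1 : z ≠ 1 := by
      intro hz1
      have hre : Real.cos θ = 1 := by
        rw [← Complex.exp_ofReal_mul_I_re, ← hz, hz1, Complex.one_re]
      have hpi := Real.pi_gt_three
      rw [abs_le] at hθ
      exact h ((Real.cos_eq_one_iff_of_lt_of_lt (by linarith) (by linarith)).mp hre)
    have hb : ∀ T : ℕ, |∑ ℓ ∈ Finset.range (T + 1), Real.cos (θ * ℓ)| ≤ 2 / ‖z - 1‖ := fun T => by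
      have h1 : ∑ ℓ ∈ Finset.range (T + 1), Real.cos (θ * ℓ) =
          (∑ ℓ ∈ Finset.range (T + 1), z ^ ℓ).re := by
        rw [Complex.re_sum]
        refine Finset.sum_congr rfl fun ℓ _ => ?_
        rw [hz, ← Complex.exp_nat_mul, ← Complex.exp_ofReal_mul_I_re]
        congr 2
        push_cast
        ring
      rw [h1]
      refine (Complex.abs_re_le_norm _).trans ?_
      rw [geom_sum_eq hz1, norm_div]
      gcongr
      refine (norm_sub_le _ _).trans ?_
      rw [norm_pow, hz, Complex.norm_exp_ofReal_mul_I]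
      norm_num
    have h2 : Filter.Tendsto (fun T : ℕ => 1 / (T : ℝ) * (2 / ‖z - 1‖)) Filter.atTop (nhds 0) := by
      simpa using hinv.mul_const (2 / ‖z - 1‖)
    refine squeeze_zero_norm (fun T => ?_) h2
    rw [norm_mul, Real.norm_eq_abs, Real.norm_eq_abs, abs_of_nonneg (by positivity)]
    gcongr
    exact hb T

/-- The uniform bound for dominated convergence: `(T + 1) / T ≤ 2` for `T ≥ 1`, while at `T = 0` the
prefactor `1 / 0` is `0`. -/
theorem abs_average_cos_le (θ : ℝ) (T : ℕ) :
    |1 / (T : ℝ) * ∑ ℓ ∈ Finset.range (T + 1), Real.cos (θ * ℓ)| ≤ 2 := by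
  rcases Nat.eq_zero_or_pos T with rfl | hT
  · simp
  have h1 : |∑ ℓ ∈ Finset.range (T + 1), Real.cos (θ * ℓ)| ≤ T + 1 := by
    refine (Finset.abs_sum_le_sum_abs _ _).trans ?_
    refine (Finset.sum_le_card_nsmul _ _ 1 fun ℓ _ => Real.abs_cos_le_one _).trans ?_
    simp
  have hT' : (1 : ℝ) ≤ T := by exact_mod_cast hT
  rw [abs_mul, abs_of_nonneg (by positivity)]
  calc 1 / (T : ℝ) * _ ≤ 1 / (T : ℝ) * (T + 1) := by gcongr
    _ ≤ 2 := by
      rw [one_div_mul_eq_div, div_le_iff₀ (by linarith)]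
      linarith

theorem tendsto_average_trigSum (hw : Summable w) (hκ : ∀ n, |κ n| ≤ 1) {A : ℕ → ℂ}
    (hA : ∀ ℓ, HasSum (fun n => phase (κ n) ℓ * (w n : ℂ)) (A ℓ)) :
    Filter.Tendsto (fun T : ℕ => 1 / (T : ℝ) * ∑ ℓ ∈ Finset.range (T + 1), ‖A ℓ‖ ^ 2)
      Filter.atTop (nhds (∑' p : {p : V × V // κ p.1 = κ p.2}, w p.1.1 * w p.1.2)) := by
  classical
  have h1 : ∀ T : ℕ, 1 / (T : ℝ) * ∑ ℓ ∈ Finset.range (T + 1), ‖A ℓ‖ ^ 2 =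
      ∑' p : V × V, (1 / (T : ℝ) * ∑ ℓ ∈ Finset.range (T + 1),
        Real.cos ((κ p.1 - κ p.2) * ℓ)) * (w p.1 * w p.2) := fun T => by
    have := (hasSum_sum (s := Finset.range (T + 1))
      fun ℓ _ => normSq_trigSum hw ℓ (hA ℓ)).mul_left (1 / (T : ℝ))
    rw [← this.tsum_eq]
    refine tsum_congr fun p => ?_
    rw [mul_assoc, Finset.sum_mul]
  simp only [h1]
  have h2 : ∑' p : {p : V × V // κ p.1 = κ p.2}, w p.1.1 * w p.1.2 =
      ∑' p : V × V, (if κ p.1 - κ p.2 = 0 then 1 else 0) * (w p.1 * w p.2) := by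
    refine (tsum_subtype {p : V × V | κ p.1 = κ p.2} fun p => w p.1 * w p.2).trans ?_
    refine tsum_congr fun p => ?_
    simp [Set.indicator_apply, sub_eq_zero]
  rw [h2]
  refine tendsto_tsum_of_dominated_convergence
    (bound := fun p => 2 * (‖w p.1‖ * ‖w p.2‖)) ?_ (fun p => ?_) ?_
  · have := (hw.norm.mul_norm hw.norm).mul_left 2
    simpa using this
  · refine Filter.Tendsto.mul_const _ (tendsto_average_cos ?_)
    have h3 := abs_le.mp (hκ p.1)
    have h4 := abs_le.mp (hκ p.2)
    rw [abs_le]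
    constructor <;> linarith
  · refine Filter.Eventually.of_forall fun T p => ?_
    rw [norm_mul, norm_mul (w p.1)]
    refine mul_le_mul_of_nonneg_right ?_ (by positivity)
    exact abs_average_cos_le _ _

theorem eq_of_mapClusterPt_of_tendsto {X Y : Type*} [TopologicalSpace Y] [T2Space Y]
    {F : Filter X} {u : X → Y} {x y : Y} (h : MapClusterPt x F u)
    (hu : Filter.Tendsto u F (nhds y)) : x = y := by
  have : (nhds x ⊓ nhds y).NeBot := by
    have h' : (nhds x ⊓ Filter.map u F).NeBot := h
    exact h'.mono (inf_le_inf_left _ hu)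
  exact eq_of_nhds_neBot this

/-- An almost periodic sequence that converges is constant. -/
theorem normSq_trigSum_of_tendsto (hw : Summable w) {A : ℕ → ℂ}
    (hA : ∀ ℓ, HasSum (fun n => phase (κ n) ℓ * (w n : ℂ)) (A ℓ)) {L : ℝ}
    (hL : Filter.Tendsto (fun ℓ => ‖A ℓ‖ ^ 2) Filter.atTop (nhds L)) (m : ℕ) :
    ‖A m‖ ^ 2 = L := by
  -- The point of the torus `V → Circle` whose powers carry the phases. `A ℓ` extends to a
  -- continuous function on the whole torus because the weights are summable.
  let g : V → Circle := fun n => Circle.exp (-(1 - κ n) * (1 : ℕ))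
  have hg : ∀ n, (g n : ℂ) = phase (κ n) 1 := fun n => by
    rw [phase_eq_exp_mul_I, Circle.coe_exp]
  let F : (V → Circle) → ℝ := fun h => ‖∑' n, (h n : ℂ) * (w n : ℂ)‖ ^ 2
  have hF : Continuous F := by
    have : Continuous fun h : V → Circle => ∑' n, (h n : ℂ) * (w n : ℂ) := by
      refine continuous_tsum (fun n => by fun_prop) hw.norm fun n h => ?_
      rw [norm_mul, Circle.norm_coe, one_mul, Complex.norm_real]
    fun_prop
  have hFg : ∀ ℓ, F (g ^ ℓ) = ‖A ℓ‖ ^ 2 := fun ℓ => by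
    rw [← (hA ℓ).tsum_eq]
    simp only [F, Pi.pow_apply, Circle.coe_pow, hg, ← phase_pow]
  -- By compactness the powers of `g` return arbitrarily close to `1`, so `F (g ^ ℓ * g ^ m)`
  -- clusters at the value for step `m`; the same sequence is a tail of the convergent one, so this
  -- value is `L`.
  have hc := (mapClusterPt_one_atTop_pow g).continuousAt_comp
    (f := fun h => F (h * g ^ m)) (by fun_prop)
  rw [one_mul, hFg] at hc
  refine eq_of_mapClusterPt_of_tendsto hc ?_
  have : ((fun h => F (h * g ^ m)) ∘ fun ℓ : ℕ => g ^ ℓ) = fun ℓ => ‖A (ℓ + m)‖ ^ 2 := by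
    ext ℓ
    simp only [Function.comp, ← pow_add, hFg]
  rw [this]
  exact hL.comp (Filter.tendsto_add_atTop_nat m)

/-- If a trigonometric sum with nonnegative weights of total mass one converges in modulus, only
one frequency occurs in it. -/
theorem frequency_eq_of_tendsto {w : V → ℝ} (hw : HasSum w 1) (hw0 : ∀ n, 0 ≤ w n)
    (hκ : ∀ n, |κ n| ≤ 1) {A : ℕ → ℂ}
    (hA : ∀ ℓ, HasSum (fun n => phase (κ n) ℓ * (w n : ℂ)) (A ℓ)) {L : ℝ}
    (hL : Filter.Tendsto (fun ℓ => ‖A ℓ‖ ^ 2) Filter.atTop (nhds L)) {n m : V}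
    (hn : w n ≠ 0) (hm : w m ≠ 0) : κ n = κ m := by
  have h0 := normSq_trigSum hw.summable 0 (hA 0)
  have h1 := normSq_trigSum hw.summable 1 (hA 1)
  rw [normSq_trigSum_of_tendsto hw.summable hA hL] at h0 h1
  -- Steps `0` and `1` have the same probability. The difference has the nonnegative terms `(1 -
  -- cos) * w * w`, so each of them is zero.
  have h2 := h0.sub h1
  rw [sub_self] at h2
  simp only [Nat.cast_zero, mul_zero, Real.cos_zero, one_mul, Nat.cast_one, mul_one] at h2
  rw [hasSum_zero_iff_of_nonneg] at h2
  · have h3 := congrFun h2 (n, m)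
    simp only [Pi.zero_apply] at h3
    have h4 : Real.cos (κ n - κ m) = 1 := by
      have : w n * w m ≠ 0 := mul_ne_zero hn hm
      have h5 : (1 - Real.cos (κ n - κ m)) * (w n * w m) = 0 := by linarith
      have := (mul_eq_zero.mp h5).resolve_right this
      linarith
    -- Both eigenvalues lie in `[-1, 1]`, so their difference is less than `2 * π` in modulus and a
    -- cosine equal to `1` forces it to vanish.
    have hpi := Real.pi_gt_three
    have h5 := abs_le.mp (hκ n)
    have h6 := abs_le.mp (hκ m)
    have := (Real.cos_eq_one_iff_of_lt_of_lt (by linarith) (by linarith)).mp h4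
    linarith
  · intro p
    have := mul_nonneg (hw0 p.1) (hw0 p.2)
    have h3 := Real.cos_le_one (κ p.1 - κ p.2)
    change 0 ≤ w p.1 * w p.2 - Real.cos (κ p.1 - κ p.2) * (w p.1 * w p.2)
    nlinarith

end TrigSum

/-! ### The quantum chain of an exactly solvable chain -/

section Hamiltonian

variable {V : Type*} {K : V → V → ℝ} {π κ : V → ℝ} {φ : V → V → ℝ}
  {b : HilbertBasis V ℂ (L2 V)}

theorem evolution_apply_basis {H : L2 V →L[ℂ] L2 V}
    (hH : ∀ n, H (b n) = ((1 - κ n : ℝ) : ℂ) • b n) (n : V) (ℓ : ℕ) :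
    (evolution H ^ ℓ) (b n) = phase (κ n) ℓ • b n := by
  have h1 : evolution H (b n) = phase (κ n) 1 • b n := by
    rw [evolution, exp_apply_eigen (c := -Complex.I * ((1 - κ n : ℝ) : ℂ)), phase]
    · simp
    · simp [hH, smul_smul]
  induction ℓ with
  | zero => simp [phase]
  | succ ℓ ih =>
    rw [pow_succ, mul_apply_eq_comp, h1, map_smul, ih, smul_smul, phase_pow (κ n) (ℓ + 1),
      pow_succ', ← phase_pow]

theorem hasSum_evolution {H : L2 V →L[ℂ] L2 V}
    (hH : ∀ n, H (b n) = ((1 - κ n : ℝ) : ℂ) • b n) (ψ : L2 V) (ℓ : ℕ) :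
    HasSum (fun n => (phase (κ n) ℓ * inner ℂ (b n) ψ) • b n) ((evolution H ^ ℓ) ψ) := by
  have h1 := (b.hasSum_repr ψ).mapL (evolution H ^ ℓ)
  simp only [map_smul, evolution_apply_basis hH, smul_smul, b.repr_apply_apply] at h1
  convert! h1 using 3
  rw [mul_comm]

theorem evolution_mem_unitary {H : L2 V →L[ℂ] L2 V} (hH : H.IsPositive) :
    evolution H ∈ unitary (L2 V →L[ℂ] L2 V) := by
  have h1 : -H ∈ selfAdjoint (L2 V →L[ℂ] L2 V) := by
    rw [selfAdjoint.mem_iff, star_neg, hH.isSelfAdjoint.star_eq]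
  have h2 := (selfAdjoint.expUnitary ⟨-H, h1⟩).2
  rw [selfAdjoint.expUnitary_coe] at h2
  simpa [evolution] using h2

variable [DecidableEq V]

theorem hamiltonianMatrix_eq (x y : V) :
    hamiltonianMatrix K π x y = (if x = y then 1 else 0) - symmetrized K π x y := rfl

theorem inner_ket_basis (hb : ∀ n x, (b n : V → ℂ) x = (φ n x : ℂ)) (n x : V) :
    inner ℂ (ket x) (b n) = (φ n x : ℂ) := by
  rw [inner_ket_left, hb]

/-- Parseval's identity for `ket y` and the row of `symmetrized K π` at `x`. By the eigenvalue
equation the coefficients of this row are `κ n * φ n x`. -/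
theorem hasSum_symmetrized_spectral (h : IsReversibleChain K π)
    (hb : ∀ n x, (b n : V → ℂ) x = (φ n x : ℂ))
    (he : ∀ n x, HasSum (fun y => symmetrized K π x y * φ n y) (κ n * φ n x)) (x y : V) :
    HasSum (fun n => κ n * φ n x * φ n y) (symmetrized K π x y) := by
  set r := realVec (symmetrized K π x) (summable_symmetrized_sq h x) with hr
  have h1 : ∀ n, inner ℂ (b n) r = ((κ n * φ n x : ℝ) : ℂ) := fun n => by
    refine (inner_basis hb n r).unique ?_
    have := Complex.hasSum_ofReal.mpr (he n x)
    convert! this using 2 with z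
    rw [hr, realVec_apply]
    push_cast
    ring
  have h2 := b.hasSum_inner_mul_inner (ket y) r
  simp only [h1, inner_ket_basis hb, inner_ket_left] at h2
  rw [hr, realVec_apply] at h2
  rw [← Complex.hasSum_ofReal]
  convert! h2 using 2 with n
  push_cast
  ring

theorem hasSum_hamiltonian_spectral (h : IsReversibleChain K π)
    (hb : ∀ n x, (b n : V → ℂ) x = (φ n x : ℂ))
    (he : ∀ n x, HasSum (fun y => symmetrized K π x y * φ n y) (κ n * φ n x))
    (hc : ∀ x y, HasSum (fun n => φ n x * φ n y) (if x = y then 1 else 0)) (x y : V) :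
    HasSum (fun n => (1 - κ n) * φ n x * φ n y) (hamiltonianMatrix K π x y) := by
  rw [hamiltonianMatrix_eq]
  convert! (hc x y).sub (hasSum_symmetrized_spectral h hb he x y) using 2 with n
  ring

theorem IsHamiltonian.eq {H H' : L2 V →L[ℂ] L2 V} (hH : IsHamiltonian K π H)
    (hH' : IsHamiltonian K π H') : H = H' := by
  refine lp.ext_continuousLinearMap (by simp) fun y => ?_
  ext x
  exact (hH x y).trans (hH' x y).symm

/-- The operator is constructed from its spectrum, where boundedness is just `|κ n| ≤ 1`; its matrix
entries are computed afterwards by Parseval's identity. -/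
theorem exists_isHamiltonian (h : IsReversibleChain K π)
    (hb : ∀ n x, (b n : V → ℂ) x = (φ n x : ℂ))
    (he : ∀ n x, HasSum (fun y => symmetrized K π x y * φ n y) (κ n * φ n x))
    (hc : ∀ x y, HasSum (fun n => φ n x * φ n y) (if x = y then 1 else 0))
    (hκ : ∀ n, |κ n| ≤ 1) :
    ∃ H : L2 V →L[ℂ] L2 V, IsHamiltonian K π H ∧ ∀ n, H (b n) = ((1 - κ n : ℝ) : ℂ) • b n := by
  have hC : ∀ n, ‖((1 - κ n : ℝ) : ℂ)‖ ≤ 2 := fun n => by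
    have := abs_le.mp (hκ n)
    rw [Complex.norm_real, Real.norm_eq_abs, abs_le]
    constructor <;> linarith
  refine ⟨diagonalOperator b _ (by norm_num) hC, fun x y => ?_, diagonalOperator_apply b _ _ hC⟩
  have h1 := b.hasSum_inner_mul_inner (ket x) (diagonalOperator b _ (by norm_num) hC (ket y))
  simp only [inner_eigen (diagonalOperator_apply b _ _ hC), inner_ket_basis hb,
    inner_basis_ket hb] at h1
  rw [inner_ket_left] at h1
  refine h1.unique ?_
  have := Complex.hasSum_ofReal.mpr (hasSum_hamiltonian_spectral h hb he hc x y)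
  convert! this using 2 with n
  push_cast
  ring

theorem hasSum_amplitude {H : L2 V →L[ℂ] L2 V} (hb : ∀ n x, (b n : V → ℂ) x = (φ n x : ℂ))
    (hH : ∀ n, H (b n) = ((1 - κ n : ℝ) : ℂ) • b n) (x y : V) (ℓ : ℕ) :
    HasSum (fun n => phase (κ n) ℓ * (φ n x : ℂ) * (φ n y : ℂ)) (amplitude H x y ℓ) := by
  have h1 := hasSum_apply (hasSum_evolution hH (ket y) ℓ) x
  convert! h1 using 2 with n
  rw [inner_basis_ket hb, lp.coeFn_smul, Pi.smul_apply, hb, smul_eq_mul]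
  ring

end Hamiltonian

/-- If no transition left `y`, every path from `y` would stay there, and no other point could be
reached. -/
theorem IsReversibleChain.exists_pos_of_nontrivial {V : Type*} [Nontrivial V] {K : V → V → ℝ}
    {π : V → ℝ} (h : IsReversibleChain K π) (y : V) : ∃ x, x ≠ y ∧ 0 < K x y := by
  by_contra! hK
  obtain ⟨x, hx⟩ := exists_ne y
  refine hx ?_
  clear hx
  induction h.connected x y with
  | refl => rfl
  | tail _ hs ih =>
    by_contra hc
    rw [ih] at hs
    exact absurd hs (not_lt.mpr (hK _ hc))

theorem spectralSolution {V : Type*} [LinearOrder V] {K : V → V → ℝ} {π κ : V → ℝ}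
    {φ : V → V → ℝ} {H : L2 V →L[ℂ] L2 V} {b : HilbertBasis V ℂ (L2 V)}
    (h : IsReversibleChain K π) (hb : ∀ n x, (b n : V → ℂ) x = (φ n x : ℂ))
    (he : ∀ n x, HasSum (fun y => symmetrized K π x y * φ n y) (κ n * φ n x))
    (hc : ∀ x y, HasSum (fun n => φ n x * φ n y) (if x = y then 1 else 0))
    (hκ : ∀ n, |κ n| ≤ 1) (hH : ∀ n, H (b n) = ((1 - κ n : ℝ) : ℂ) • b n) :
    SpectralSolution K π κ φ H b := by
  have henergy : ∀ n, 0 ≤ 1 - κ n ∧ 1 - κ n ≤ 2 := fun n => by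
    have := abs_le.mp (hκ n)
    constructor <;> linarith
  have hpos : H.IsPositive := isPositive_of_eigen (fun n => (henergy n).1) hH
  have hsqrt : ∀ x, Real.sqrt (π x) ≠ 0 := fun x => (Real.sqrt_pos.mpr (h.pos x)).ne'
  have hA : ∀ x y ℓ, HasSum (fun n => phase (κ n) ℓ * ((φ n x * φ n y : ℝ) : ℂ))
      (amplitude H x y ℓ) := fun x y ℓ => by
    convert! hasSum_amplitude hb hH x y ℓ using 2
    push_cast
    ring
  have hdiag : ∀ x y, Summable fun n => φ n x ^ 2 * φ n y ^ 2 := fun x y => by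
    have := (summable_pair (hc x y).summable (fun _ => 1) (by simp)).comp_injective
      (i := fun n => (n, n)) fun a c hac => (Prod.mk.inj hac).1
    convert! this using 2
    simp only [Function.comp]
    ring
  have hsub : ∀ x y, Summable (fun p : {p : V × V // κ p.1 = κ p.2} =>
      φ p.1.1 x * φ p.1.2 x * φ p.1.1 y * φ p.1.2 y) := fun x y => by
    have := (summable_pair (hc x y).summable (fun _ => 1) (by simp)).subtype
      {p : V × V | κ p.1 = κ p.2}
    convert! this using 2
    simp only [Function.comp]
    ring
  have hav : ∀ x y, Filter.Tendsto
      (fun T : ℕ => 1 / (T : ℝ) * ∑ ℓ ∈ Finset.range (T + 1), ‖amplitude H x y ℓ‖ ^ 2)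
      Filter.atTop (nhds (∑' p : {p : V × V // κ p.1 = κ p.2},
        φ p.1.1 x * φ p.1.2 x * φ p.1.1 y * φ p.1.2 y)) := fun x y => by
    convert! tendsto_average_trigSum (hc x y).summable hκ (hA x y) using 4
    ring
  refine
    { positive := hpos
      unitary := evolution_mem_unitary hpos
      basis_apply := hb
      eigen := hH
      energy := henergy
      right_eigen := fun n x => ?_
      hamiltonian_spectral := hasSum_hamiltonian_spectral h hb he hc
      transition_spectral := fun x y => ?_
      coefficient := inner_basis hb
      solution := fun ψ hψ ℓ => ?_
      amplitude_formula := hasSum_amplitude hb hH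
      probability := fun x y ℓ => ?_
      time_average := fun hinj x y => ?_
      time_average_degenerate := fun x y => ⟨hsub x y, hav x y⟩
      no_limit := fun hV y => ?_ }
  · have := (he n x).mul_left (Real.sqrt (π x))
    convert! this using 1
    · ext y
      have := hsqrt x
      unfold symmetrized
      field_simp
    · ring
  · have := (hasSum_symmetrized_spectral h hb he x y).mul_left
      (Real.sqrt (π x) * (Real.sqrt (π y))⁻¹)
    convert! this using 1
    have := hsqrt x
    have := hsqrt y
    unfold symmetrized
    field_simp
  · have h1 : ψ ℓ = (evolution H ^ ℓ) (ψ 0) := by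
      induction ℓ with
      | zero => simp
      | succ ℓ ih => rw [hψ, ih, pow_succ', mul_apply_eq_comp]
    refine ⟨h1, ?_⟩
    rw [h1]
    exact hasSum_evolution hH (ψ 0) ℓ
  · have h1 := normSq_trigSum (hc x y).summable ℓ (hA x y ℓ)
    have hp : ∀ p : V × V, Real.cos ((κ p.1 - κ p.2) * ℓ) *
        (φ p.1 x * φ p.2 x * φ p.1 y * φ p.2 y) =
        Real.cos ((κ p.1 - κ p.2) * ℓ) * ((φ p.1 x * φ p.1 y) * (φ p.2 x * φ p.2 y)) :=
      fun p => by ring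
    refine ⟨hdiag x y, ?_, ?_⟩
    · simp only [hp]
      exact h1.summable.subtype {p : V × V | p.2 < p.1}
    · rw [← h1.tsum_eq, tsum_pair_eq h1.summable]
      · simp only [hp]
        congr 1
        refine tsum_congr fun n => ?_
        simp only [sub_self, zero_mul, Real.cos_zero]
        ring
      · intro p
        rw [← Real.cos_neg]
        simp only [Prod.fst_swap, Prod.snd_swap]
        ring_nf
  · convert! hav x y using 2
    let g : V ≃ {p : V × V // κ p.1 = κ p.2} :=
      ⟨fun n => ⟨(n, n), rfl⟩, fun p => p.1.1, fun n => rfl, fun p =>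
        Subtype.ext (Prod.ext rfl (hinj p.2))⟩
    rw [← g.tsum_eq]
    refine tsum_congr fun n => ?_
    change _ = φ n x * φ n x * φ n y * φ n y
    ring
  · rintro ⟨L, hL⟩
    obtain ⟨x, hxy, hK⟩ := h.exists_pos_of_nontrivial y
    have hw : HasSum (fun n => φ n y * φ n y) 1 := by simpa using hc y y
    have hfreq := fun n m => frequency_eq_of_tendsto hw (fun n => mul_self_nonneg _) hκ (hA y y)
      hL (n := n) (m := m)
    obtain ⟨m, hm⟩ : ∃ m, φ m y ≠ 0 := by
      by_contra! h0
      simp only [h0, mul_zero] at hw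
      exact zero_ne_one (hasSum_zero.unique hw)
    have h1 := (hc x y).mul_left (κ m)
    rw [if_neg hxy, mul_zero] at h1
    -- Every `n` with `φ n y ≠ 0` has the eigenvalue `κ m`, so the spectral sum is `κ m` times the
    -- completeness sum, which vanishes for `x ≠ y`. But `x` was chosen with `K x y > 0`.
    have h2 : symmetrized K π x y = 0 := by
      refine (hasSum_symmetrized_spectral h hb he x y).unique ?_
      convert! h1 using 2 with n
      by_cases hn : φ n y = 0
      · simp [hn]
      · rw [hfreq n m (mul_self_ne_zero.mpr hn) (mul_self_ne_zero.mpr hm)]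
        ring
    have h3 := Real.sqrt_pos.mpr (h.pos x)
    have h4 := Real.sqrt_pos.mpr (h.pos y)
    have : 0 < symmetrized K π x y := by
      unfold symmetrized
      positivity
    exact this.ne' h2

theorem HasEigenbasis.quantumSolvable {V : Type*} [LinearOrder V] {K : V → V → ℝ} {π κ : V → ℝ}
    {v : V → V → ℝ} {d : V → ℝ} (hE : HasEigenbasis K π κ v d) (h : IsReversibleChain K π) :
    QuantumSolvable K π κ (phiHat π v d) := by
  obtain ⟨b, hb⟩ := exists_hilbertBasis (hE.hasSum_phiHat_mul h) hE.complete
  have he := hE.hasSum_symmetrized h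
  have hκ := hE.abs_le_one h
  obtain ⟨H, hH, hHb⟩ := exists_isHamiltonian h hb he hE.complete hκ
  refine ⟨⟨H, hH, fun H' hH' => hH'.eq hH⟩, fun H' hH' => ⟨b, ?_⟩⟩
  rw [hH'.eq hH]
  exact spectralSolution h hb he hE.complete hκ hHb

/-- Everything about a solvable chain follows from its classical part. -/
theorem solvableChain_of_hasEigenbasis {V : Type*} [LinearOrder V] [Zero V] {K : V → V → ℝ}
    {π κ : V → ℝ} {P : V → V → ℝ} {d : V → ℝ} (hK : ∀ x y, 0 < K x y)
    (h : IsReversibleChain K π) (hE : HasEigenbasis K π κ P d) (hP : ∀ x, P 0 x = 1)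
    (hP0 : ∀ n, P n 0 = 1) : SolvableChain K π κ P d := by
  refine ⟨hK, h, ?_, hP, hP0, hE, hE.quantumSolvable h, fun H hH x ℓ => ?_⟩
  -- The constant function is a left eigenvector, and conservation identifies its eigenvalue as `1`.
  · have := hE.left_eigen 0 0
    simp only [hP, mul_one] at this
    exact this.unique (h.conservation 0)
  · obtain ⟨b, hb⟩ := (hE.quantumSolvable h).2 H hH
    have h1 := hb.amplitude_formula x 0 ℓ
    have hs : (Real.sqrt (π x * π 0) : ℂ) ≠ 0 := by
      rw [Ne, Complex.ofReal_eq_zero]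
      exact (Real.sqrt_pos.mpr (mul_pos (h.pos x) (h.pos 0))).ne'
    have h2 : ∀ n, phase (κ n) ℓ * (phiHat π P d n x : ℂ) * (phiHat π P d n 0 : ℂ) =
        (Real.sqrt (π x * π 0) : ℂ) * (phase (κ n) ℓ * ((d n ^ 2 * P n x : ℝ) : ℂ)) := fun n => by
      rw [phiHat, phiHat, hP0, Real.sqrt_mul (h.pos x).le]
      push_cast
      ring
    simp only [h2] at h1
    have h3 := (summable_mul_left_iff hs).mp h1.summable
    exact ⟨h3, by rw [← tsum_mul_left, h1.tsum_eq]⟩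

/-! ### Chains built by convolution -/

/-- The Cauchy product of two sequences. -/
def cauchyProd (α β : ℕ → ℝ) (n : ℕ) : ℝ := ∑ k ∈ Finset.range (n + 1), α k * β (n - k)

/-- The distribution on `{0, …, N}` with weights proportional to `α x * β (N - x)`. -/
def splitMeasure (α β : ℕ → ℝ) (N x : ℕ) : ℝ := α x * β (N - x) / cauchyProd α β N

section Sums

variable (μ ν : ℕ → ℕ → ℝ) (f : ℕ → ℝ)

/-- A transition consists of two draws: `z` out of `y` is kept, and the remaining `N - z` is divided
anew, `x = z + w`. Exchanging the sums averages a function over one draw at a time. In the other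
types the second draw divides `N - y` (`sum_convII`), or `y` is first enlarged to `y + w` and then
divided (`sum_convIII`). -/
theorem sum_convI {N y : ℕ} (hy : y ≤ N) :
    ∑ x ∈ Finset.range (N + 1), convI μ ν N x y * f x =
      ∑ z ∈ Finset.range (y + 1), ν y z *
        ∑ w ∈ Finset.range (N - z + 1), μ (N - z) w * f (z + w) := by
  simp only [convI, Finset.sum_mul, Finset.mul_sum]
  rw [Finset.sum_comm' (t' := Finset.range (y + 1)) (s' := fun z => Finset.Ico z (N + 1))]
  · refine Finset.sum_congr rfl fun z hz => ?_
    rw [Finset.sum_Ico_eq_sum_range, Nat.sub_add_comm (by simp at hz; omega)]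
    refine Finset.sum_congr rfl fun w _ => ?_
    rw [Nat.add_sub_cancel_left]
    ring
  · intro x z
    simp
    omega

theorem sum_convII {N y : ℕ} (hy : y ≤ N) :
    ∑ x ∈ Finset.range (N + 1), convII μ ν N x y * f x =
      ∑ z ∈ Finset.range (y + 1), ν y z *
        ∑ w ∈ Finset.range (N - y + 1), μ (N - y) w * f (z + w) := by
  simp only [convII, Finset.sum_mul, Finset.mul_sum]
  rw [Finset.sum_comm' (t' := Finset.range (y + 1)) (s' := fun z => Finset.Ico z (N - y + z + 1))]
  · refine Finset.sum_congr rfl fun z hz => ?_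
    rw [Finset.sum_Ico_eq_sum_range]
    refine Finset.sum_congr (by congr 1; omega) fun w _ => ?_
    rw [Nat.add_sub_cancel_left]
    ring
  · intro x z
    simp
    omega

theorem sum_convIII {N y : ℕ} (hy : y ≤ N) :
    ∑ x ∈ Finset.range (N + 1), convIII μ ν N x y * f x =
      ∑ w ∈ Finset.range (N - y + 1), ν (N - y) w *
        ∑ x ∈ Finset.range (y + w + 1), μ (y + w) x * f x := by
  simp only [convIII, Finset.sum_mul, Finset.mul_sum]
  rw [Finset.sum_comm' (t' := Finset.Ico y (N + 1)) (s' := fun z => Finset.range (z + 1))]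
  · rw [Finset.sum_Ico_eq_sum_range, Nat.sub_add_comm hy]
    refine Finset.sum_congr rfl fun w _ => ?_
    rw [Nat.add_sub_cancel_left]
    refine Finset.sum_congr rfl fun x _ => ?_
    ring
  · intro x z
    simp
    omega

theorem hasSum_convInf (μ : ℕ → ℝ) (y : ℕ) {g : ℕ → ℝ}
    (h : ∀ z ≤ y, HasSum (fun w => μ w * f (z + w)) (g z)) :
    HasSum (fun x => convInf μ ν x y * f x) (∑ z ∈ Finset.range (y + 1), ν y z * g z) := by
  have h1 : ∀ z ∈ Finset.range (y + 1),
      HasSum (fun x => if z ≤ x then μ (x - z) * ν y z * f x else 0) (ν y z * g z) := by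
    intro z hz
    have h2 := (h z (by simp at hz; omega)).mul_left (ν y z)
    have hinj : Function.Injective fun w : ℕ => z + w := add_right_injective z
    rw [← hinj.hasSum_iff]
    · convert! h2 using 2 with w
      simp
      ring
    · intro x hx
      rw [if_neg]
      intro hzx
      exact hx ⟨x - z, by simp; omega⟩
  have h3 := hasSum_sum h1
  convert! h3 using 2 with x
  rw [convInf, Finset.sum_mul, ← Finset.sum_filter]
  refine Finset.sum_congr ?_ fun z _ => rfl
  ext z
  simp
  omega

end Sums

section Congr

variable {μ μ' ν ν' : ℕ → ℕ → ℝ}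

theorem convI_congr (hμ : ∀ M w, w ≤ M → μ M w = μ' M w) (hν : ∀ M w, w ≤ M → ν M w = ν' M w)
    {N x y : ℕ} (hx : x ≤ N) : convI μ ν N x y = convI μ' ν' N x y := by
  refine Finset.sum_congr rfl fun z hz => ?_
  simp only [Finset.mem_Icc, le_min_iff] at hz
  rw [hμ _ _ (by omega), hν _ _ (by omega)]

theorem convII_congr (hμ : ∀ M w, w ≤ M → μ M w = μ' M w) (hν : ∀ M w, w ≤ M → ν M w = ν' M w)
    {N x y : ℕ} (hy : y ≤ N) : convII μ ν N x y = convII μ' ν' N x y := by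
  refine Finset.sum_congr rfl fun z hz => ?_
  simp only [Finset.mem_Icc, le_min_iff] at hz
  rw [hμ _ _ (by omega), hν _ _ (by omega)]

theorem convIII_congr (hμ : ∀ M w, w ≤ M → μ M w = μ' M w) (hν : ∀ M w, w ≤ M → ν M w = ν' M w)
    {N x y : ℕ} : convIII μ ν N x y = convIII μ' ν' N x y := by
  refine Finset.sum_congr rfl fun z hz => ?_
  simp only [Finset.mem_Icc, max_le_iff] at hz
  rw [hμ _ _ (by omega), hν _ _ (by omega)]

theorem convInf_congr {μ : ℕ → ℝ} (hν : ∀ M w, w ≤ M → ν M w = ν' M w) (x y : ℕ) :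
    convInf μ ν x y = convInf μ ν' x y := by
  refine Finset.sum_congr rfl fun z hz => ?_
  simp only [Finset.mem_Icc, le_min_iff] at hz
  rw [hν _ _ (by omega)]

end Congr

/-! ### Positivity, conservation and detailed balance of the convolution kernels -/

theorem IsReversibleChain.of_pos {V : Type*} {K : V → V → ℝ} {π : V → ℝ} (hK : ∀ x y, 0 < K x y)
    (hsum : ∀ y, HasSum (fun x => K x y) 1) (hb : ∀ x y, K x y * π y = K y x * π x)
    (hπ : ∀ x, 0 < π x) (ht : HasSum π 1) : IsReversibleChain K π :=
  ⟨fun x y => (hK x y).le, hsum, fun x y => Relation.ReflTransGen.single (hK x y), hb, hπ, ht⟩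

section Positive

variable {α β γ : ℕ → ℝ}

theorem cauchyProd_pos (hα : ∀ n, 0 < α n) (hβ : ∀ n, 0 < β n) (n : ℕ) :
    0 < cauchyProd α β n :=
  Finset.sum_pos (fun _ _ => mul_pos (hα _) (hβ _)) ⟨0, by simp⟩

theorem cauchyProd_comm (α β : ℕ → ℝ) (n : ℕ) : cauchyProd α β n = cauchyProd β α n := by
  unfold cauchyProd
  rw [← Finset.sum_range_reflect]
  refine Finset.sum_congr rfl fun k hk => ?_
  simp only [Finset.mem_range] at hk
  rw [mul_comm]
  congr 2
  omega

theorem splitMeasure_pos (hα : ∀ n, 0 < α n) (hβ : ∀ n, 0 < β n) (N x : ℕ) :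
    0 < splitMeasure α β N x :=
  div_pos (mul_pos (hα _) (hβ _)) (cauchyProd_pos hα hβ N)

theorem sum_splitMeasure (hα : ∀ n, 0 < α n) (hβ : ∀ n, 0 < β n) (N : ℕ) :
    ∑ x ∈ Finset.range (N + 1), splitMeasure α β N x = 1 := by
  simp only [splitMeasure, ← Finset.sum_div]
  exact div_self (cauchyProd_pos hα hβ N).ne'

theorem hasSum_fin {N : ℕ} {f : ℕ → ℝ} {s : ℝ} (h : ∑ x ∈ Finset.range (N + 1), f x = s) :
    HasSum (fun x : Fin (N + 1) => f x) s := by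
  rw [← h, Finset.sum_range]
  exact hasSum_fintype _

theorem convI_pos (hα : ∀ n, 0 < α n) (hβ : ∀ n, 0 < β n) (hγ : ∀ n, 0 < γ n) (N x y : ℕ) :
    0 < convI (splitMeasure β γ) (splitMeasure α β) N x y :=
  Finset.sum_pos (fun _ _ => mul_pos (splitMeasure_pos hβ hγ _ _) (splitMeasure_pos hα hβ _ _))
    ⟨0, by simp⟩

theorem convII_pos (hα : ∀ n, 0 < α n) (hβ : ∀ n, 0 < β n) (hγ : ∀ n, 0 < γ n) {N x y : ℕ}
    (hx : x ≤ N) (hy : y ≤ N) :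
    0 < convII (splitMeasure β γ) (splitMeasure α β) N x y :=
  Finset.sum_pos (fun _ _ => mul_pos (splitMeasure_pos hβ hγ _ _) (splitMeasure_pos hα hβ _ _))
    ⟨min x y, by simp; omega⟩

theorem convIII_pos (hα : ∀ n, 0 < α n) (hβ : ∀ n, 0 < β n) (hγ : ∀ n, 0 < γ n) {N x y : ℕ}
    (hx : x ≤ N) (hy : y ≤ N) :
    0 < convIII (splitMeasure α β) (splitMeasure β γ) N x y :=
  Finset.sum_pos (fun _ _ => mul_pos (splitMeasure_pos hα hβ _ _) (splitMeasure_pos hβ hγ _ _))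
    ⟨N, by simp; omega⟩

theorem convInf_pos (hα : ∀ n, 0 < α n) (hβ : ∀ n, 0 < β n) {s : ℝ} (hs : 0 < s) (x y : ℕ) :
    0 < convInf (fun w => β w / s) (splitMeasure α β) x y :=
  Finset.sum_pos (fun _ _ => mul_pos (div_pos (hβ _) hs) (splitMeasure_pos hα hβ _ _))
    ⟨0, by simp⟩

/-- Divide `N` into three parts with weights `α`, `β`, `γ`; the state is the sum of the first two.
The kernel keeps the `α` part `z` and redistributes the other two, so `K x y * π y` is a sum over
`z` of `α z * β (x - z) * β (y - z) * γ (N - x) * γ (N - y)` over a factor depending on `z` and `N`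
only. -/
theorem isReversibleChain_convI (hα : ∀ n, 0 < α n) (hβ : ∀ n, 0 < β n) (hγ : ∀ n, 0 < γ n)
    (N : ℕ) :
    IsReversibleChain (V := Fin (N + 1))
      (fun x y => convI (splitMeasure β γ) (splitMeasure α β) N x y)
      (fun x => splitMeasure (cauchyProd α β) γ N x) := by
  have hαβ := cauchyProd_pos hα hβ
  refine .of_pos (fun x y => convI_pos hα hβ hγ N x y) (fun y => ?_) (fun x y => ?_)
    (fun x => splitMeasure_pos hαβ hγ _ _) (hasSum_fin (sum_splitMeasure hαβ hγ N))
  · refine hasSum_fin (f := fun x => convI (splitMeasure β γ) (splitMeasure α β) N x y) ?_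
    have := sum_convI (splitMeasure β γ) (splitMeasure α β) (fun _ => 1) (Fin.is_le y)
    simpa [sum_splitMeasure hβ hγ, sum_splitMeasure hα hβ] using this
  · simp only [convI, Finset.sum_mul, min_comm (x : ℕ)]
    refine Finset.sum_congr rfl fun z hz => ?_
    simp only [Finset.mem_Icc, le_min_iff] at hz
    have hx := Fin.is_le x
    have hy := Fin.is_le y
    have h1 : N - z - (x - z) = N - x := by omega
    have h2 : N - z - (y - z) = N - y := by omega
    have h3 := (hαβ x).ne'
    have h4 := (hαβ y).ne'
    simp only [splitMeasure, h1, h2]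
    field_simp

/-- Here `N` has four parts with weights `α`, `β`, `β`, `γ`, of sizes `z`, `y - z`, `x - z` and the
rest. The step exchanges the two `β` parts, which have equal weights, so the joint law is symmetric.
-/
theorem isReversibleChain_convII (hα : ∀ n, 0 < α n) (hβ : ∀ n, 0 < β n) (hγ : ∀ n, 0 < γ n)
    (N : ℕ) :
    IsReversibleChain (V := Fin (N + 1))
      (fun x y => convII (splitMeasure β γ) (splitMeasure α β) N x y)
      (fun x => splitMeasure (cauchyProd α β) (cauchyProd β γ) N x) := by
  have hαβ := cauchyProd_pos hα hβ
  have hβγ := cauchyProd_pos hβ hγ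
  refine .of_pos (fun x y => convII_pos hα hβ hγ (Fin.is_le x) (Fin.is_le y)) (fun y => ?_)
    (fun x y => ?_) (fun x => splitMeasure_pos hαβ hβγ _ _)
    (hasSum_fin (sum_splitMeasure hαβ hβγ N))
  · refine hasSum_fin (f := fun x => convII (splitMeasure β γ) (splitMeasure α β) N x y) ?_
    have := sum_convII (splitMeasure β γ) (splitMeasure α β) (fun _ => 1) (Fin.is_le y)
    simpa [sum_splitMeasure hβ hγ, sum_splitMeasure hα hβ] using this
  · simp only [convII, Finset.sum_mul, min_comm (x : ℕ), add_comm (x : ℕ)]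
    refine Finset.sum_congr rfl fun z hz => ?_
    simp only [Finset.mem_Icc, le_min_iff] at hz
    have hx := Fin.is_le x
    have hy := Fin.is_le y
    have h1 : N - x - (y - z) = N - y - (x - z) := by omega
    have h3 := (hαβ x).ne'
    have h4 := (hαβ y).ne'
    have h5 := (hβγ (N - x)).ne'
    have h6 := (hβγ (N - y)).ne'
    simp only [splitMeasure, h1]
    field_simp

/-- The state is the `α` part of three. The kernel keeps the `γ` part `N - z` and redistributes the
rest, so after multiplication by `π y` each summand is symmetric in `x` and `y`. -/
theorem isReversibleChain_convIII (hα : ∀ n, 0 < α n) (hβ : ∀ n, 0 < β n) (hγ : ∀ n, 0 < γ n)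
    (N : ℕ) :
    IsReversibleChain (V := Fin (N + 1))
      (fun x y => convIII (splitMeasure α β) (splitMeasure β γ) N x y)
      (fun x => splitMeasure α (cauchyProd β γ) N x) := by
  have hβγ := cauchyProd_pos hβ hγ
  refine .of_pos (fun x y => convIII_pos hα hβ hγ (Fin.is_le x) (Fin.is_le y)) (fun y => ?_)
    (fun x y => ?_) (fun x => splitMeasure_pos hα hβγ _ _)
    (hasSum_fin (sum_splitMeasure hα hβγ N))
  · refine hasSum_fin (f := fun x => convIII (splitMeasure α β) (splitMeasure β γ) N x y) ?_
    have := sum_convIII (splitMeasure α β) (splitMeasure β γ) (fun _ => 1) (Fin.is_le y)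
    simpa [sum_splitMeasure hβ hγ, sum_splitMeasure hα hβ] using this
  · simp only [convIII, Finset.sum_mul, max_comm (x : ℕ)]
    refine Finset.sum_congr rfl fun z hz => ?_
    simp only [Finset.mem_Icc, max_le_iff] at hz
    have h1 : N - x - (z - x) = N - z := by omega
    have h2 : N - y - (z - y) = N - z := by omega
    have h5 := (hβγ (N - x)).ne'
    have h6 := (hβγ (N - y)).ne'
    simp only [splitMeasure, h1, h2]
    field_simp

theorem isReversibleChain_convInf (hα : ∀ n, 0 < α n) (hβ : ∀ n, 0 < β n) {s t : ℝ} (hs : 0 < s)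
    (ht : 0 < t) (hβs : HasSum β s) (hαt : HasSum (cauchyProd α β) t) :
    IsReversibleChain (convInf (fun w => β w / s) (splitMeasure α β))
      (fun x => cauchyProd α β x / t) := by
  have hαβ := cauchyProd_pos hα hβ
  refine .of_pos (fun x y => convInf_pos hα hβ hs x y) (fun y => ?_) (fun x y => ?_)
    (fun x => div_pos (hαβ x) ht) ?_
  · have h1 : HasSum (fun w => β w / s) 1 := by
      simpa [hs.ne'] using hβs.div_const s
    have := hasSum_convInf (splitMeasure α β) (fun _ => 1) (fun w => β w / s) y (g := fun _ => 1)
      (fun z _ => by simpa using h1)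
    simpa [sum_splitMeasure hα hβ] using this
  · simp only [convInf, Finset.sum_mul, min_comm x]
    refine Finset.sum_congr rfl fun z hz => ?_
    have h3 := (hαβ x).ne'
    have h4 := (hαβ y).ne'
    simp only [splitMeasure]
    field_simp
  · simpa [ht.ne'] using hαt.div_const t

end Positive

/-! ### Orthogonal polynomials and triangular operators -/

open Polynomial in
-- Polynomials of exact degrees `0, 1, …, n - 1` span all polynomials of degree below `n`: remove
-- the leading term and recurse. This reduces every linear statement about polynomials below to a
-- convenient basis.
theorem mem_submodule_of_degree_lt {e : ℕ → ℝ[X]} (hdeg : ∀ j, (e j).natDegree ≤ j)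
    (hc : ∀ j, (e j).coeff j ≠ 0) (M : Submodule ℝ ℝ[X]) {n : ℕ} (h : ∀ j < n, e j ∈ M)
    {p : ℝ[X]} (hp : p.degree < n) : p ∈ M := by
  induction n generalizing p with
  | zero =>
    have : p = 0 := by
      rw [← degree_eq_bot]
      exact Nat.WithBot.lt_zero_iff.mp (by exact_mod_cast hp)
    rw [this]
    exact M.zero_mem
  | succ n ih =>
    have h1 : (p - C (p.coeff n / (e n).coeff n) * e n).degree < n := by
      rw [degree_lt_iff_coeff_zero]
      intro m hm
      rcases hm.eq_or_lt with rfl | hm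
      · rw [coeff_sub, coeff_C_mul, div_mul_cancel₀ _ (hc _), sub_self]
      · have h2 : p.coeff m = 0 := (degree_lt_iff_coeff_zero _ _).mp hp m hm
        have h3 : (e n).coeff m = 0 := coeff_eq_zero_of_natDegree_lt ((hdeg n).trans_lt hm)
        rw [coeff_sub, coeff_C_mul, h2, h3, mul_zero, sub_zero]
    have h2 := ih (fun j hj => h j (by omega)) h1
    have h3 := M.smul_mem (p.coeff n / (e n).coeff n) (h n (by omega))
    rw [smul_eq_C_mul] at h3
    simpa using M.add_mem h2 h3

/-- The Newton basis polynomial with nodes `u 0, …, u (k - 1)`. -/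
def newton (u : ℕ → ℝ) (k : ℕ) : Polynomial ℝ :=
  ∏ j ∈ Finset.range k, (Polynomial.X - Polynomial.C (u j))

theorem newton_monic (u : ℕ → ℝ) (k : ℕ) : (newton u k).Monic :=
  Polynomial.monic_prod_of_monic _ _ fun j _ => Polynomial.monic_X_sub_C (u j)

theorem newton_natDegree (u : ℕ → ℝ) (k : ℕ) : (newton u k).natDegree = k := by
  rw [newton, Polynomial.natDegree_prod_of_monic _ _ fun j _ => Polynomial.monic_X_sub_C (u j)]
  simp

theorem newton_coeff_self (u : ℕ → ℝ) (k : ℕ) : (newton u k).coeff k = 1 := by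
  have := newton_monic u k
  rwa [Polynomial.Monic, Polynomial.leadingCoeff, newton_natDegree] at this

theorem newton_eval (u : ℕ → ℝ) (k : ℕ) (t : ℝ) :
    (newton u k).eval t = ∏ j ∈ Finset.range k, (t - u j) := by
  simp [newton, Polynomial.eval_prod]

theorem newton_eval_of_lt (u : ℕ → ℝ) {k x : ℕ} (h : x < k) : (newton u k).eval (u x) = 0 := by
  rw [newton_eval]
  exact Finset.prod_eq_zero (Finset.mem_range.mpr h) (sub_self _)

open Polynomial in
/-- The operator with matrix `K`, acting on functions of `x` that are polynomials in `u x`, is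
triangular, with diagonal entries `l n`. -/
def IsTriangular {V : Type*} (K : V → V → ℝ) (u : V → ℝ) (l : ℕ → ℝ) : Prop :=
  ∀ (n : ℕ) (p : ℝ[X]), p.natDegree ≤ n → ∃ r : ℝ[X], r.natDegree ≤ n ∧
    r.coeff n = l n * p.coeff n ∧ ∀ y, HasSum (fun x => K x y * p.eval (u x)) (r.eval (u y))

open Polynomial in
-- After subtracting the multiple of `e n` with the same top coefficient, only lower basis elements
-- remain, and their images have degree below `n`. The top coefficient thus comes from `r n` alone.
theorem isTriangular_of_basis {V : Type*} {K : V → V → ℝ} {u : V → ℝ} {l : ℕ → ℝ}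
    {e r : ℕ → ℝ[X]} (hdeg : ∀ j, (e j).natDegree ≤ j) (hc : ∀ j, (e j).coeff j = 1)
    (hr : ∀ j, (r j).natDegree ≤ j) (hrc : ∀ j, (r j).coeff j = l j)
    (h : ∀ k y, HasSum (fun x => K x y * (e k).eval (u x)) ((r k).eval (u y))) :
    IsTriangular K u l := by
  intro n p hp
  let M : Submodule ℝ ℝ[X] :=
    { carrier := {p | ∃ s : ℝ[X], s.degree < n ∧
        ∀ y, HasSum (fun x => K x y * p.eval (u x)) (s.eval (u y))}
      add_mem' := by
        rintro p q ⟨s, hs, hs'⟩ ⟨t, ht, ht'⟩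
        refine ⟨s + t, (degree_add_le _ _).trans_lt (max_lt hs ht), fun y => ?_⟩
        simpa [mul_add] using (hs' y).add (ht' y)
      zero_mem' := ⟨0, by simp, fun y => by simp⟩
      smul_mem' := by
        rintro c p ⟨s, hs, hs'⟩
        refine ⟨C c * s, ?_, fun y => ?_⟩
        · rw [← smul_eq_C_mul]
          exact (degree_smul_le _ _).trans_lt hs
        · simpa [mul_left_comm] using (hs' y).mul_left c }
  have hlt : (p - C (p.coeff n) * e n).degree < n := by
    rw [degree_lt_iff_coeff_zero]
    intro m hm
    rcases hm.eq_or_lt with rfl | hm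
    · rw [coeff_sub, coeff_C_mul, hc, mul_one, sub_self]
    · rw [coeff_sub, coeff_C_mul, coeff_eq_zero_of_natDegree_lt (hp.trans_lt hm),
        coeff_eq_zero_of_natDegree_lt ((hdeg n).trans_lt hm), mul_zero, sub_zero]
  have hM : ∀ j < n, e j ∈ M := fun j hj =>
    ⟨r j, lt_of_le_of_lt (natDegree_le_iff_degree_le.mp (hr j)) (by exact_mod_cast hj), h j⟩
  obtain ⟨s, hs, hs'⟩ := mem_submodule_of_degree_lt hdeg (fun j => by simp [hc]) M hM hlt
  refine ⟨s + C (p.coeff n) * r n, ?_, ?_, fun y => ?_⟩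
  · refine (natDegree_add_le _ _).trans (max_le ?_ ((natDegree_C_mul_le _ _).trans (hr n)))
    exact natDegree_le_iff_degree_le.mpr hs.le
  · rw [coeff_add, coeff_C_mul, hrc, coeff_eq_zero_of_degree_lt hs, zero_add, mul_comm]
  · have := (hs' y).add ((h n y).mul_left (p.coeff n))
    convert! this using 1
    · ext x
      simp
      ring
    · simp

open Polynomial in
/-- Polynomials `Q n` in `u x` of degree `deg n`, orthogonal with respect to `π` with squared norm
`1 / w n`. -/
structure IsOrthogonalPolys {V : Type*} (π u : V → ℝ) (deg : V → ℕ) (Q : V → ℝ[X])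
    (w : V → ℝ) : Prop where
  natDegree_le : ∀ n, (Q n).natDegree ≤ deg n
  coeff_ne_zero : ∀ n, (Q n).coeff (deg n) ≠ 0
  weight_pos : ∀ n, 0 < w n
  hasSum : ∀ n (q : ℝ[X]), q.natDegree ≤ deg n →
    HasSum (fun x => π x * (Q n).eval (u x) * q.eval (u x))
      (q.coeff (deg n) / ((Q n).coeff (deg n) * w n))

namespace IsOrthogonalPolys

variable {V : Type*} {π u : V → ℝ} {deg : V → ℕ} {Q : V → Polynomial ℝ} {w : V → ℝ}

open Polynomial in
-- The pairing formula is linear in `q`, so one test polynomial of each degree suffices. The tests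
-- are chosen to match the weight rather than the lattice of `Q`.
theorem of_tests {T : V → ℕ → ℝ[X]} (hQ : ∀ n, (Q n).natDegree ≤ deg n)
    (hQ0 : ∀ n, (Q n).coeff (deg n) ≠ 0) (hw : ∀ n, 0 < w n)
    (hT : ∀ n j, (T n j).natDegree ≤ j) (hT0 : ∀ n j, (T n j).coeff j ≠ 0)
    (h : ∀ n, ∀ j ≤ deg n, HasSum (fun x => π x * (Q n).eval (u x) * (T n j).eval (u x))
      (if j = deg n then (T n j).coeff j / ((Q n).coeff (deg n) * w n) else 0)) :
    IsOrthogonalPolys π u deg Q w := by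
  refine ⟨hQ, hQ0, hw, fun n q hq => ?_⟩
  let M : Submodule ℝ ℝ[X] :=
    { carrier := {p | HasSum (fun x => π x * (Q n).eval (u x) * p.eval (u x))
        (p.coeff (deg n) / ((Q n).coeff (deg n) * w n))}
      add_mem' := by
        intro p q hp hq
        simpa [mul_add, add_div] using HasSum.add hp hq
      zero_mem' := by simp
      smul_mem' := by
        intro c p hp
        simpa [mul_left_comm, mul_div_assoc] using HasSum.mul_left c hp }
  refine mem_submodule_of_degree_lt (hT n) (hT0 n) M (n := deg n + 1) (fun j hj => ?_) ?_
  · change HasSum _ _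
    convert! h n j (by omega) using 1
    split_ifs with hj'
    · rw [hj']
    · rw [coeff_eq_zero_of_natDegree_lt (lt_of_le_of_lt (hT n j) (by omega)), zero_div]
  · exact (natDegree_le_iff_degree_le.mp hq).trans_lt (by exact_mod_cast Nat.lt_succ_self _)

theorem hasSum_of_lt (h : IsOrthogonalPolys π u deg Q w) {n : V} {q : Polynomial ℝ}
    (hq : q.degree < deg n) : HasSum (fun x => π x * (Q n).eval (u x) * q.eval (u x)) 0 := by
  have := h.hasSum n q (Polynomial.natDegree_le_iff_degree_le.mpr hq.le)
  rwa [Polynomial.coeff_eq_zero_of_degree_lt hq, zero_div] at this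

theorem hasSum_mul [DecidableEq V] (h : IsOrthogonalPolys π u deg Q w)
    (hdeg : Function.Injective deg) (n m : V) :
    HasSum (fun x => π x * (Q n).eval (u x) * (Q m).eval (u x)) (if n = m then 1 / w n else 0) := by
  split_ifs with hnm
  · subst hnm
    convert! h.hasSum n (Q n) (h.natDegree_le n) using 1
    have := h.coeff_ne_zero n
    have := (h.weight_pos n).ne'
    field_simp
  · have hd : ∀ {a : V}, (Q a).degree ≤ deg a := fun {a} =>
      Polynomial.natDegree_le_iff_degree_le.mp (h.natDegree_le a)
    rcases lt_or_gt_of_ne (hdeg.ne hnm) with hlt | hlt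
    · convert! h.hasSum_of_lt (hd.trans_lt (by exact_mod_cast hlt)) using 2
      ring
    · exact h.hasSum_of_lt (hd.trans_lt (by exact_mod_cast hlt))

end IsOrthogonalPolys

/-! ### Self-adjoint triangular operators -/

section Adjoint

variable {V : Type*} {K : V → V → ℝ} {π : V → ℝ}

/-- The elementary bound `|f g| ≤ f ^ 2 + g ^ 2`, with conservation in one variable and balance in
the other, gives absolute convergence. This justifies the exchange of summations in the adjoint
relation. -/
theorem IsReversibleChain.summable_pair_mul (h : IsReversibleChain K π) {f g : V → ℝ}
    (hf : Summable fun x => π x * f x ^ 2) (hg : Summable fun x => π x * g x ^ 2) :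
    Summable fun p : V × V => K p.1 p.2 * π p.2 * (f p.1 * g p.2) := by
  have h1 : Summable fun p : V × V => K p.2 p.1 * π p.1 * f p.1 ^ 2 := by
    rw [summable_prod_of_nonneg]
    · have hx : ∀ x, HasSum (fun y => K y x * π x * f x ^ 2) (π x * f x ^ 2) := fun x => by
        simpa [mul_assoc] using (h.conservation x).mul_right (π x * f x ^ 2)
      refine ⟨fun x => (hx x).summable, ?_⟩
      simpa only [(hx _).tsum_eq] using hf
    · exact fun p => mul_nonneg (mul_nonneg (h.nonneg _ _) (h.pos _).le) (sq_nonneg _)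
  have h2 : Summable fun p : V × V => K p.2 p.1 * π p.1 * g p.1 ^ 2 := by
    rw [summable_prod_of_nonneg]
    · have hx : ∀ x, HasSum (fun y => K y x * π x * g x ^ 2) (π x * g x ^ 2) := fun x => by
        simpa [mul_assoc] using (h.conservation x).mul_right (π x * g x ^ 2)
      refine ⟨fun x => (hx x).summable, ?_⟩
      simpa only [(hx _).tsum_eq] using hg
    · exact fun p => mul_nonneg (mul_nonneg (h.nonneg _ _) (h.pos _).le) (sq_nonneg _)
  refine Summable.of_norm_bounded (h1.add h2.prod_symm) fun p => ?_
  have hb := h.balance p.1 p.2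
  have hk := mul_nonneg (h.nonneg p.1 p.2) (h.pos p.2).le
  simp only [Prod.fst_swap, Prod.snd_swap]
  rw [← hb, norm_mul, Real.norm_of_nonneg hk, ← mul_add]
  refine mul_le_mul_of_nonneg_left ?_ hk
  rw [Real.norm_eq_abs, abs_le]
  constructor <;> nlinarith [sq_nonneg (f p.1 + g p.2), sq_nonneg (f p.1 - g p.2),
    sq_nonneg (f p.1), sq_nonneg (g p.2)]

/-- `K` is symmetric with respect to the inner product defined by `π`. -/
theorem IsReversibleChain.adjoint (h : IsReversibleChain K π) {f g f' g' : V → ℝ} {s : ℝ}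
    (hf : Summable fun x => π x * f x ^ 2) (hg : Summable fun x => π x * g x ^ 2)
    (hf' : ∀ y, HasSum (fun x => K x y * f x) (f' y))
    (hg' : ∀ y, HasSum (fun x => K x y * g x) (g' y))
    (hs : HasSum (fun x => π x * f x * g' x) s) : HasSum (fun x => π x * f' x * g x) s := by
  have h1 := (h.summable_pair_mul hf hg).hasSum
  have h2 := h1.prod_fiberwise (g := fun x => π x * f x * g' x) fun x => by
    convert! (hg' x).mul_left (π x * f x) using 2 with y
    linear_combination (f x * g y) * h.balance x y
  have h3 := ((Equiv.prodComm V V).hasSum_iff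
    (f := fun p : V × V => K p.1 p.2 * π p.2 * (f p.1 * g p.2))).mpr h1
  have h4 := h3.prod_fiberwise (g := fun x => π x * f' x * g x) fun y => by
    have := (hf' y).mul_left (π y * g y)
    convert! this using 1
    · ext x
      simp
      ring
    · ring
  rw [hs.unique h2]
  exact h4

/-- The orthogonal polynomials are eigenvectors of every triangular self-adjoint operator. -/
theorem IsTriangular.eigen {u : V → ℝ} {deg : V → ℕ} {Q : V → Polynomial ℝ} {w : V → ℝ}
    {l : ℕ → ℝ} (hl : IsTriangular K u l) (h : IsReversibleChain K π)
    (hsq : ∀ p : Polynomial ℝ, Summable fun x => π x * p.eval (u x) ^ 2)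
    (hQ : IsOrthogonalPolys π u deg Q w) (n y : V) :
    HasSum (fun x => K x y * (Q n).eval (u x)) (l (deg n) * (Q n).eval (u y)) := by
  obtain ⟨r, hr, hrc, hrs⟩ := hl (deg n) (Q n) (hQ.natDegree_le n)
  -- The defect of the eigenvalue equation. Triangularity cancels its top coefficient, so it has
  -- degree below `deg n` and is orthogonal to `Q n`.
  set D := r - Polynomial.C (l (deg n)) * Q n with hD
  have hDdeg : D.degree < deg n := by
    rw [Polynomial.degree_lt_iff_coeff_zero]
    intro m hm
    rw [hD, Polynomial.coeff_sub, Polynomial.coeff_C_mul]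
    rcases hm.eq_or_lt with rfl | hm
    · rw [hrc, sub_self]
    · rw [Polynomial.coeff_eq_zero_of_natDegree_lt (hr.trans_lt hm),
        Polynomial.coeff_eq_zero_of_natDegree_lt ((hQ.natDegree_le n).trans_lt hm), mul_zero,
        sub_zero]
  have hD0 : ∀ x, D.eval (u x) = 0 := by
    by_cases hz : D = 0
    · simp [hz]
    obtain ⟨D', hD', -, hDs⟩ := hl D.natDegree D le_rfl
    have hD'deg : D'.degree < deg n := by
      refine (Polynomial.natDegree_le_iff_degree_le.mp hD').trans_lt ?_
      rwa [← Polynomial.degree_eq_natDegree hz]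
    -- The pairing of `K Q n` with `D` equals that of `Q n` with `K D`, which is zero because `K D`
    -- also has degree below `deg n`. Hence `D` has norm zero and vanishes on the lattice, all
    -- weights being positive.
    have h1 := h.adjoint (hsq (Q n)) (hsq D) hrs hDs (hQ.hasSum_of_lt hD'deg)
    have h2 := h1.sub ((hQ.hasSum_of_lt hDdeg).mul_left (l (deg n)))
    have h3 : HasSum (fun x => π x * D.eval (u x) ^ 2) 0 := by
      convert! h2 using 1
      · ext x
        simp only [hD, Polynomial.eval_sub, Polynomial.eval_mul, Polynomial.eval_C]
        ring
      · simp
    rw [hasSum_zero_iff_of_nonneg fun x => mul_nonneg (h.pos x).le (sq_nonneg _)] at h3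
    intro x
    have := congrFun h3 x
    simpa [(h.pos x).ne'] using this
  convert! hrs y using 1
  have := hD0 y
  simp only [hD, Polynomial.eval_sub, Polynomial.eval_mul, Polynomial.eval_C] at this
  linarith

end Adjoint

/-! ### Eigenbases from orthogonal polynomials, and completeness -/

theorem hasEigenbasis_of_complete {V : Type*} [DecidableEq V] {K : V → V → ℝ} {π u κ : V → ℝ}
    {deg : V → ℕ} {Q : V → Polynomial ℝ} {w : V → ℝ} {P : V → V → ℝ}
    (hQ : IsOrthogonalPolys π u deg Q w) (hdeg : Function.Injective deg)
    (hP : ∀ n x, P n x = (Q n).eval (u x))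
    (hK : ∀ n y, HasSum (fun x => K x y * (Q n).eval (u x)) (κ n * (Q n).eval (u y)))
    (hc : ∀ x y, HasSum
      (fun n => (Real.sqrt (π x) * Real.sqrt (w n) * P n x) *
        (Real.sqrt (π y) * Real.sqrt (w n) * P n y)) (if x = y then 1 else 0)) :
    HasEigenbasis K π κ P (fun n => Real.sqrt (w n)) where
  norm_pos n := Real.sqrt_pos.mpr (hQ.weight_pos n)
  left_eigen n x := by simpa only [hP] using hK n x
  orthogonal n m := by
    simpa only [hP, Real.sq_sqrt (hQ.weight_pos _).le] using hQ.hasSum_mul hdeg n m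
  complete := hc

/-- A one-sided inverse of a finite square matrix is two-sided, so orthonormal rows give orthonormal
columns. -/
theorem hasSum_complete_of_fintype {V : Type*} [Fintype V] [DecidableEq V] {φ : V → V → ℝ}
    (h : ∀ n m, HasSum (fun x => φ n x * φ m x) (if n = m then 1 else 0)) (x y : V) :
    HasSum (fun n => φ n x * φ n y) (if x = y then 1 else 0) := by
  have h1 : (Matrix.of φ) * (Matrix.of φ).transpose = 1 := by
    ext n m
    rw [Matrix.mul_apply, Matrix.one_apply]
    exact (hasSum_fintype _).unique (h n m)
  rw [mul_eq_one_comm] at h1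
  have h2 := congrFun (congrFun h1 x) y
  rw [Matrix.mul_apply, Matrix.one_apply] at h2
  rw [← h2]
  exact hasSum_fintype _

theorem hasEigenbasis_of_fintype {V : Type*} [Fintype V] [DecidableEq V] {K : V → V → ℝ}
    {π u κ : V → ℝ} {deg : V → ℕ} {Q : V → Polynomial ℝ} {w : V → ℝ} {P : V → V → ℝ}
    (hQ : IsOrthogonalPolys π u deg Q w) (hdeg : Function.Injective deg) (hπ : ∀ x, 0 < π x)
    (hP : ∀ n x, P n x = (Q n).eval (u x))
    (hK : ∀ n y, HasSum (fun x => K x y * (Q n).eval (u x)) (κ n * (Q n).eval (u y))) :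
    HasEigenbasis K π κ P (fun n => Real.sqrt (w n)) := by
  refine hasEigenbasis_of_complete hQ hdeg hP hK (hasSum_complete_of_fintype fun n m => ?_)
  have h1 := (hQ.hasSum_mul hdeg n m).mul_left (Real.sqrt (w n) * Real.sqrt (w m))
  convert! h1 using 1
  · ext x
    rw [hP, hP]
    linear_combination (Real.sqrt (w n) * Real.sqrt (w m) * (Q n).eval (u x) *
      (Q m).eval (u x)) * Real.sq_sqrt (hπ x).le
  · split_ifs with hnm
    · subst hnm
      rw [Real.mul_self_sqrt (hQ.weight_pos n).le]
      have := (hQ.weight_pos n).ne'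
      field_simp
    · simp

/-- Completeness of self-dual orthogonal polynomials. -/
theorem hasEigenbasis_of_selfDual {K : ℕ → ℕ → ℝ} {π u κ : ℕ → ℝ} {Q : ℕ → Polynomial ℝ}
    {w : ℕ → ℝ} {P : ℕ → ℕ → ℝ} {c : ℝ} (hQ : IsOrthogonalPolys π u id Q w)
    (hπ : ∀ x, 0 < π x) (hP : ∀ n x, P n x = (Q n).eval (u x)) (hsymm : ∀ n x, P n x = P x n)
    (hw : ∀ n, w n = c * π n)
    (hK : ∀ n y, HasSum (fun x => K x y * (Q n).eval (u x)) (κ n * (Q n).eval (u y))) :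
    HasEigenbasis K π κ P (fun n => Real.sqrt (w n)) := by
  refine hasEigenbasis_of_complete hQ Function.injective_id hP hK fun x y => ?_
  -- Orthogonality of the polynomials with degrees `x` and `y`; duality exchanges degree and
  -- position, and `w n = c * π n` turns the weight of summation into the squared norming constant.
  have h1 := (hQ.hasSum_mul Function.injective_id x y).mul_left
    (c * (Real.sqrt (π x) * Real.sqrt (π y)))
  convert! h1 using 1
  · ext n
    rw [← hP, ← hP, hsymm x n, hsymm y n]
    have := Real.sq_sqrt (hQ.weight_pos n).le
    have := hw n
    linear_combination (Real.sqrt (π x) * P n x * Real.sqrt (π y) * P n y) *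
      (Real.sq_sqrt (hQ.weight_pos n).le + hw n)
  · split_ifs with hxy
    · subst hxy
      rw [Real.mul_self_sqrt (hπ x).le, ← hw]
      have := (hQ.weight_pos x).ne'
      field_simp
    · simp

/-! ### Convolutions of distributions that act diagonally on Newton bases -/

/-- The kernel that sends `y` to a random `z ≤ y` with weights `α z * β (y - z)` acts diagonally
on the Newton basis of `u`. -/
def IsThinning (u α β c : ℕ → ℝ) : Prop :=
  ∀ k y, ∑ z ∈ Finset.range (y + 1), α z * β (y - z) * (newton u k).eval (u z) =
    c k * (newton u k).eval (u y) * cauchyProd α β y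

section Thinning

variable {u α β γ c : ℕ → ℝ}

theorem newton_affine (s t : ℝ) (k x : ℕ) :
    (newton (fun j => s + t * u j) k).eval (s + t * u x) = t ^ k * (newton u k).eval (u x) := by
  have h : ∀ j, s + t * u x - (s + t * u j) = t * (u x - u j) := fun j => by ring
  rw [newton_eval, newton_eval]
  simp only [h, Finset.prod_mul_distrib, Finset.prod_const, Finset.card_range]

theorem IsThinning.affine (h : IsThinning u α β c) (s t : ℝ) :
    IsThinning (fun x => s + t * u x) α β c := by
  intro k y
  simp only [newton_affine]
  rw [show c k * (t ^ k * (newton u k).eval (u y)) * cauchyProd α β y =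
    t ^ k * (c k * (newton u k).eval (u y) * cauchyProd α β y) by ring, ← h, Finset.mul_sum]
  exact Finset.sum_congr rfl fun z _ => by ring

/-- A criterion for diagonal action: multiplication by the Newton basis shifts the weights. -/
theorem IsThinning.of_shift
    (h : ∀ k n, ∑ z ∈ Finset.range (n + 1), α (z + k) * β (n - z) * (newton u k).eval (u (z + k)) =
      c k * (newton u k).eval (u (n + k)) * cauchyProd α β (n + k)) : IsThinning u α β c := by
  intro k y
  -- Below the `k`-th node both sides vanish. For `y = n + k` the first `k` summands drop out, and
  -- the others are the shifted sum of the hypothesis.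
  rcases lt_or_ge y k with hy | hy
  · rw [newton_eval_of_lt u hy, mul_zero, zero_mul]
    refine Finset.sum_eq_zero fun z hz => ?_
    rw [newton_eval_of_lt u (by simp at hz; omega), mul_zero]
  · obtain ⟨n, rfl⟩ := Nat.exists_eq_add_of_le' hy
    rw [← h k n, show n + k + 1 = k + (n + 1) by ring, Finset.sum_range_add]
    rw [Finset.sum_eq_zero, zero_add]
    · refine Finset.sum_congr rfl fun z _ => ?_
      rw [add_comm k z, Nat.add_sub_add_right]
    · intro z hz
      rw [newton_eval_of_lt u (by simpa using hz), mul_zero]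

theorem IsThinning.sum_splitMeasure (h : IsThinning u α β c) (hα : ∀ n, 0 < α n)
    (hβ : ∀ n, 0 < β n) (k y : ℕ) :
    ∑ z ∈ Finset.range (y + 1), splitMeasure α β y z * (newton u k).eval (u z) =
      c k * (newton u k).eval (u y) := by
  have hc := (cauchyProd_pos hα hβ y).ne'
  have h1 := h k y
  rw [← div_eq_iff hc, Finset.sum_div] at h1
  rw [← h1]
  exact Finset.sum_congr rfl fun z _ => by rw [splitMeasure]; ring

open Polynomial in
-- Diagonal action on the Newton basis becomes triangular action on arbitrary polynomials. To fit
-- `IsTriangular`, the finite sum is written with a kernel that is zero for `z > y`.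
theorem IsThinning.exists_image (h : IsThinning u α β c) (hα : ∀ n, 0 < α n) (hβ : ∀ n, 0 < β n)
    (n : ℕ) (p : ℝ[X]) (hp : p.natDegree ≤ n) : ∃ r : ℝ[X], r.natDegree ≤ n ∧
      r.coeff n = c n * p.coeff n ∧ ∀ y,
        ∑ z ∈ Finset.range (y + 1), splitMeasure α β y z * p.eval (u z) = r.eval (u y) := by
  have key : ∀ (f : ℕ → ℝ) y, HasSum
      (fun z => (if z ≤ y then splitMeasure α β y z else 0) * f z)
      (∑ z ∈ Finset.range (y + 1), splitMeasure α β y z * f z) := fun f y => by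
    have h1 : ∑ z ∈ Finset.range (y + 1), splitMeasure α β y z * f z =
        ∑ z ∈ Finset.range (y + 1), (if z ≤ y then splitMeasure α β y z else 0) * f z :=
      Finset.sum_congr rfl fun z hz => by rw [if_pos (by simp at hz; omega)]
    rw [h1]
    exact hasSum_sum_of_ne_finset_zero fun z hz => by
      rw [if_neg (by simp at hz; omega), zero_mul]
  have hT : IsTriangular (fun z y => if z ≤ y then splitMeasure α β y z else 0) u c := by
    refine isTriangular_of_basis (e := newton u) (r := fun k => C (c k) * newton u k)
      (fun j => (newton_natDegree u j).le) (newton_coeff_self u)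
      (fun j => (natDegree_C_mul_le _ _).trans (newton_natDegree u j).le)
      (fun j => by rw [coeff_C_mul, newton_coeff_self, mul_one]) fun k y => ?_
    rw [eval_mul, eval_C, ← h.sum_splitMeasure hα hβ]
    exact key _ y
  obtain ⟨r, h1, h2, h3⟩ := hT n p hp
  exact ⟨r, h1, h2, fun y => (key _ y).unique (h3 y)⟩

theorem splitMeasure_reflect (α β : ℕ → ℝ) {M w : ℕ} (hw : w ≤ M) :
    splitMeasure α β M (M - w) = splitMeasure β α M w := by
  rw [splitMeasure, splitMeasure, cauchyProd_comm, Nat.sub_sub_self hw, mul_comm]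

theorem sum_splitMeasure_reflect (α β f : ℕ → ℝ) (M : ℕ) :
    ∑ w ∈ Finset.range (M + 1), splitMeasure α β M w * f w =
      ∑ v ∈ Finset.range (M + 1), splitMeasure β α M v * f (M - v) := by
  rw [← Finset.sum_range_reflect]
  refine Finset.sum_congr rfl fun v hv => ?_
  simp only [Finset.mem_range] at hv
  rw [show M + 1 - 1 - v = M - v by omega, splitMeasure_reflect α β (by omega)]

section Finite

variable {u' c' : ℕ → ℝ} {N : ℕ}

/-- Counted from the top, the `β` share `w` of `N - z` leaves the `γ` share `v = N - z - w`, and `z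
+ w = N - v`. So the second draw is a thinning of `N - z` on the reflected lattice `u'`, whose value
there is `u z`. -/
theorem IsThinning.sum_reflect {r p : Polynomial ℝ}
    (hr : ∀ y, ∑ z ∈ Finset.range (y + 1), splitMeasure γ β y z * p.eval (u' z) = r.eval (u' y))
    (hu : ∀ v ≤ N, u' v = u (N - v)) {z : ℕ} (hz : z ≤ N) :
    ∑ w ∈ Finset.range (N - z + 1), splitMeasure β γ (N - z) w * p.eval (u (z + w)) =
      r.eval (u z) := by
  have h1 := hr (N - z)
  rw [hu _ (Nat.sub_le N z), Nat.sub_sub_self hz] at h1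
  rw [← h1, sum_splitMeasure_reflect β γ (fun w => p.eval (u (z + w)))]
  refine Finset.sum_congr rfl fun v hv => ?_
  simp only [Finset.mem_range] at hv
  rw [hu v (by omega), show z + (N - z - v) = N - v by omega]

/-- The second draw is a reflected thinning with constants `c'`, the first a thinning with constants
`c`. Both preserve polynomials in the same lattice variable, so the diagonal entries multiply. -/
theorem isTriangular_convI (hα : ∀ n, 0 < α n) (hβ : ∀ n, 0 < β n) (hγ : ∀ n, 0 < γ n)
    (h : IsThinning u α β c) (h' : IsThinning u' γ β c') (hu : ∀ v ≤ N, u' v = u (N - v)) :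
    IsTriangular (V := Fin (N + 1))
      (fun x y => convI (splitMeasure β γ) (splitMeasure α β) N x y) (fun x => u x)
      (fun n => c n * c' n) := by
  intro n p hp
  obtain ⟨r, hr, hrc, hrs⟩ := h'.exists_image hγ hβ n p hp
  obtain ⟨s, hs, hsc, hss⟩ := h.exists_image hα hβ n r hr
  refine ⟨s, hs, by rw [hsc, hrc, mul_assoc], fun y => ?_⟩
  refine hasSum_fin (f := fun x => convI (splitMeasure β γ) (splitMeasure α β) N x y *
    p.eval (u x)) ?_
  rw [sum_convI _ _ _ (Fin.is_le y), ← hss]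
  refine Finset.sum_congr rfl fun z hz => ?_
  have hy := Fin.is_le y
  simp only [Finset.mem_range] at hz
  rw [IsThinning.sum_reflect hrs hu (by omega)]

theorem isTriangular_convIII (hα : ∀ n, 0 < α n) (hβ : ∀ n, 0 < β n) (hγ : ∀ n, 0 < γ n)
    (h : IsThinning u α β c) (h' : IsThinning u' γ β c') (hu : ∀ v ≤ N, u' v = u (N - v)) :
    IsTriangular (V := Fin (N + 1))
      (fun x y => convIII (splitMeasure α β) (splitMeasure β γ) N x y) (fun x => u x)
      (fun n => c n * c' n) := by
  intro n p hp
  obtain ⟨r, hr, hrc, hrs⟩ := h.exists_image hα hβ n p hp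
  obtain ⟨s, hs, hsc, hss⟩ := h'.exists_image hγ hβ n r hr
  refine ⟨s, hs, by rw [hsc, hrc]; ring, fun y => ?_⟩
  refine hasSum_fin (f := fun x => convIII (splitMeasure α β) (splitMeasure β γ) N x y *
    p.eval (u x)) ?_
  rw [sum_convIII _ _ _ (Fin.is_le y), ← IsThinning.sum_reflect hss hu (Fin.is_le y)]
  exact Finset.sum_congr rfl fun z _ => by rw [hrs]

end Finite

open Polynomial in
-- Both draws thin on the linear lattice, but from the separate amounts `y` and `N - y`. Expanding
-- `(z + w) ^ k` binomially gives products of a polynomial in `y` of degree `j` and one in `N - y`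
-- of degree `k - j`. The diagonal entries need not be known here; the eigenvalues are found by
-- evaluation at `0`.
theorem exists_isTriangular_convII {N : ℕ} (hα : ∀ n, 0 < α n) (hβ : ∀ n, 0 < β n)
    (hγ : ∀ n, 0 < γ n) (h : IsThinning (fun x => (x : ℝ)) α β c) {c' : ℕ → ℝ}
    (h' : IsThinning (fun x => (x : ℝ)) β γ c') :
    ∃ l, IsTriangular (V := Fin (N + 1))
      (fun x y => convII (splitMeasure β γ) (splitMeasure α β) N x y) (fun x => (x : ℕ)) l := by
  choose r hr _ hrs using fun j => h.exists_image hα hβ j (X ^ j) (natDegree_X_pow_le j)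
  choose s hs _ hss using fun j => h'.exists_image hβ hγ j (X ^ j) (natDegree_X_pow_le j)
  simp only [eval_pow, eval_X] at hrs hss
  refine ⟨_, isTriangular_of_basis (e := fun k => X ^ k)
    (r := fun k => ∑ j ∈ Finset.range (k + 1),
      C (k.choose j : ℝ) * (r j * (s (k - j)).comp (C (N : ℝ) - X)))
    natDegree_X_pow_le (fun j => by simp) (fun k => ?_) (fun k => rfl) fun k y => ?_⟩
  · refine natDegree_sum_le_of_forall_le _ _ fun j hj => ?_
    refine (natDegree_C_mul_le _ _).trans (natDegree_mul_le.trans ?_)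
    have h1 : (C (N : ℝ) - X).natDegree ≤ 1 := (natDegree_sub_le _ _).trans (by simp)
    have h2 : ((s (k - j)).comp (C (N : ℝ) - X)).natDegree ≤ k - j :=
      natDegree_comp_le.trans ((Nat.mul_le_mul (hs _) h1).trans (by simp))
    have := hr j
    simp only [Finset.mem_range] at hj
    omega
  · have hy := Fin.is_le y
    simp only [eval_finsetSum, eval_mul, eval_C, eval_comp, eval_sub, eval_X, eval_pow]
    rw [← Nat.cast_sub hy]
    simp only [← hrs, ← hss]
    refine hasSum_fin (f := fun x => convII (splitMeasure β γ) (splitMeasure α β) N x y *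
      (x : ℝ) ^ k) ?_
    rw [sum_convII _ _ (fun x => (x : ℝ) ^ k) hy]
    push_cast
    simp only [add_pow, Finset.sum_mul_sum]
    simp only [Finset.mul_sum]
    conv_rhs => rw [Finset.sum_comm]
    refine Finset.sum_congr rfl fun z _ => ?_
    rw [Finset.sum_comm]
    refine Finset.sum_congr rfl fun w _ => ?_
    exact Finset.sum_congr rfl fun j _ => by ring

open Polynomial in
-- In the binomial expansion of `(z + w) ^ k` the added amount `w` contributes only constant
-- moments. The term of degree `k` carries the total mass `1` of `μ`, so the diagonal is that of the
-- thinning.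
theorem isTriangular_convInf {μ : ℕ → ℝ} (hα : ∀ n, 0 < α n) (hβ : ∀ n, 0 < β n)
    (h : IsThinning (fun x => (x : ℝ)) α β c) (hμ : HasSum μ 1)
    (hm : ∀ k : ℕ, Summable fun w => μ w * (w : ℝ) ^ k) :
    IsTriangular (convInf μ (splitMeasure α β)) (fun x => (x : ℝ)) c := by
  choose r hr hrc hrs using fun j => h.exists_image hα hβ j (X ^ j) (natDegree_X_pow_le j)
  simp only [eval_pow, eval_X] at hrs
  refine isTriangular_of_basis (e := fun k => X ^ k)
    (r := fun k => ∑ j ∈ Finset.range (k + 1),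
      C ((k.choose j : ℝ) * ∑' w, μ w * (w : ℝ) ^ (k - j)) * r j)
    natDegree_X_pow_le (fun j => by simp) (fun k => ?_) (fun k => ?_) fun k y => ?_
  · refine natDegree_sum_le_of_forall_le _ _ fun j hj => ?_
    have := hr j
    simp only [Finset.mem_range] at hj
    exact (natDegree_C_mul_le _ _).trans (by omega)
  · rw [finsetSum_coeff, Finset.sum_range_succ, Finset.sum_eq_zero]
    · simp [hrc, hμ.tsum_eq]
    · intro j hj
      rw [coeff_C_mul, coeff_eq_zero_of_natDegree_lt, mul_zero]
      exact (hr j).trans_lt (by simpa using hj)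
  · have h1 := hasSum_convInf (splitMeasure α β) (fun x => (x : ℝ) ^ k) μ y
      (g := fun z => ∑ j ∈ Finset.range (k + 1),
        (k.choose j : ℝ) * (∑' w, μ w * (w : ℝ) ^ (k - j)) * (z : ℝ) ^ j) fun z _ => by
      have h2 := hasSum_sum (s := Finset.range (k + 1)) fun j _ =>
        ((hm (k - j)).hasSum.mul_left ((k.choose j : ℝ) * (z : ℝ) ^ j))
      convert! h2 using 1
      · ext w
        push_cast
        rw [add_pow, Finset.mul_sum]
        exact Finset.sum_congr rfl fun j _ => by ring
      · exact Finset.sum_congr rfl fun j _ => by ring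
    simp only [eval_pow, eval_X]
    convert! h1 using 1
    simp only [eval_finsetSum, eval_mul, eval_C, ← hrs]
    simp only [Finset.mul_sum]
    rw [Finset.sum_comm]
    refine Finset.sum_congr rfl fun z _ => ?_
    exact Finset.sum_congr rfl fun j _ => by ring

end Thinning

/-! ### Exponential, binomial and `q`-binomial sequences -/

/-- The multiplier `m` acts as a (twisted) number operator: on a sum of indices it obeys a Leibniz
rule, and on each factor it lowers the index. Condition `hg` says that the two contributions combine
to a factor depending on the total index only, so the Cauchy product obeys a first-order recursion.
-/
theorem cauchyProd_succ {α β m τ p r g : ℕ → ℝ} (hm0 : m 0 = 0)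
    (hm : ∀ x w, m (x + w) = m x + τ x * m w) (hα : ∀ x, m (x + 1) * α (x + 1) = p x * α x)
    (hβ : ∀ w, m (w + 1) * β (w + 1) = r w * β w) (hg : ∀ x w, p x + τ x * r w = g (x + w))
    (n : ℕ) : m (n + 1) * cauchyProd α β (n + 1) = g n * cauchyProd α β n := by
  have h1 : m (n + 1) * cauchyProd α β (n + 1) =
      ∑ k ∈ Finset.range (n + 1 + 1), m k * α k * β (n + 1 - k) +
      ∑ k ∈ Finset.range (n + 1 + 1), τ k * α k * (m (n + 1 - k) * β (n + 1 - k)) := by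
    rw [cauchyProd, Finset.mul_sum, ← Finset.sum_add_distrib]
    refine Finset.sum_congr rfl fun k hk => ?_
    simp only [Finset.mem_range] at hk
    have := hm k (n + 1 - k)
    rw [Nat.add_sub_cancel' (by omega)] at this
    rw [this]
    ring
  rw [h1, Finset.sum_range_succ', Finset.sum_range_succ (fun k => τ k * _ * _)]
  simp only [hm0, Nat.sub_self, zero_mul, mul_zero, add_zero, Nat.add_sub_add_right]
  rw [← Finset.sum_add_distrib, cauchyProd, Finset.mul_sum]
  refine Finset.sum_congr rfl fun k hk => ?_
  simp only [Finset.mem_range] at hk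
  have h2 := hg k (n - k)
  rw [Nat.add_sub_cancel' (by omega)] at h2
  rw [hα, show n + 1 - k = n - k + 1 by omega, hβ, ← h2]
  ring

theorem cauchyProd_eq {α β δ m τ p r g : ℕ → ℝ} (hm0 : m 0 = 0) (hm1 : ∀ n, m (n + 1) ≠ 0)
    (hm : ∀ x w, m (x + w) = m x + τ x * m w) (hα : ∀ x, m (x + 1) * α (x + 1) = p x * α x)
    (hβ : ∀ w, m (w + 1) * β (w + 1) = r w * β w) (hg : ∀ x w, p x + τ x * r w = g (x + w))
    (hδ : ∀ n, m (n + 1) * δ (n + 1) = g n * δ n) (h0 : δ 0 = α 0 * β 0) :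
    cauchyProd α β = δ := by
  ext n
  induction n with
  | zero => simp [cauchyProd, h0]
  | succ n ih =>
    apply mul_left_cancel₀ (hm1 n)
    rw [cauchyProd_succ hm0 hm hα hβ hg, hδ, ih]

/-- Diagonal action on the Newton basis for a family of weights stable under shifts. -/
theorem IsThinning.of_shift_family {u α β c C D : ℕ → ℝ} {α' δ' : ℕ → ℕ → ℝ}
    (hα : ∀ k z, α (z + k) * (newton u k).eval (u (z + k)) = C k * α' k z)
    (hαβ : ∀ k, cauchyProd (α' k) β = δ' k)
    (hδ : ∀ k n, cauchyProd α β (n + k) * (newton u k).eval (u (n + k)) = D k * δ' k n)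
    (hc : ∀ k, c k * D k = C k) : IsThinning u α β c := by
  refine .of_shift fun k n => ?_
  rw [mul_assoc, mul_comm ((newton u k).eval _), hδ, ← mul_assoc, hc, ← hαβ, cauchyProd,
    Finset.mul_sum]
  refine Finset.sum_congr rfl fun z _ => ?_
  rw [mul_right_comm, hα]
  ring

/-- The sequence `A ^ n / n!`. -/
def expSeq (A : ℝ) (n : ℕ) : ℝ := A ^ n / (n.factorial : ℝ)

/-- The sequence `t ^ n (a)_n / n!`. -/
def hahnSeq (t a : ℝ) (n : ℕ) : ℝ := t ^ n * poch a n / (n.factorial : ℝ)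

/-- The sequence `t ^ n (a; q)_n / (q; q)_n`. -/
def qHahnSeq (q t a : ℝ) (n : ℕ) : ℝ := t ^ n * qPoch a q n / qPoch q q n

theorem expSeq_pos {A : ℝ} (hA : 0 < A) (n : ℕ) : 0 < expSeq A n := by
  unfold expSeq
  positivity

section Poch

variable (a : ℝ) (k n : ℕ)

@[simp] theorem poch_zero : poch a 0 = 1 := by simp [poch]

theorem poch_succ : poch a (n + 1) = poch a n * (a + n) := by
  simp [poch, ascPochhammer_succ_eval]

theorem poch_add : poch a (k + n) = poch a k * poch (a + k) n := by
  induction n with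
  | zero => simp
  | succ n ih =>
    rw [← add_assoc, poch_succ, ih, poch_succ]
    push_cast
    ring

theorem poch_succ' : poch a (n + 1) = a * poch (a + 1) n := by
  rw [add_comm, poch_add]
  simp [poch]

theorem poch_eq_prod : poch a n = ∏ k ∈ Finset.range n, (a + k) := by
  induction n with
  | zero => simp
  | succ n ih => rw [poch_succ, Finset.prod_range_succ, ih]

theorem poch_one : poch 1 n = (n.factorial : ℝ) := by
  induction n with
  | zero => simp
  | succ n ih =>
    rw [poch_succ, ih, Nat.factorial_succ]
    push_cast
    ring

variable {a}

theorem poch_pos (ha : 0 < a) : 0 < poch a n := ascPochhammer_pos n a ha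

end Poch

section QPoch

variable (a q : ℝ) (k n : ℕ)

@[simp] theorem qPoch_zero : qPoch a q 0 = 1 := by simp [qPoch]

theorem qPoch_succ : qPoch a q (n + 1) = qPoch a q n * (1 - a * q ^ n) := by
  rw [qPoch, Finset.prod_range_succ, ← qPoch]

theorem qPoch_add : qPoch a q (k + n) = qPoch a q k * qPoch (a * q ^ k) q n := by
  rw [qPoch, Finset.prod_range_add, ← qPoch, qPoch]
  congr 1
  exact Finset.prod_congr rfl fun i _ => by ring

theorem qPoch_succ' : qPoch a q (n + 1) = (1 - a) * qPoch (a * q) q n := by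
  rw [add_comm, qPoch_add, pow_one]
  simp [qPoch]

variable {a q}

theorem qPoch_pos (hq : 0 < q) (hq1 : q < 1) (ha : a < 1) : 0 < qPoch a q n := by
  refine Finset.prod_pos fun k _ => ?_
  have h1 : q ^ k ≤ 1 := pow_le_one₀ hq.le hq1.le
  have h2 : 0 < q ^ k := by positivity
  rcases le_or_gt a 0 with h | h
  · nlinarith
  · nlinarith

end QPoch

theorem hahnSeq_pos {t a : ℝ} (ht : 0 < t) (ha : 0 < a) (n : ℕ) : 0 < hahnSeq t a n := by
  have := poch_pos n ha
  unfold hahnSeq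
  positivity

theorem qHahnSeq_pos {q t a : ℝ} (hq : 0 < q) (hq1 : q < 1) (ht : 0 < t) (ha : a < 1) (n : ℕ) :
    0 < qHahnSeq q t a n := by
  have := qPoch_pos n hq hq1 ha
  have := qPoch_pos n hq hq1 hq1
  unfold qHahnSeq
  positivity

theorem cauchyProd_expSeq (A B : ℝ) : cauchyProd (expSeq A) (expSeq B) = expSeq (A + B) := by
  have h : ∀ C : ℝ, ∀ x : ℕ, ((x + 1 : ℕ) : ℝ) * expSeq C (x + 1) = C * expSeq C x := fun C x => by
    rw [expSeq, expSeq, Nat.factorial_succ, pow_succ']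
    push_cast
    field_simp
  exact cauchyProd_eq (m := fun n => n) (τ := fun _ => 1) (by simp)
    (fun n => by positivity) (fun x w => by push_cast; ring) (h A) (h B) (fun _ _ => by ring)
    (h (A + B)) (by simp [expSeq])

theorem hahnSeq_succ (t a : ℝ) (x : ℕ) :
    ((x + 1 : ℕ) : ℝ) * hahnSeq t a (x + 1) = t * (a + x) * hahnSeq t a x := by
  rw [hahnSeq, hahnSeq, Nat.factorial_succ, poch_succ, pow_succ']
  push_cast
  field_simp

theorem cauchyProd_hahnSeq (t a b : ℝ) :
    cauchyProd (hahnSeq t a) (hahnSeq t b) = hahnSeq t (a + b) :=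
  cauchyProd_eq (m := fun n => n) (τ := fun _ => 1) (g := fun n => t * (a + b + n)) (by simp)
    (fun n => by positivity) (fun x w => by push_cast; ring) (hahnSeq_succ t a) (hahnSeq_succ t b)
    (fun _ _ => by push_cast; ring) (hahnSeq_succ t (a + b)) (by simp [hahnSeq])

theorem one_sub_pow_pos {q : ℝ} (hq : 0 < q) (hq1 : q < 1) (n : ℕ) : 0 < 1 - q ^ (n + 1) :=
  sub_pos.mpr (pow_lt_one₀ hq.le hq1 (by omega))

theorem qHahnSeq_succ {q : ℝ} (hq : 0 < q) (hq1 : q < 1) (t a : ℝ) (x : ℕ) :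
    (1 - q ^ (x + 1)) * qHahnSeq q t a (x + 1) = t * (1 - a * q ^ x) * qHahnSeq q t a x := by
  have h1 := (one_sub_pow_pos hq hq1 x).ne'
  have h2 := (qPoch_pos x hq hq1 hq1).ne'
  rw [qHahnSeq, qHahnSeq, qPoch_succ, qPoch_succ, ← pow_succ', pow_succ' t]
  field_simp

/-- The second factor must carry `t * a` instead of `t`: then `t * (1 - a * q ^ x)` and `q ^ x * (t
* a) * (1 - b * q ^ w)` telescope to `t * (1 - a * b * q ^ (x + w))`. -/
theorem cauchyProd_qHahnSeq {q : ℝ} (hq : 0 < q) (hq1 : q < 1) (t a b : ℝ) :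
    cauchyProd (qHahnSeq q t a) (qHahnSeq q (t * a) b) = qHahnSeq q t (a * b) :=
  cauchyProd_eq (m := fun n => 1 - q ^ n) (τ := fun x => q ^ x)
    (g := fun n => t * (1 - a * b * q ^ n)) (by simp)
    (fun n => (one_sub_pow_pos hq hq1 n).ne') (fun x w => by ring)
    (qHahnSeq_succ hq hq1 t a) (qHahnSeq_succ hq hq1 (t * a) b) (fun _ _ => by ring)
    (qHahnSeq_succ hq hq1 t (a * b)) (by simp [qHahnSeq])

/-! ### Newton bases on linear and exponential lattices -/

theorem newton_natCast (k n : ℕ) : (newton (fun x => (x : ℝ)) k).eval ((n + k : ℕ) : ℝ) =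
    ((n + k).factorial : ℝ) / (n.factorial : ℝ) := by
  rw [newton_eval, ← Nat.factorial_mul_descFactorial (Nat.le_add_left k n), Nat.add_sub_cancel,
    Nat.descFactorial_eq_prod_range, Nat.cast_mul, mul_div_cancel_left₀ _ (by positivity)]
  rw [Nat.cast_prod]
  refine Finset.prod_congr rfl fun i hi => ?_
  simp only [Finset.mem_range] at hi
  rw [Nat.cast_sub (by omega)]

theorem newton_id_eq_poch (k : ℕ) (x : ℝ) :
    (newton (fun x => (x : ℝ)) k).eval x = (-1) ^ k * poch (-x) k := by
  rw [newton_eval, poch_eq_prod, ← Finset.card_range k, ← Finset.prod_const, Finset.card_range,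
    ← Finset.prod_mul_distrib]
  exact Finset.prod_congr rfl fun i _ => by ring

theorem poch_neg_natCast (n k : ℕ) :
    poch (-(n : ℝ)) k = (-1) ^ k * (k.factorial : ℝ) * (n.choose k : ℝ) := by
  have h1 := newton_id_eq_poch k n
  have h2 : (newton (fun x => (x : ℝ)) k).eval (n : ℝ) = (n.descFactorial k : ℝ) := by
    rw [newton_eval, Nat.descFactorial_eq_prod_range]
    rcases le_or_gt k n with hk | hk
    · rw [Nat.cast_prod]
      refine Finset.prod_congr rfl fun i hi => ?_
      simp only [Finset.mem_range] at hi
      rw [Nat.cast_sub (by omega)]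
    · rw [Finset.prod_eq_zero (Finset.mem_range.mpr hk) (sub_self _),
        Finset.prod_eq_zero (Finset.mem_range.mpr hk) (Nat.sub_self _), Nat.cast_zero]
  rw [h2, Nat.descFactorial_eq_factorial_mul_choose] at h1
  have h3 : ((-1 : ℝ) ^ k) * (-1) ^ k = 1 := by rw [← mul_pow]; simp
  push_cast at h1
  rw [mul_assoc, h1, ← mul_assoc, h3, one_mul]

theorem isThinning_expSeq {A B : ℝ} (hA : 0 < A) (hB : 0 < B) :
    IsThinning (fun x => (x : ℝ)) (expSeq A) (expSeq B) (fun k => (A / (A + B)) ^ k) := by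
  have key : ∀ C : ℝ, ∀ k z, expSeq C (z + k) *
      (newton (fun x => (x : ℝ)) k).eval ((z + k : ℕ) : ℝ) = C ^ k * expSeq C z := fun C k z => by
    rw [newton_natCast, expSeq, expSeq, pow_add]
    field_simp
  refine .of_shift_family (α' := fun _ => expSeq A) (key A) (fun k => cauchyProd_expSeq A B)
    (D := fun k => (A + B) ^ k) (fun k n => ?_) fun k => ?_
  · rw [cauchyProd_expSeq, key]
  · have : A + B ≠ 0 := by positivity
    rw [div_pow]
    field_simp

theorem hahnSeq_mul_newton (t a : ℝ) (k z : ℕ) : hahnSeq t a (z + k) *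
    (newton (fun x => (x : ℝ)) k).eval ((z + k : ℕ) : ℝ) =
      t ^ k * poch a k * hahnSeq t (a + k) z := by
  rw [newton_natCast, hahnSeq, hahnSeq, add_comm z k, poch_add, pow_add]
  field_simp

theorem isThinning_hahnSeq {t a b : ℝ} (ht : 0 < t) (ha : 0 < a) (hb : 0 < b) :
    IsThinning (fun x => (x : ℝ)) (hahnSeq t a) (hahnSeq t b)
      (fun k => poch a k / poch (a + b) k) := by
  refine .of_shift_family (α' := fun k => hahnSeq t (a + k)) (hahnSeq_mul_newton t a)
    (fun k => cauchyProd_hahnSeq t (a + k) b) (D := fun k => t ^ k * poch (a + b) k)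
    (fun k n => ?_) fun k => ?_
  · rw [cauchyProd_hahnSeq, hahnSeq_mul_newton, add_right_comm]
  · have := (poch_pos k (add_pos ha hb)).ne'
    field_simp

section QThinning

variable {q : ℝ}

theorem prod_one_sub_pow (hq : 0 < q) (hq1 : q < 1) (k n : ℕ) :
    ∏ j ∈ Finset.range k, (1 - q ^ (n + k - j)) = qPoch q q (n + k) / qPoch q q n := by
  rw [qPoch_add, mul_div_cancel_left₀ _ (qPoch_pos n hq hq1 hq1).ne', qPoch,
    ← Finset.prod_range_reflect]
  refine Finset.prod_congr rfl fun j hj => ?_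
  simp only [Finset.mem_range] at hj
  rw [mul_assoc, ← pow_add, ← pow_succ']
  congr 2
  omega

theorem newton_inv_pow (hq : 0 < q) (hq1 : q < 1) (k n : ℕ) :
    (newton (fun x => (q ^ x)⁻¹) k).eval ((q ^ (n + k))⁻¹) =
      ((q ^ (n + k))⁻¹) ^ k * (qPoch q q (n + k) / qPoch q q n) := by
  rw [newton_eval, ← prod_one_sub_pow hq hq1, ← Finset.card_range k, ← Finset.prod_const,
    Finset.card_range, ← Finset.prod_mul_distrib]
  refine Finset.prod_congr rfl fun j hj => ?_
  simp only [Finset.mem_range] at hj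
  have h1 : q ^ (n + k) = q ^ j * q ^ (n + k - j) := by
    rw [← pow_add]
    congr 1
    omega
  rw [h1]
  field_simp

theorem newton_pow (hq : 0 < q) (hq1 : q < 1) (k n : ℕ) :
    (newton (fun x => q ^ x) k).eval (q ^ (n + k)) =
      (∏ j ∈ Finset.range k, (-q ^ j)) * (qPoch q q (n + k) / qPoch q q n) := by
  rw [newton_eval, ← prod_one_sub_pow hq hq1, ← Finset.prod_mul_distrib]
  refine Finset.prod_congr rfl fun j hj => ?_
  simp only [Finset.mem_range] at hj
  have h1 : q ^ (n + k) = q ^ j * q ^ (n + k - j) := by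
    rw [← pow_add]
    congr 1
    omega
  rw [h1]
  ring

theorem isThinning_qHahnSeq (hq : 0 < q) (hq1 : q < 1) {t a b : ℝ} (ht : 0 < t)
    (hab : a * b < 1) :
    IsThinning (fun x => (q ^ x)⁻¹) (qHahnSeq q t a) (qHahnSeq q (t * a) b)
      (fun k => qPoch a q k / qPoch (a * b) q k) := by
  have key : ∀ a : ℝ, ∀ k z, qHahnSeq q t a (z + k) *
      (newton (fun x => (q ^ x)⁻¹) k).eval ((q ^ (z + k))⁻¹) =
        (t * (q ^ k)⁻¹) ^ k * qPoch a q k * qHahnSeq q (t * (q ^ k)⁻¹) (a * q ^ k) z :=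
    fun a k z => by
      have h1 := (qPoch_pos z hq hq1 hq1).ne'
      have h2 := (qPoch_pos (z + k) hq hq1 hq1).ne'
      rw [newton_inv_pow hq hq1, qHahnSeq, qHahnSeq]
      nth_rw 2 [add_comm z k]
      rw [qPoch_add]
      have h3 : ((q ^ (z + k))⁻¹) ^ k * t ^ (z + k) =
          (t * (q ^ k)⁻¹) ^ k * (t * (q ^ k)⁻¹) ^ z := by
        rw [← pow_add, mul_pow, inv_pow, inv_pow, ← pow_mul, ← pow_mul, mul_comm (z + k) k,
          add_comm k z]
        ring
      field_simp
      field_simp at h3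
      linear_combination (qPoch a q k * qPoch (a * q ^ k) q z) * h3
  refine .of_shift_family (α' := fun k => qHahnSeq q (t * (q ^ k)⁻¹) (a * q ^ k)) (key a)
    (δ' := fun k => qHahnSeq q (t * (q ^ k)⁻¹) (a * b * q ^ k)) (fun k => ?_)
    (D := fun k => (t * (q ^ k)⁻¹) ^ k * qPoch (a * b) q k) (fun k n => ?_) fun k => ?_
  -- The shift changes `t` and `a` in opposite ways, so their product, the base of the partner
  -- sequence, is unchanged.
  · have h1 : t * a = t * (q ^ k)⁻¹ * (a * q ^ k) := by field_simp
    rw [h1, cauchyProd_qHahnSeq hq hq1]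
    congr 1
    ring
  · rw [cauchyProd_qHahnSeq hq hq1, key]
  · have := (qPoch_pos k hq hq1 hab).ne'
    field_simp

/-- Thinning by the other factor of the `q`-product requires the inverse lattice `q ^ x`: there the
Newton factors shift `c` only and leave the bases `t * b` and `t` untouched. -/
theorem isThinning_qHahnSeq_reverse (hq : 0 < q) (hq1 : q < 1) {t b c : ℝ} (ht : 0 < t)
    (hbc : b * c < 1) :
    IsThinning (fun x => q ^ x) (qHahnSeq q (t * b) c) (qHahnSeq q t b)
      (fun k => b ^ k * qPoch c q k / qPoch (b * c) q k) := by
  have key : ∀ t a : ℝ, ∀ k z, qHahnSeq q t a (z + k) *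
      (newton (fun x => q ^ x) k).eval (q ^ (z + k)) =
        (t ^ k * qPoch a q k * ∏ j ∈ Finset.range k, (-q ^ j)) * qHahnSeq q t (a * q ^ k) z :=
    fun t a k z => by
      have h1 := (qPoch_pos z hq hq1 hq1).ne'
      have h2 := (qPoch_pos (z + k) hq hq1 hq1).ne'
      rw [newton_pow hq hq1, qHahnSeq, qHahnSeq]
      nth_rw 2 [add_comm z k]
      rw [qPoch_add, pow_add]
      field_simp
  have hcomm : ∀ α β : ℕ → ℝ, cauchyProd α β = cauchyProd β α := fun α β =>
    funext (cauchyProd_comm α β)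
  refine .of_shift_family (α' := fun k => qHahnSeq q (t * b) (c * q ^ k)) (key (t * b) c)
    (δ' := fun k => qHahnSeq q t (b * c * q ^ k)) (fun k => ?_)
    (D := fun k => t ^ k * qPoch (b * c) q k * ∏ j ∈ Finset.range k, (-q ^ j))
    (fun k n => ?_) fun k => ?_
  · rw [hcomm, cauchyProd_qHahnSeq hq hq1, mul_assoc]
  · rw [hcomm, cauchyProd_qHahnSeq hq hq1, key]
  · have := (qPoch_pos k hq hq1 hbc).ne'
    rw [mul_pow]
    field_simp

end QThinning

/-! ### The Chu–Vandermonde identities -/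

/-- Induction on `n` for all `c`, in the form free of denominators. Pascal's rule splits the sum
into two with the common terms of the sum for `n` and `c + 1`; their coefficients are `c + k` and `b
+ k`, whose difference `c - b` is the missing factor. -/
theorem chuVandermonde (b c : ℝ) (n : ℕ) :
    ∑ k ∈ Finset.range (n + 1), (n.choose k : ℝ) * (-1) ^ k * poch b k * poch (c + k) (n - k) =
      poch (c - b) n := by
  induction n generalizing c with
  | zero => simp
  | succ n ih =>
    have h1 : ∀ k ∈ Finset.range (n + 1),
        ((n + 1).choose (k + 1) : ℝ) * (-1) ^ (k + 1) * poch b (k + 1) *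
          poch (c + (k + 1 : ℕ)) (n + 1 - (k + 1)) =
        (n.choose (k + 1) : ℝ) * (-1) ^ (k + 1) * poch b (k + 1) *
          poch (c + (k + 1 : ℕ)) (n - k) -
        (b + k) * ((n.choose k : ℝ) * (-1) ^ k * poch b k * poch (c + 1 + k) (n - k)) := by
      intro k _
      rw [Nat.choose_succ_succ, Nat.add_sub_add_right, poch_succ b k,
        show c + ((k + 1 : ℕ) : ℝ) = c + 1 + k by push_cast; ring]
      push_cast
      ring
    have h2 : ∀ k ∈ Finset.range (n + 1),
        (n.choose k : ℝ) * (-1) ^ k * poch b k * poch (c + k) (n + 1 - k) =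
        (c + k) * ((n.choose k : ℝ) * (-1) ^ k * poch b k * poch (c + 1 + k) (n - k)) := by
      intro k hk
      simp only [Finset.mem_range] at hk
      rw [show n + 1 - k = n - k + 1 by omega, poch_succ' (c + k),
        show c + k + 1 = c + 1 + k by ring]
      ring
    have h3 : ∑ k ∈ Finset.range (n + 1), (n.choose (k + 1) : ℝ) * (-1) ^ (k + 1) *
        poch b (k + 1) * poch (c + (k + 1 : ℕ)) (n - k) + poch c (n + 1) =
        ∑ k ∈ Finset.range (n + 1),
          (n.choose k : ℝ) * (-1) ^ k * poch b k * poch (c + k) (n + 1 - k) := by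
      rw [Finset.sum_range_succ, Finset.sum_range_succ' _ n]
      simp
    rw [Finset.sum_range_succ', Finset.sum_congr rfl h1, Finset.sum_sub_distrib]
    have h4 : poch (c - b) (n + 1) = (c - b) * poch (c + 1 - b) n := by
      rw [poch_succ', show c - b + 1 = c + 1 - b by ring]
    rw [h4, ← ih, sub_add_eq_add_sub]
    simp only [Nat.choose_zero_right, Nat.cast_one, pow_zero, mul_one, poch_zero, Nat.cast_zero,
      add_zero, Nat.sub_zero, one_mul]
    rw [h3, Finset.sum_congr rfl h2, ← Finset.sum_sub_distrib, Finset.mul_sum]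
    exact Finset.sum_congr rfl fun k _ => by ring

theorem chuVandermonde_div (b : ℝ) {c : ℝ} {n : ℕ} (hc : poch c n ≠ 0) :
    ∑ k ∈ Finset.range (n + 1), (n.choose k : ℝ) * (-1) ^ k * (poch b k / poch c k) =
      poch (c - b) n / poch c n := by
  rw [eq_div_iff hc, ← chuVandermonde, Finset.sum_mul]
  refine Finset.sum_congr rfl fun k hk => ?_
  simp only [Finset.mem_range] at hk
  have h1 := poch_add c k (n - k)
  rw [Nat.add_sub_cancel' (by omega)] at h1
  have h2 : poch c k ≠ 0 := fun h => hc (by rw [h1, h, zero_mul])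
  rw [h1]
  field_simp

/-- The coefficients `(q ^ (-n); q)_k q ^ k / (q; q)_k`. -/
def qVandermondeCoeff (q : ℝ) (n k : ℕ) : ℝ := qPoch ((q ^ n)⁻¹) q k * q ^ k / qPoch q q k

theorem qPoch_inv_pow_of_lt {q : ℝ} (hq : 0 < q) {n k : ℕ} (h : n < k) :
    qPoch ((q ^ n)⁻¹) q k = 0 := by
  refine Finset.prod_eq_zero (Finset.mem_range.mpr h) ?_
  rw [inv_mul_cancel₀ (by positivity), sub_self]

theorem qVandermondeCoeff_of_lt {q : ℝ} (hq : 0 < q) {n k : ℕ} (h : n < k) :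
    qVandermondeCoeff q n k = 0 := by
  rw [qVandermondeCoeff, qPoch_inv_pow_of_lt hq h, zero_mul, zero_div]

theorem qVandermondeCoeff_succ {q : ℝ} (hq : 0 < q) (hq1 : q < 1) (n k : ℕ) :
    qVandermondeCoeff q (n + 1) (k + 1) =
      (q ^ (k + 1))⁻¹ * qVandermondeCoeff q n (k + 1) -
        (q ^ k)⁻¹ * qVandermondeCoeff q n k := by
  have h1 := (qPoch_pos k hq hq1 hq1).ne'
  have h2 := (one_sub_pow_pos hq hq1 k).ne'
  have h3 : qPoch ((q ^ (n + 1))⁻¹) q (k + 1) =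
      (1 - (q ^ (n + 1))⁻¹) * qPoch ((q ^ n)⁻¹) q k := by
    rw [qPoch_succ', show (q ^ (n + 1))⁻¹ * q = (q ^ n)⁻¹ by rw [pow_succ]; field_simp]
  unfold qVandermondeCoeff
  rw [h3, qPoch_succ, qPoch_succ, ← pow_succ']
  field_simp
  ring

/-- The induction of `chuVandermonde` with the `q`-Pascal rule `qVandermondeCoeff_succ`: now the
coefficients are `(q ^ k)⁻¹ - c` and `(q ^ k)⁻¹ - b`, with difference `b - c`. -/
theorem qChuVandermonde {q : ℝ} (hq : 0 < q) (hq1 : q < 1) (b c : ℝ) (n : ℕ) :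
    ∑ k ∈ Finset.range (n + 1), qVandermondeCoeff q n k * qPoch b q k *
        qPoch (c * q ^ k) q (n - k) = ∏ i ∈ Finset.range n, (b - c * q ^ i) := by
  induction n generalizing c with
  | zero => simp [qVandermondeCoeff]
  | succ n ih =>
    have h1 : ∀ k ∈ Finset.range (n + 1),
        qVandermondeCoeff q (n + 1) (k + 1) * qPoch b q (k + 1) *
          qPoch (c * q ^ (k + 1)) q (n + 1 - (k + 1)) =
        (q ^ (k + 1))⁻¹ * qVandermondeCoeff q n (k + 1) * qPoch b q (k + 1) *
          qPoch (c * q ^ (k + 1)) q (n - k) -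
        ((q ^ k)⁻¹ - b) * (qVandermondeCoeff q n k * qPoch b q k *
          qPoch (c * q * q ^ k) q (n - k)) := by
      intro k _
      rw [qVandermondeCoeff_succ hq hq1, Nat.add_sub_add_right, qPoch_succ b q k,
        show c * q ^ (k + 1) = c * q * q ^ k by ring]
      field_simp
    have h2 : ∀ k ∈ Finset.range (n + 1),
        (q ^ k)⁻¹ * qVandermondeCoeff q n k * qPoch b q k * qPoch (c * q ^ k) q (n + 1 - k) =
        ((q ^ k)⁻¹ - c) * (qVandermondeCoeff q n k * qPoch b q k *
          qPoch (c * q * q ^ k) q (n - k)) := by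
      intro k hk
      simp only [Finset.mem_range] at hk
      rw [show n + 1 - k = n - k + 1 by omega, qPoch_succ' (c * q ^ k),
        show c * q ^ k * q = c * q * q ^ k by ring]
      field_simp
    have h3 : ∑ k ∈ Finset.range (n + 1), (q ^ (k + 1))⁻¹ * qVandermondeCoeff q n (k + 1) *
        qPoch b q (k + 1) * qPoch (c * q ^ (k + 1)) q (n - k) + qPoch c q (n + 1) =
        ∑ k ∈ Finset.range (n + 1),
          (q ^ k)⁻¹ * qVandermondeCoeff q n k * qPoch b q k *
            qPoch (c * q ^ k) q (n + 1 - k) := by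
      rw [Finset.sum_range_succ, Finset.sum_range_succ' _ n,
        qVandermondeCoeff_of_lt hq (Nat.lt_succ_self n)]
      simp [qVandermondeCoeff]
    rw [Finset.sum_range_succ', Finset.sum_congr rfl h1, Finset.sum_sub_distrib]
    have h4 : ∏ i ∈ Finset.range (n + 1), (b - c * q ^ i) =
        (b - c) * ∏ i ∈ Finset.range n, (b - c * q * q ^ i) := by
      rw [Finset.prod_range_succ', mul_comm, pow_zero, mul_one]
      congr 1
      exact Finset.prod_congr rfl fun i _ => by ring
    have h5 : qVandermondeCoeff q (n + 1) 0 * qPoch b q 0 *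
        qPoch (c * q ^ 0) q (n + 1 - 0) = qPoch c q (n + 1) := by
      simp [qVandermondeCoeff]
    rw [h4, ← ih, sub_add_eq_add_sub, h5, h3, Finset.sum_congr rfl h2,
      ← Finset.sum_sub_distrib, Finset.mul_sum]
    exact Finset.sum_congr rfl fun k _ => by ring

theorem qChuVandermonde_div {q : ℝ} (hq : 0 < q) (hq1 : q < 1) (b : ℝ) {c : ℝ} {n : ℕ}
    (hc : qPoch c q n ≠ 0) :
    ∑ k ∈ Finset.range (n + 1), qVandermondeCoeff q n k * (qPoch b q k / qPoch c q k) =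
      (∏ i ∈ Finset.range n, (b - c * q ^ i)) / qPoch c q n := by
  rw [eq_div_iff hc, ← qChuVandermonde hq hq1, Finset.sum_mul]
  refine Finset.sum_congr rfl fun k hk => ?_
  simp only [Finset.mem_range] at hk
  have h1 := qPoch_add c q k (n - k)
  rw [Nat.add_sub_cancel' (by omega)] at h1
  have h2 : qPoch c q k ≠ 0 := fun h => hc (by rw [h1, h, zero_mul])
  rw [h1]
  field_simp

/-! ### Orthogonality of the Krawtchouk and Hahn polynomials -/

open Polynomial in
/-- The polynomial with the coefficients `c k` in the Newton basis. -/
def newtonSum (u c : ℕ → ℝ) (n : ℕ) : ℝ[X] := ∑ k ∈ Finset.range (n + 1), C (c k) * newton u k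

section NewtonSum

variable (u c : ℕ → ℝ) (n : ℕ)

theorem newtonSum_natDegree_le : (newtonSum u c n).natDegree ≤ n :=
  Polynomial.natDegree_sum_le_of_forall_le _ _ fun k hk =>
    (Polynomial.natDegree_C_mul_le _ _).trans (by
      rw [newton_natDegree]
      simp only [Finset.mem_range] at hk
      omega)

theorem newtonSum_coeff : (newtonSum u c n).coeff n = c n := by
  rw [newtonSum, Polynomial.finsetSum_coeff, Finset.sum_range_succ, Finset.sum_eq_zero]
  · rw [Polynomial.coeff_C_mul, newton_coeff_self, zero_add, mul_one]
  · intro k hk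
    rw [Polynomial.coeff_C_mul, Polynomial.coeff_eq_zero_of_natDegree_lt, mul_zero]
    rw [newton_natDegree]
    simpa using hk

theorem newtonSum_eval (t : ℝ) :
    (newtonSum u c n).eval t = ∑ k ∈ Finset.range (n + 1), c k * (newton u k).eval t := by
  simp [newtonSum, Polynomial.eval_finsetSum]

theorem newtonSum_eval_zero : (newtonSum u c n).eval (u 0) = c 0 := by
  rw [newtonSum_eval, Finset.sum_range_succ', Finset.sum_eq_zero]
  · simp [newton]
  · intro k _
    rw [newton_eval_of_lt u (Nat.succ_pos k), mul_zero]

variable {u c n}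

theorem sum_splitMeasure_newtonSum {α β T m : ℕ → ℝ} {N : ℕ}
    (h : ∀ k ≤ n, ∑ x ∈ Finset.range (N + 1), α x * (β (N - x) * T x) * (newton u k).eval (u x) =
      m k) :
    ∑ x ∈ Finset.range (N + 1), splitMeasure α β N x * (newtonSum u c n).eval (u x) * T x =
      (∑ k ∈ Finset.range (n + 1), c k * m k) / cauchyProd α β N := by
  have h1 : ∑ k ∈ Finset.range (n + 1), c k * m k = ∑ k ∈ Finset.range (n + 1),
      ∑ x ∈ Finset.range (N + 1), c k * (α x * (β (N - x) * T x) * (newton u k).eval (u x)) := by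
    refine Finset.sum_congr rfl fun k hk => ?_
    simp only [Finset.mem_range] at hk
    rw [← h k (by omega), Finset.mul_sum]
  rw [h1, Finset.sum_comm, Finset.sum_div]
  refine Finset.sum_congr rfl fun x _ => ?_
  rw [newtonSum_eval, splitMeasure, Finset.mul_sum, Finset.sum_mul, Finset.sum_div]
  exact Finset.sum_congr rfl fun k _ => by ring

/-- If the test polynomial is absorbed by the second weight, changing `β` to a multiple of `β'`,
each moment is the thinning identity for `α` and `β'` at `y = N`. -/
theorem IsThinning.sum_test {α β β' c' T : ℕ → ℝ} {N : ℕ} {τ : ℝ} (h : IsThinning u α β' c')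
    (hT : ∀ x ≤ N, β (N - x) * T x = τ * β' (N - x)) (k : ℕ) :
    ∑ x ∈ Finset.range (N + 1), α x * (β (N - x) * T x) * (newton u k).eval (u x) =
      τ * (c' k * (newton u k).eval (u N) * cauchyProd α β' N) := by
  rw [← h k N, Finset.mul_sum]
  refine Finset.sum_congr rfl fun x hx => ?_
  simp only [Finset.mem_range] at hx
  rw [hT x (by omega)]
  ring

end NewtonSum

theorem newton_id_self {N k : ℕ} (h : k ≤ N) : (newton (fun x => (x : ℝ)) k).eval (N : ℝ) =
    (N.factorial : ℝ) / ((N - k).factorial : ℝ) := by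
  have := newton_natCast k (N - k)
  rwa [Nat.sub_add_cancel h] at this

theorem newton_id_pos {N k : ℕ} (h : k ≤ N) :
    0 < (newton (fun x => (x : ℝ)) k).eval (N : ℝ) := by
  rw [newton_id_self h]
  positivity

/-- The coefficients of the Krawtchouk polynomials in the Newton basis. -/
def krawtchoukCoeff (a : ℝ) (N n k : ℕ) : ℝ :=
  (n.choose k : ℝ) * (-1) ^ k * (a⁻¹) ^ k / (newton (fun x => (x : ℝ)) k).eval (N : ℝ)

theorem tsum_eq_sum_of_lt {f : ℕ → ℝ} {n : ℕ} (h : ∀ k, n < k → f k = 0) :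
    ∑' k, f k = ∑ k ∈ Finset.range (n + 1), f k :=
  tsum_eq_sum fun k hk => h k (by simpa using hk)

theorem poch_neg_natCast_of_lt {n k : ℕ} (h : n < k) : poch (-(n : ℝ)) k = 0 := by
  rw [poch_neg_natCast, Nat.choose_eq_zero_of_lt h]
  simp

theorem poch_neg_eq_newton (x : ℝ) (k : ℕ) :
    poch (-x) k = (-1) ^ k * (newton (fun x => (x : ℝ)) k).eval x := by
  rw [newton_id_eq_poch, ← mul_assoc, ← mul_pow]
  simp

theorem krawtchoukPoly_eq (a : ℝ) (N n x : ℕ) :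
    krawtchoukPoly a N n x =
      (newtonSum (fun x => (x : ℝ)) (krawtchoukCoeff a N n) n).eval (x : ℝ) := by
  rw [krawtchoukPoly, hyper, tsum_eq_sum_of_lt (n := n), newtonSum_eval]
  · refine Finset.sum_congr rfl fun k _ => ?_
    simp only [List.map_cons, List.map_nil, List.prod_cons, List.prod_nil, mul_one]
    rw [poch_neg_natCast n k, poch_neg_eq_newton, poch_neg_eq_newton, krawtchoukCoeff]
    field_simp
  · intro k hk
    simp [poch_neg_natCast_of_lt hk]

theorem expSeq_mul_newton (C : ℝ) (k z : ℕ) : expSeq C (z + k) *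
    (newton (fun x => (x : ℝ)) k).eval ((z + k : ℕ) : ℝ) = C ^ k * expSeq C z := by
  rw [newton_natCast, expSeq, expSeq, pow_add]
  field_simp

theorem krawtchoukMeasure_eq {a A B : ℝ} (hA : 0 < A) (hB : 0 < B) (ha : a = A / (A + B))
    {N x : ℕ} (hx : x ≤ N) :
    krawtchoukMeasure a N x = splitMeasure (expSeq A) (expSeq B) N x := by
  have h1 : 1 - a = B / (A + B) := by
    rw [ha]
    field_simp
    ring
  have h2 : (A + B) ^ N = (A + B) ^ x * (A + B) ^ (N - x) := by
    rw [← pow_add, Nat.add_sub_cancel' hx]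
  have h3 : 0 < A + B := by positivity
  rw [krawtchoukMeasure, splitMeasure, cauchyProd_expSeq, h1, ha, Nat.cast_choose ℝ hx, expSeq,
    expSeq, expSeq, h2, div_pow, div_pow]
  field_simp

theorem newton_reflect (s : ℝ) (u : ℕ → ℝ) (j : ℕ) (x : ℝ) :
    (newton (fun i => s - u i) j).eval x = (-1) ^ j * (newton u j).eval (s - x) := by
  rw [newton_eval, newton_eval, ← Finset.card_range j, ← Finset.prod_const, Finset.card_range,
    ← Finset.prod_mul_distrib]
  exact Finset.prod_congr rfl fun i _ => by ring

/-- With nodes `N, N - 1, …` the test polynomial is, up to sign, the falling factorial of `N - x`,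
which shifts the index of `expSeq B` by `j`. What remains is the thinning identity for `N - j`. -/
theorem sum_krawtchouk_test (A B : ℝ) (hA : 0 < A) (hB : 0 < B) {N j : ℕ} (hj : j ≤ N) (k : ℕ) :
    ∑ x ∈ Finset.range (N + 1), expSeq A x *
      (expSeq B (N - x) * (newton (fun i => (N : ℝ) - i) j).eval (x : ℝ)) *
        (newton (fun x => (x : ℝ)) k).eval (x : ℝ) =
      (-1) ^ j * B ^ j * ((A / (A + B)) ^ k *
        (newton (fun x => (x : ℝ)) k).eval ((N - j : ℕ) : ℝ) * expSeq (A + B) (N - j)) := by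
  obtain ⟨M, rfl⟩ := Nat.exists_eq_add_of_le' hj
  rw [Nat.add_sub_cancel, ← cauchyProd_expSeq, ← isThinning_expSeq hA hB k M,
    show M + j + 1 = M + 1 + j by ring, Finset.sum_range_add, Finset.mul_sum]
  have h0 : ∑ x ∈ Finset.range j, expSeq A (M + 1 + x) *
      (expSeq B (M + j - (M + 1 + x)) *
        (newton (fun i => ((M + j : ℕ) : ℝ) - i) j).eval ((M + 1 + x : ℕ) : ℝ)) *
        (newton (fun x => (x : ℝ)) k).eval ((M + 1 + x : ℕ) : ℝ) = 0 := by
    refine Finset.sum_eq_zero fun x hx => ?_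
    simp only [Finset.mem_range] at hx
    rw [newton_reflect, ← Nat.cast_sub (by omega), newton_eval_of_lt _ (by omega)]
    ring
  rw [h0, add_zero]
  refine Finset.sum_congr rfl fun x hx => ?_
  simp only [Finset.mem_range] at hx
  have h1 := expSeq_mul_newton B j (M - x)
  have h2 : M - x + j = M + j - x := by omega
  rw [h2] at h1
  rw [newton_reflect, ← Nat.cast_sub (by omega)]
  linear_combination (expSeq A x * (-1) ^ j *
    (newton (fun x => (x : ℝ)) k).eval (x : ℝ)) * h1

theorem isOrthogonalPolys_krawtchouk {a : ℝ} (ha : 0 < a) (ha1 : a < 1) (N : ℕ) :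
    IsOrthogonalPolys (V := Fin (N + 1)) (fun x => krawtchoukMeasure a N x) (fun x => (x : ℕ))
      (fun n => n) (fun n => newtonSum (fun x => (x : ℝ)) (krawtchoukCoeff a N n) n)
      (fun n => krawtchoukNormSq a N n) := by
  have hb : 0 < 1 - a := sub_pos.mpr ha1
  refine .of_tests (T := fun _ j => newton (fun i => (N : ℝ) - i) j)
    (fun n => newtonSum_natDegree_le _ _ _) (fun n => ?_) (fun n => ?_)
    (fun n j => (newton_natDegree _ j).le) (fun n j => by simp [newton_coeff_self])
    fun n j hj => ?_
  · have := (newton_id_pos (Fin.is_le n)).ne'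
    rw [newtonSum_coeff, krawtchoukCoeff]
    simp [this, ha.ne']
  · have := Nat.choose_pos (Fin.is_le n)
    unfold krawtchoukNormSq
    positivity
  · have hn := Fin.is_le n
    generalize (n : ℕ) = n at hn hj
    simp only [newtonSum_coeff, newton_coeff_self]
    refine hasSum_fin (f := fun x => krawtchoukMeasure a N x *
      (newtonSum (fun x => (x : ℝ)) (krawtchoukCoeff a N n) n).eval (x : ℝ) *
        (newton (fun i => (N : ℝ) - i) j).eval (x : ℝ)) ?_
    have h1 := sum_splitMeasure_newtonSum (u := fun x => (x : ℝ)) (c := krawtchoukCoeff a N n)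
      (n := n) (T := fun x => (newton (fun i => (N : ℝ) - i) j).eval (x : ℝ))
      fun k _ => sum_krawtchouk_test a (1 - a) ha hb (hj.trans hn) k
    have h2 : ∀ x ∈ Finset.range (N + 1), krawtchoukMeasure a N x =
        splitMeasure (expSeq a) (expSeq (1 - a)) N x := fun x hx =>
      krawtchoukMeasure_eq ha hb (by ring) (by simp at hx; omega)
    rw [Finset.sum_congr rfl fun x hx => by rw [h2 x hx], h1, cauchyProd_expSeq]
    have hN : poch (-(N : ℝ)) n ≠ 0 := by
      have := (newton_id_pos hn).ne'
      rw [poch_neg_eq_newton]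
      simp [this]
    -- The sum over `k` has parameters `-(N - j)` and `-N`, so its numerator is the shifted
    -- factorial of `-j` with `n` factors, zero unless `j = n`.
    have h3 := chuVandermonde_div (-((N - j : ℕ) : ℝ)) hN
    have h4 : ∑ k ∈ Finset.range (n + 1), krawtchoukCoeff a N n k *
        ((-1) ^ j * (1 - a) ^ j * ((a / (a + (1 - a))) ^ k *
          (newton (fun x => (x : ℝ)) k).eval ((N - j : ℕ) : ℝ) *
            expSeq (a + (1 - a)) (N - j))) =
        (-1) ^ j * (1 - a) ^ j * expSeq 1 (N - j) *
          (poch (-(N : ℝ) - -((N - j : ℕ) : ℝ)) n / poch (-(N : ℝ)) n) := by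
      rw [← h3, Finset.mul_sum]
      refine Finset.sum_congr rfl fun k hk => ?_
      simp only [Finset.mem_range] at hk
      have h5 := (newton_id_pos (show k ≤ N by omega)).ne'
      rw [show a + (1 - a) = 1 by ring, poch_neg_eq_newton, poch_neg_eq_newton, krawtchoukCoeff,
        div_one, inv_pow]
      field_simp
    rw [h4, show a + (1 - a) = 1 by ring, Nat.cast_sub (hj.trans hn),
      show -(N : ℝ) - -((N : ℝ) - (j : ℝ)) = -(j : ℝ) by ring]
    split_ifs with hjn
    · subst hjn
      have h6 : ((N.choose j : ℕ) : ℝ) ≠ 0 := by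
        have := Nat.choose_pos hn
        positivity
      rw [poch_neg_natCast, poch_neg_natCast, krawtchoukCoeff, krawtchoukNormSq, newton_id_self hn,
        expSeq, expSeq, Nat.choose_self, Nat.cast_choose ℝ hn, one_pow, one_pow, inv_pow, div_pow]
      have h8 : ((-1 : ℝ) ^ j) ^ 2 = 1 := by rw [← pow_mul, mul_comm, pow_mul]; simp
      field_simp
      rw [h8]
      simp
    · rw [poch_neg_natCast_of_lt (by omega)]
      simp

/-- The coefficients of the Hahn polynomials in the Newton basis. -/
def hahnCoeff (a b : ℝ) (N n k : ℕ) : ℝ :=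
  (n.choose k : ℝ) * (-1) ^ k * poch (n + a + b - 1) k /
    (poch a k * (newton (fun x => (x : ℝ)) k).eval (N : ℝ))

theorem hahnPoly_eq (a b : ℝ) (N n x : ℕ) :
    hahnPoly a b N n x =
      (newtonSum (fun x => (x : ℝ)) (hahnCoeff a b N n) n).eval (x : ℝ) := by
  rw [hahnPoly, hyper, tsum_eq_sum_of_lt (n := n), newtonSum_eval]
  · refine Finset.sum_congr rfl fun k _ => ?_
    simp only [List.map_cons, List.map_nil, List.prod_cons, List.prod_nil, mul_one]
    rw [poch_neg_natCast n k, poch_neg_eq_newton, poch_neg_eq_newton, hahnCoeff]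
    field_simp
    simp
  · intro k hk
    simp [poch_neg_natCast_of_lt hk]

theorem hahnMeasure_eq {a b t : ℝ} (ht : 0 < t) {N x : ℕ} (hx : x ≤ N) :
    hahnMeasure a b N x = splitMeasure (hahnSeq t a) (hahnSeq t b) N x := by
  have h2 : t ^ N = t ^ x * t ^ (N - x) := by
    rw [← pow_add, Nat.add_sub_cancel' hx]
  rw [hahnMeasure, splitMeasure, cauchyProd_hahnSeq, Nat.cast_choose ℝ hx, hahnSeq,
    hahnSeq, hahnSeq, h2]
  field_simp

theorem hahnSeq_mul_poch (t b : ℝ) (j w : ℕ) :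
    hahnSeq t b w * poch (b + w) j = poch b j * hahnSeq t (b + j) w := by
  have h1 := poch_add b w j
  rw [add_comm, poch_add] at h1
  rw [hahnSeq, hahnSeq]
  linear_combination (-t ^ w / (w.factorial : ℝ)) * h1

theorem newton_add_natCast (s : ℝ) (j : ℕ) (x : ℝ) :
    (newton (fun i => s + i) j).eval x = (-1) ^ j * poch (s - x) j := by
  rw [newton_eval, poch_eq_prod, ← Finset.card_range j, ← Finset.prod_const, Finset.card_range,
    ← Finset.prod_mul_distrib]
  exact Finset.prod_congr rfl fun i _ => by ring

theorem hahnNormSq_pos {a b : ℝ} (ha : 0 < a) (hb : 0 < b) {N n : ℕ} (hn : n ≤ N) :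
    0 < hahnNormSq a b N n := by
  unfold hahnNormSq
  split_ifs with h0
  · exact one_pos
  · have h1 : (1 : ℝ) ≤ n := by exact_mod_cast Nat.one_le_iff_ne_zero.mpr h0
    exact div_pos (mul_pos (by exact_mod_cast Nat.choose_pos hn) (mul_pos (mul_pos (poch_pos n ha)
      (by linarith)) (poch_pos N (add_pos ha hb))))
      (mul_pos (poch_pos n hb) (poch_pos (N + 1) (by linarith)))

/-- The base `n + s - 1` may be negative for `n = 0`, where the product is empty; for larger `n` it
is at least `s`. -/
theorem poch_pred_pos {s : ℝ} (hs : 0 < s) (n : ℕ) : 0 < poch (n + s - 1) n := by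
  rcases n with _ | n
  · simp
  · refine poch_pos _ ?_
    have := n.cast_nonneg (α := ℝ)
    push_cast
    linarith

/-- The pairing of top degree, expressed by the leading coefficient and the norming constant. The
case `n = 0` is separate because `n + a + b - 1` may vanish there; otherwise it is a factor that
cancels. -/
theorem hahn_norm_identity {a b : ℝ} (ha : 0 < a) (hb : 0 < b) {N n : ℕ} (hn : n ≤ N) :
    (-1) ^ n * poch b n * (poch (a + b + n) N / poch (a + b) N) *
      ((n.factorial : ℝ) / poch (a + b + n) n) =
      1 / (hahnCoeff a b N n n * hahnNormSq a b N n) := by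
  have hs : 0 < a + b := add_pos ha hb
  rcases Nat.eq_zero_or_pos n with rfl | hpos
  · have := (poch_pos N hs).ne'
    simp [hahnCoeff, hahnNormSq, newton, this]
  · have h1 : (1 : ℝ) ≤ n := by exact_mod_cast hpos
    have e1 : (n : ℝ) + a + b - 1 + 1 = a + b + n := by ring
    have h2 : poch (n + a + b - 1) (N + 1) = (n + a + b - 1) * poch (a + b + n) N := by
      rw [poch_succ', e1]
    have h3 : poch (n + a + b - 1) n * (2 * n + a + b - 1) =
        (n + a + b - 1) * poch (a + b + n) n := by
      rw [show 2 * (n : ℝ) + a + b - 1 = n + a + b - 1 + n by ring, ← poch_succ, poch_succ', e1]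
    have p1 := (poch_pos n ha).ne'
    have p2 := (poch_pos n hb).ne'
    have p3 := (poch_pos N hs).ne'
    have p4 := (poch_pos N (show 0 < a + b + n by linarith)).ne'
    have p5 := (poch_pos n (show 0 < a + b + n by linarith)).ne'
    have p6 : (n : ℝ) + a + b - 1 ≠ 0 := by
      have : (0 : ℝ) < n + a + b - 1 := by linarith
      exact this.ne'
    have h4 : hahnCoeff a b N n n * hahnNormSq a b N n =
        (-1) ^ n * (poch (n + a + b - 1) n * (2 * n + a + b - 1)) * poch (a + b) N /
          ((n.factorial : ℝ) * poch b n * poch (n + a + b - 1) (N + 1)) := by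
      rw [hahnCoeff, hahnNormSq, if_neg hpos.ne', newton_id_self hn, Nat.choose_self,
        Nat.cast_choose ℝ hn]
      have p7 := (poch_pos (N + 1) (show 0 < n + a + b - 1 by linarith)).ne'
      field_simp
      simp
    rw [h4, h3, h2]
    have h8 : ((-1 : ℝ) ^ n) ^ 2 = 1 := by rw [← pow_mul, mul_comm, pow_mul]; simp
    field_simp
    linear_combination h8

theorem isOrthogonalPolys_hahn {a b : ℝ} (ha : 0 < a) (hb : 0 < b) (N : ℕ) :
    IsOrthogonalPolys (V := Fin (N + 1)) (fun x => hahnMeasure a b N x) (fun x => (x : ℕ))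
      (fun n => n) (fun n => newtonSum (fun x => (x : ℝ)) (hahnCoeff a b N n) n)
      (fun n => hahnNormSq a b N n) := by
  have hs : 0 < a + b := add_pos ha hb
  -- Up to sign these tests are the shifted factorials of `b + N - x`; multiplied into the weight
  -- with parameter `b` they replace it by `b + j`.
  refine .of_tests (T := fun _ j => newton (fun i => b + N + i) j)
    (fun n => newtonSum_natDegree_le _ _ _) (fun n => ?_) (fun n => hahnNormSq_pos ha hb n.is_le)
    (fun n j => (newton_natDegree _ j).le) (fun n j => by simp [newton_coeff_self])
    fun n j hj => ?_
  · have h1 := (newton_id_pos (Fin.is_le n)).ne'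
    have h2 := (poch_pos n ha).ne'
    have h3 := (poch_pred_pos hs n).ne'
    rw [show ((n : ℕ) : ℝ) + (a + b) - 1 = n + a + b - 1 by ring] at h3
    rw [newtonSum_coeff, hahnCoeff]
    simp [h1, h2, h3]
  · have hn := Fin.is_le n
    generalize (n : ℕ) = n at hn hj
    simp only [newtonSum_coeff, newton_coeff_self]
    refine hasSum_fin (f := fun x => hahnMeasure a b N x *
      (newtonSum (fun x => (x : ℝ)) (hahnCoeff a b N n) n).eval (x : ℝ) *
        (newton (fun i => b + N + i) j).eval (x : ℝ)) ?_
    have hbj : 0 < b + j := by positivity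
    have h1 := sum_splitMeasure_newtonSum (u := fun x => (x : ℝ)) (c := hahnCoeff a b N n)
      (n := n) (T := fun x => (newton (fun i => b + N + i) j).eval (x : ℝ))
      fun k _ => (isThinning_hahnSeq one_pos ha hbj).sum_test (β := hahnSeq 1 b) (N := N)
        (τ := (-1) ^ j * poch b j) (fun x hx => by
          have := hahnSeq_mul_poch 1 b j (N - x)
          rw [Nat.cast_sub hx] at this
          rw [newton_add_natCast, show b + N - x = b + (N - x : ℝ) by ring]
          linear_combination (-1) ^ j * this) k
    have h2 : ∀ x ∈ Finset.range (N + 1), hahnMeasure a b N x =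
        splitMeasure (hahnSeq 1 a) (hahnSeq 1 b) N x := fun x hx =>
      hahnMeasure_eq one_pos (by simp at hx; omega)
    rw [Finset.sum_congr rfl fun x hx => by rw [h2 x hx], h1, cauchyProd_hahnSeq,
      cauchyProd_hahnSeq]
    have hsj : 0 < a + b + j := by positivity
    have h3 := chuVandermonde_div (n + a + b - 1) (poch_pos n hsj).ne'
    have h4 : ∑ k ∈ Finset.range (n + 1), hahnCoeff a b N n k *
        ((-1) ^ j * poch b j * (poch a k / poch (a + (b + j)) k *
          (newton (fun x => (x : ℝ)) k).eval (N : ℝ) * hahnSeq 1 (a + (b + j)) N)) =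
        (-1) ^ j * poch b j * hahnSeq 1 (a + b + j) N *
          (poch (a + b + j - (n + a + b - 1)) n / poch (a + b + j) n) := by
      rw [← h3, Finset.mul_sum]
      refine Finset.sum_congr rfl fun k hk => ?_
      simp only [Finset.mem_range] at hk
      have h5 := (newton_id_pos (show k ≤ N by omega)).ne'
      have h6 := (poch_pos k ha).ne'
      rw [hahnCoeff, ← add_assoc]
      field_simp
    rw [h4]
    split_ifs with hjn
    · subst hjn
      rw [← hahn_norm_identity ha hb hn, show a + b + j - (j + a + b - 1) = 1 by ring, poch_one,
        hahnSeq, hahnSeq]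
      field_simp
    -- As `j < n`, the Chu–Vandermonde numerator starts at the nonpositive integer `-(n - 1 - j)`
    -- and its `n` factors reach zero.
    · have h7 : a + b + j - (n + a + b - 1) = -((n - 1 - j : ℕ) : ℝ) := by
        rw [Nat.cast_sub (by omega), Nat.cast_sub (by omega)]
        push_cast
        ring
      rw [h7, poch_neg_natCast_of_lt (by omega)]
      simp

/-! ### Orthogonality of the `q`-Hahn polynomials -/

section QHahn

variable {q : ℝ}

theorem newton_inv_pow_self (hq : 0 < q) (hq1 : q < 1) {N k : ℕ} (h : k ≤ N) :
    (newton (fun x => (q ^ x)⁻¹) k).eval ((q ^ N)⁻¹) =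
      ((q ^ N)⁻¹) ^ k * (qPoch q q N / qPoch q q (N - k)) := by
  have := newton_inv_pow hq hq1 k (N - k)
  rwa [Nat.sub_add_cancel h] at this

theorem newton_inv_pow_pos (hq : 0 < q) (hq1 : q < 1) {N k : ℕ} (h : k ≤ N) :
    0 < (newton (fun x => (q ^ x)⁻¹) k).eval ((q ^ N)⁻¹) := by
  rw [newton_inv_pow_self hq hq1 h]
  have := qPoch_pos N hq hq1 hq1
  have := qPoch_pos (N - k) hq hq1 hq1
  positivity

theorem qPoch_eq_newton (hq : 0 < q) (k : ℕ) (t : ℝ) :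
    qPoch t q k =
      (∏ i ∈ Finset.range k, (-q ^ i)) * (newton (fun x => (q ^ x)⁻¹) k).eval t := by
  rw [newton_eval, qPoch, ← Finset.prod_mul_distrib]
  refine Finset.prod_congr rfl fun i _ => ?_
  field_simp
  ring

theorem prod_neg_pow_ne_zero (hq : 0 < q) (k : ℕ) : ∏ i ∈ Finset.range k, (-q ^ i) ≠ 0 :=
  Finset.prod_ne_zero_iff.mpr fun i _ => by simp [hq.ne']

/-- The coefficients of the `q`-Hahn polynomials in the Newton basis. -/
def qHahnCoeff (q a b : ℝ) (N n k : ℕ) : ℝ :=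
  qVandermondeCoeff q n k * qPoch (a * b * q ^ ((n : ℤ) - 1)) q k /
    (qPoch a q k * (newton (fun x => (q ^ x)⁻¹) k).eval ((q ^ N)⁻¹))

theorem qHahnPoly_eq (hq : 0 < q) (a b : ℝ) (N n x : ℕ) :
    qHahnPoly q a b N n x =
      (newtonSum (fun x => (q ^ x)⁻¹) (qHahnCoeff q a b N n) n).eval ((q ^ x)⁻¹) := by
  rw [qHahnPoly, qHyper, tsum_eq_sum_of_lt (n := n), newtonSum_eval]
  · refine Finset.sum_congr rfl fun k _ => ?_
    have h1 := prod_neg_pow_ne_zero hq k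
    simp only [List.map_cons, List.map_nil, List.prod_cons, List.prod_nil, mul_one, zpow_neg,
      zpow_natCast, List.length_cons, List.length_nil]
    rw [qPoch_eq_newton hq k ((q ^ x)⁻¹), qPoch_eq_newton hq k ((q ^ N)⁻¹), qHahnCoeff,
      qVandermondeCoeff]
    norm_num
    rw [← mul_assoc, ← mul_assoc (qPoch a q k), mul_comm (qPoch a q k)]
    generalize (newton (fun x => (q ^ x)⁻¹) k).eval ((q ^ N)⁻¹) = A
    generalize ∏ i ∈ Finset.range k, (-q ^ i) = B at h1 ⊢
    field_simp
  · intro k hk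
    simp [qPoch_inv_pow_of_lt hq hk]

theorem qHahnMeasure_eq (hq : 0 < q) (hq1 : q < 1) {a b t : ℝ} (ht : 0 < t) {N x : ℕ}
    (hx : x ≤ N) :
    qHahnMeasure q a b N x = splitMeasure (qHahnSeq q t a) (qHahnSeq q (t * a) b) N x := by
  have h2 : t ^ N = t ^ x * t ^ (N - x) := by
    rw [← pow_add, Nat.add_sub_cancel' hx]
  have h3 := (qPoch_pos N hq hq1 hq1).ne'
  rw [qHahnMeasure, splitMeasure, cauchyProd_qHahnSeq hq hq1, qBinom, qHahnSeq,
    qHahnSeq, qHahnSeq, h2, mul_pow]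
  field_simp

/-- The factor of the norming constant complements that of the leading coefficient to `(a b;
q)_{2n}`. As this is positive for `a * b < 1`, the leading coefficient does not vanish, even where
single factors of the usual formula do. -/
theorem qHahnFactor_mul_qPoch (a b : ℝ) (n : ℕ) :
    qHahnFactor q a b n * qPoch (a * b * q ^ ((n : ℤ) - 1)) q n = qPoch (a * b) q (2 * n) := by
  rcases n with _ | n
  · simp [qHahnFactor]
  · have h1 : (((n + 1 : ℕ) : ℤ) - 1) = (n : ℤ) := by push_cast; ring
    have h2 : 2 * ((n + 1 : ℕ) : ℤ) - 1 = ((2 * n + 1 : ℕ) : ℤ) := by push_cast; ring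
    rw [qHahnFactor, if_neg (Nat.succ_ne_zero n), h1, h2, zpow_natCast, zpow_natCast,
      Nat.add_sub_cancel, show 2 * (n + 1) = n + ((n + 1) + 1) by ring, qPoch_add _ _ n (n + 1 + 1),
      qPoch_succ _ _ (n + 1)]
    ring

theorem one_sub_mul_pow_pos (hq : 0 < q) (hq1 : q < 1) {z : ℝ} (hz : z < 1) (n : ℕ) :
    0 < 1 - z * q ^ n := by
  have h1 : q ^ n ≤ 1 := pow_le_one₀ hq.le hq1.le
  have h2 : 0 < q ^ n := by positivity
  rcases le_or_gt z 0 with h | h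
  · nlinarith
  · nlinarith

theorem qHahnFactor_pos (hq : 0 < q) (hq1 : q < 1) {a b : ℝ} (hab : a * b < 1) (n : ℕ) :
    0 < qHahnFactor q a b n := by
  rcases n with _ | n
  · simp [qHahnFactor]
  · have h2 : 2 * ((n + 1 : ℕ) : ℤ) - 1 = ((2 * n + 1 : ℕ) : ℤ) := by push_cast; ring
    rw [qHahnFactor, if_neg (Nat.succ_ne_zero n), h2, zpow_natCast]
    exact mul_pos (qPoch_pos _ hq hq1 hab) (one_sub_mul_pow_pos hq hq1 hab _)

theorem mul_lt_one_of_lt {a b : ℝ} (ha : 0 < a) (ha1 : a < 1) (hb : b < 1) : a * b < 1 := by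
  nlinarith

theorem qBinom_pos (hq : 0 < q) (hq1 : q < 1) (N x : ℕ) : 0 < qBinom q N x :=
  div_pos (qPoch_pos _ hq hq1 hq1) (mul_pos (qPoch_pos _ hq hq1 hq1) (qPoch_pos _ hq hq1 hq1))

theorem mul_pow_lt_one (hq : 0 < q) (hq1 : q < 1) {z : ℝ} (hz : z < 1) (n : ℕ) :
    z * q ^ n < 1 :=
  sub_pos.mp (one_sub_mul_pow_pos hq hq1 hz n)

theorem qHahnNormSq_pos (hq : 0 < q) (hq1 : q < 1) {a b : ℝ} (ha : 0 < a) (ha1 : a < 1)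
    (hb : b < 1) (N n : ℕ) : 0 < qHahnNormSq q a b N n := by
  have hab := mul_lt_one_of_lt ha ha1 hb
  exact mul_pos (mul_pos (qBinom_pos hq hq1 N n) (div_pos (qPoch_pos n hq hq1 ha1)
    (mul_pos (mul_pos (qPoch_pos n hq hq1 (mul_pow_lt_one hq hq1 hab N))
      (qPoch_pos n hq hq1 hb)) (pow_pos ha n)))) (qHahnFactor_pos hq hq1 hab n)

theorem qVandermondeCoeff_self (hq : 0 < q) (hq1 : q < 1) (n : ℕ) :
    qVandermondeCoeff q n n * ∏ i ∈ Finset.range n, (-q ^ i) = 1 := by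
  induction n with
  | zero => simp [qVandermondeCoeff]
  | succ n ih =>
    rw [qVandermondeCoeff_succ hq hq1, qVandermondeCoeff_of_lt hq (Nat.lt_succ_self n),
      Finset.prod_range_succ, ← ih]
    field_simp
    ring

theorem qHahnCoeff_self_ne_zero (hq : 0 < q) (hq1 : q < 1) {a b : ℝ} (ha1 : a < 1)
    (hab : a * b < 1) {N n : ℕ} (hn : n ≤ N) : qHahnCoeff q a b N n n ≠ 0 := by
  have h1 := qHahnFactor_mul_qPoch (q := q) a b n
  refine div_ne_zero (mul_ne_zero ?_ ?_) (mul_ne_zero (qPoch_pos n hq hq1 ha1).ne'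
    (newton_inv_pow_pos hq hq1 hn).ne')
  · exact left_ne_zero_of_mul_eq_one (qVandermondeCoeff_self hq hq1 n)
  · intro h
    rw [h, mul_zero] at h1
    exact (qPoch_pos (2 * n) hq hq1 hab).ne h1

/-- The index `i` is paired with `n - 1 - i`, so that each pair of factors multiplies to `q ^ (n -
1)`. -/
theorem prod_pow_mul_prod_pow (q : ℝ) (n : ℕ) :
    (∏ i ∈ Finset.range n, (-q ^ i)) * ∏ i ∈ Finset.range n, (-q ^ i) = (q ^ (n - 1)) ^ n := by
  nth_rw 1 [← Finset.prod_range_reflect]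
  rw [← Finset.prod_mul_distrib, ← Finset.card_range n, ← Finset.prod_const, Finset.card_range]
  refine Finset.prod_congr rfl fun i hi => ?_
  simp only [Finset.mem_range] at hi
  rw [neg_mul_neg, ← pow_add]
  congr 1
  omega

theorem qHahn_norm_identity (hq : 0 < q) (hq1 : q < 1) {a b : ℝ} (ha : 0 < a) (ha1 : a < 1)
    (hb : b < 1) {N n : ℕ} (hn : n ≤ N) :
    qPoch b q n * (qPoch (a * b * q ^ n) q N / qPoch (a * b) q N) *
      ((∏ i ∈ Finset.range n, (a * b * q ^ ((n : ℤ) - 1) - a * b * q ^ n * q ^ i)) /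
        qPoch (a * b * q ^ n) q n) =
      (∏ i ∈ Finset.range n, (-(b * q ^ N * q ^ i))) /
        (qHahnCoeff q a b N n n * qHahnNormSq q a b N n) := by
  have hs := mul_lt_one_of_lt ha ha1 hb
  have h1 := qHahnFactor_mul_qPoch (q := q) a b n
  have h2 := qVandermondeCoeff_self hq hq1 n
  have h3 := prod_pow_mul_prod_pow q n
  set G := ∏ i ∈ Finset.range n, (-q ^ i)
  have hG : G ≠ 0 := right_ne_zero_of_mul_eq_one h2
  have h4 : ∏ i ∈ Finset.range n, (-(b * q ^ N * q ^ i)) = (b * q ^ N) ^ n * G := by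
    rw [← Finset.card_range n, ← Finset.prod_const, Finset.card_range, ← Finset.prod_mul_distrib]
    exact Finset.prod_congr rfl fun i _ => by ring
  have h5 : ∏ i ∈ Finset.range n, (a * b * q ^ ((n : ℤ) - 1) - a * b * q ^ n * q ^ i) =
      (a * b) ^ n * (q ^ (n - 1)) ^ n * qPoch q q n := by
    rw [qPoch, ← mul_pow, show (a * b * q ^ (n - 1)) ^ n =
      ∏ _i ∈ Finset.range n, a * b * q ^ (n - 1) by simp, ← Finset.prod_mul_distrib]
    refine Finset.prod_congr rfl fun i hi => ?_
    simp only [Finset.mem_range] at hi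
    obtain ⟨m, rfl⟩ : ∃ m, n = m + 1 := ⟨n - 1, by omega⟩
    rw [show ((m + 1 : ℕ) : ℤ) - 1 = (m : ℤ) by push_cast; ring, zpow_natCast,
      Nat.add_sub_cancel]
    ring
  have h6 : qPoch (a * b) q n * qPoch (a * b * q ^ n) q N =
      qPoch (a * b) q N * qPoch (a * b * q ^ N) q n := by
    rw [← qPoch_add, ← qPoch_add, add_comm]
  have h7 : qPoch (a * b) q n * qPoch (a * b * q ^ n) q n = qPoch (a * b) q (2 * n) := by
    rw [← qPoch_add, two_mul]
  have p1 := (qPoch_pos N hq hq1 hs).ne'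
  have p2 := (qPoch_pos n hq hq1 hs).ne'
  have p3 := (qPoch_pos n hq hq1 (mul_pow_lt_one hq hq1 hs n)).ne'
  have p4 := (qPoch_pos n hq hq1 (mul_pow_lt_one hq hq1 hs N)).ne'
  have p5 := (qPoch_pos n hq hq1 ha1).ne'
  have p6 := (qPoch_pos n hq hq1 hb).ne'
  have p7 := (qPoch_pos n hq hq1 hq1).ne'
  have p8 := (qPoch_pos (N - n) hq hq1 hq1).ne'
  have p9 := (qPoch_pos N hq hq1 hq1).ne'
  have h8 : qHahnCoeff q a b N n n * qHahnNormSq q a b N n =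
      (q ^ N) ^ n * qPoch (a * b) q n * qPoch (a * b * q ^ n) q n /
        (G * qPoch q q n * qPoch (a * b * q ^ N) q n * qPoch b q n * a ^ n) := by
    rw [mul_assoc ((q ^ N) ^ n), h7, ← h1, qHahnCoeff, qHahnNormSq, newton_inv_pow_self hq hq1 hn,
      qBinom, eq_div_of_mul_eq hG h2, inv_pow]
    have p10 : (q ^ N) ^ n ≠ 0 := by positivity
    field_simp
  have h9 : qPoch (a * b * q ^ n) q N =
      qPoch (a * b) q N * qPoch (a * b * q ^ N) q n / qPoch (a * b) q n := by
    rw [← h6]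
    field_simp
  rw [h4, h5, h8, h9, mul_pow b, mul_pow a, ← h3]
  field_simp

theorem qHahnSeq_mul_qPoch (t b : ℝ) (j w : ℕ) :
    qHahnSeq q t b w * qPoch (b * q ^ w) q j = qPoch b q j * qHahnSeq q t (b * q ^ j) w := by
  have h1 := qPoch_add b q w j
  rw [add_comm, qPoch_add] at h1
  rw [qHahnSeq, qHahnSeq]
  linear_combination (-t ^ w / qPoch q q w) * h1

theorem qPoch_eq_newton_inv (hq : 0 < q) {s : ℝ} (hs : s ≠ 0) (j : ℕ) (x : ℝ) :
    qPoch (s * x) q j = (∏ i ∈ Finset.range j, (-(s * q ^ i))) *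
      (newton (fun i => (s * q ^ i)⁻¹) j).eval x := by
  rw [newton_eval, qPoch, ← Finset.prod_mul_distrib]
  refine Finset.prod_congr rfl fun i _ => ?_
  field_simp
  ring

/-- The tests are `(b q ^ (N - x); q)_j`, which shift `b` to `b * q ^ j` in the weight. They have
degree exactly `j` in `(q ^ x)⁻¹` only for `b ≠ 0`, whence the restriction. -/
theorem isOrthogonalPolys_qHahn_of_ne_zero (hq : 0 < q) (hq1 : q < 1) {a b : ℝ} (ha : 0 < a)
    (ha1 : a < 1) (hb : b < 1) (hb0 : b ≠ 0) (N : ℕ) :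
    IsOrthogonalPolys (V := Fin (N + 1)) (fun x => qHahnMeasure q a b N x)
      (fun x => (q ^ (x : ℕ))⁻¹) (fun n => n)
      (fun n => newtonSum (fun x => (q ^ x)⁻¹) (qHahnCoeff q a b N n) n)
      (fun n => qHahnNormSq q a b N n) := by
  have hs := mul_lt_one_of_lt ha ha1 hb
  have hbN : b * q ^ N ≠ 0 := mul_ne_zero hb0 (pow_ne_zero _ hq.ne')
  have hT : ∀ j, ∏ i ∈ Finset.range j, (-(b * q ^ N * q ^ i)) ≠ 0 := fun j =>
    Finset.prod_ne_zero_iff.mpr fun i _ => by simp [hq.ne', hb0]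
  refine .of_tests (T := fun _ j => Polynomial.C (∏ i ∈ Finset.range j, (-(b * q ^ N * q ^ i))) *
      newton (fun i => (b * q ^ N * q ^ i)⁻¹) j)
    (fun n => newtonSum_natDegree_le _ _ _) (fun n => ?_)
    (fun n => qHahnNormSq_pos hq hq1 ha ha1 hb N n)
    (fun n j => (Polynomial.natDegree_C_mul_le _ _).trans (newton_natDegree _ j).le)
    (fun n j => by
      rw [Polynomial.coeff_C_mul, newton_coeff_self, mul_one]
      exact hT j)
    fun n j hj => ?_
  · rw [newtonSum_coeff]
    exact qHahnCoeff_self_ne_zero hq hq1 ha1 hs n.is_le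
  · have hn := Fin.is_le n
    generalize (n : ℕ) = n at hn hj
    simp only [newtonSum_coeff, newton_coeff_self, Polynomial.coeff_C_mul, mul_one,
      Polynomial.eval_mul, Polynomial.eval_C, ← qPoch_eq_newton_inv hq hbN]
    refine hasSum_fin (f := fun x => qHahnMeasure q a b N x *
      (newtonSum (fun x => (q ^ x)⁻¹) (qHahnCoeff q a b N n) n).eval ((q ^ x)⁻¹) *
        qPoch (b * q ^ N * (q ^ x)⁻¹) q j) ?_
    have hsj : a * (b * q ^ j) < 1 := by
      rw [← mul_assoc]
      exact mul_pow_lt_one hq hq1 hs j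
    have hsj' : a * b * q ^ j < 1 := by rwa [mul_assoc]
    have h1 := sum_splitMeasure_newtonSum (u := fun x => (q ^ x)⁻¹) (c := qHahnCoeff q a b N n)
      (n := n) (T := fun x => qPoch (b * q ^ N * (q ^ x)⁻¹) q j)
      fun k _ => (isThinning_qHahnSeq hq hq1 one_pos hsj).sum_test (β := qHahnSeq q (1 * a) b)
        (N := N) (τ := qPoch b q j) (fun x hx => by
          rw [← qHahnSeq_mul_qPoch]
          congr 2
          rw [pow_sub₀ q hq.ne' hx, mul_assoc]) k
    have h2 : ∀ x ∈ Finset.range (N + 1), qHahnMeasure q a b N x =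
        splitMeasure (qHahnSeq q 1 a) (qHahnSeq q (1 * a) b) N x := fun x hx =>
      qHahnMeasure_eq hq hq1 one_pos (by simp at hx; omega)
    rw [Finset.sum_congr rfl fun x hx => by rw [h2 x hx], h1, cauchyProd_qHahnSeq hq hq1,
      cauchyProd_qHahnSeq hq hq1]
    have h3 := qChuVandermonde_div hq hq1 (a * b * q ^ ((n : ℤ) - 1))
      (qPoch_pos n hq hq1 hsj').ne'
    have h4 : ∑ k ∈ Finset.range (n + 1), qHahnCoeff q a b N n k *
        (qPoch b q j * (qPoch a q k / qPoch (a * (b * q ^ j)) q k *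
          (newton (fun x => (q ^ x)⁻¹) k).eval ((q ^ N)⁻¹) *
            qHahnSeq q 1 (a * (b * q ^ j)) N)) =
        qPoch b q j * qHahnSeq q 1 (a * b * q ^ j) N *
          ((∏ i ∈ Finset.range n, (a * b * q ^ ((n : ℤ) - 1) - a * b * q ^ j * q ^ i)) /
            qPoch (a * b * q ^ j) q n) := by
      rw [← h3, Finset.mul_sum]
      refine Finset.sum_congr rfl fun k hk => ?_
      simp only [Finset.mem_range] at hk
      have h5 := (newton_inv_pow_pos hq hq1 (show k ≤ N by omega)).ne'
      have h6 := (qPoch_pos k hq hq1 ha1).ne'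
      rw [qHahnCoeff, ← mul_assoc a b]
      generalize (newton (fun x => (q ^ x)⁻¹) k).eval ((q ^ N)⁻¹) = A at h5 ⊢
      field_simp
    rw [h4]
    split_ifs with hjn
    · subst hjn
      rw [← qHahn_norm_identity hq hq1 ha ha1 hb hn, qHahnSeq, qHahnSeq]
      have := (qPoch_pos N hq hq1 hq1).ne'
      field_simp
    -- For `j < n` the factor with `j + i = n - 1` vanishes in the `q`-Chu–Vandermonde product.
    · rw [Finset.prod_eq_zero (i := n - 1 - j) (Finset.mem_range.mpr (by omega))]
      · simp
      · obtain ⟨m, rfl⟩ : ∃ m, n = m + 1 := ⟨n - 1, by omega⟩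
        rw [show ((m + 1 : ℕ) : ℤ) - 1 = (m : ℤ) by push_cast; ring, zpow_natCast,
          mul_assoc (a * b), ← pow_add, show j + (m + 1 - 1 - j) = m by omega, sub_self]

theorem continuous_qPoch {f : ℝ → ℝ} (hf : Continuous f) (q : ℝ) (n : ℕ) :
    Continuous fun b => qPoch (f b) q n := by
  unfold qPoch
  fun_prop

theorem continuousAt_qHahnCoeff (hq : 0 < q) (hq1 : q < 1) {a : ℝ} (ha1 : a < 1) {N n k : ℕ}
    (hk : k ≤ N) (b : ℝ) : ContinuousAt (fun b => qHahnCoeff q a b N n k) b := by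
  unfold qHahnCoeff
  refine ContinuousAt.div ?_ continuousAt_const
    (mul_ne_zero (qPoch_pos k hq hq1 ha1).ne' (newton_inv_pow_pos hq hq1 hk).ne')
  exact (continuous_const.mul (continuous_qPoch (by fun_prop) q k)).continuousAt

theorem continuousAt_qHahnNormSq (hq : 0 < q) (hq1 : q < 1) {a b : ℝ} (ha : 0 < a) (ha1 : a < 1)
    (hb : b < 1) (N n : ℕ) : ContinuousAt (fun b => qHahnNormSq q a b N n) b := by
  have hab := mul_lt_one_of_lt ha ha1 hb
  unfold qHahnNormSq
  refine (continuousAt_const.mul (continuousAt_const.div ?_ ?_)).mul ?_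
  · exact (((continuous_qPoch (by fun_prop) q n).mul (continuous_qPoch continuous_id q n)).mul
      continuous_const).continuousAt
  · exact (mul_pos (mul_pos (qPoch_pos n hq hq1 (mul_pow_lt_one hq hq1 hab N))
      (qPoch_pos n hq hq1 hb)) (pow_pos ha n)).ne'
  · unfold qHahnFactor
    split_ifs
    · exact continuousAt_const
    · exact ((continuous_qPoch (by fun_prop) q _).mul (by fun_prop)).continuousAt

theorem continuousAt_qHahnMeasure (hq : 0 < q) (hq1 : q < 1) {a b : ℝ} (hab : a * b < 1)
    (N x : ℕ) : ContinuousAt (fun b => qHahnMeasure q a b N x) b := by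
  unfold qHahnMeasure
  refine ContinuousAt.div ?_ (continuous_qPoch (by fun_prop) q N).continuousAt
    (qPoch_pos N hq hq1 hab).ne'
  exact (continuous_const.mul ((continuous_const.mul (continuous_qPoch continuous_id q _)).mul
    continuous_const)).continuousAt

/-- For `b = 0` the tests of the generic case degenerate to constants. But for a fixed polynomial
the pairing formula is an identity between functions of `b` continuous at `0`, so it extends from `b
≠ 0`. -/
theorem isOrthogonalPolys_qHahn (hq : 0 < q) (hq1 : q < 1) {a b : ℝ} (ha : 0 < a)
    (ha1 : a < 1) (hb : b < 1) (N : ℕ) :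
    IsOrthogonalPolys (V := Fin (N + 1)) (fun x => qHahnMeasure q a b N x)
      (fun x => (q ^ (x : ℕ))⁻¹) (fun n => n)
      (fun n => newtonSum (fun x => (q ^ x)⁻¹) (qHahnCoeff q a b N n) n)
      (fun n => qHahnNormSq q a b N n) := by
  rcases ne_or_eq b 0 with hb0 | rfl
  · exact isOrthogonalPolys_qHahn_of_ne_zero hq hq1 ha ha1 hb hb0 N
  have hab := mul_lt_one_of_lt ha ha1 hb
  refine ⟨fun n => newtonSum_natDegree_le _ _ _, fun n => ?_,
    fun n => qHahnNormSq_pos hq hq1 ha ha1 hb N n, fun n p hp => ?_⟩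
  · rw [newtonSum_coeff]
    exact qHahnCoeff_self_ne_zero hq hq1 ha1 hab n.is_le
  · have hn := n.is_le
    let F : ℝ → ℝ := fun b => ∑ x : Fin (N + 1), qHahnMeasure q a b N x *
      (∑ k ∈ Finset.range ((n : ℕ) + 1), qHahnCoeff q a b N n k *
        (newton (fun x => (q ^ x)⁻¹) k).eval ((q ^ (x : ℕ))⁻¹)) * p.eval ((q ^ (x : ℕ))⁻¹)
    let R : ℝ → ℝ := fun b => p.coeff n / (qHahnCoeff q a b N n n * qHahnNormSq q a b N n)
    have hF : ContinuousAt F 0 := by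
      refine tendsto_finsetSum _ fun x _ => Filter.Tendsto.mul_const _ (Filter.Tendsto.mul
        (continuousAt_qHahnMeasure hq hq1 hab N x) (tendsto_finsetSum _ fun k hk =>
          Filter.Tendsto.mul_const _ (continuousAt_qHahnCoeff hq hq1 ha1 ?_ 0)))
      simp only [Finset.mem_range] at hk
      omega
    have hR : ContinuousAt R 0 := continuousAt_const.div
      ((continuousAt_qHahnCoeff hq hq1 ha1 hn 0).mul
        (continuousAt_qHahnNormSq hq hq1 ha ha1 hb N n))
      (mul_ne_zero (qHahnCoeff_self_ne_zero hq hq1 ha1 hab hn)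
        (qHahnNormSq_pos hq hq1 ha ha1 hb N n).ne')
    have hFR : F =ᶠ[nhdsWithin 0 {0}ᶜ] R := by
      have h1 : ∀ᶠ b : ℝ in nhdsWithin 0 {0}ᶜ, b < 1 :=
        mem_nhdsWithin_of_mem_nhds (Iio_mem_nhds one_pos)
      filter_upwards [h1, self_mem_nhdsWithin] with b hb1 hb0
      have := (isOrthogonalPolys_qHahn_of_ne_zero hq hq1 ha ha1 hb1 hb0 N).hasSum n p hp
      simp only [newtonSum_coeff, newtonSum_eval] at this
      exact (hasSum_fintype _).unique this
    have h0 : F 0 = R 0 := tendsto_nhds_unique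
      ((hF.tendsto.mono_left nhdsWithin_le_nhds).congr' hFR)
      (hR.tendsto.mono_left nhdsWithin_le_nhds)
    simp only [newtonSum_coeff, newtonSum_eval]
    change HasSum _ (R 0)
    rw [← h0]
    exact hasSum_fintype _

end QHahn

/-! ### Orthogonality of the Charlier and Meixner polynomials -/

theorem hasSum_of_hasSum_shift {f : ℕ → ℝ} {s : ℝ} (k : ℕ) (h : HasSum (fun z => f (z + k)) s)
    (h0 : ∀ x < k, f x = 0) : HasSum f s := by
  rw [hasSum_nat_add_iff, Finset.sum_eq_zero fun x hx => h0 x (Finset.mem_range.mp hx),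
    add_zero] at h
  exact h

open Polynomial in
theorem summable_mul_polynomial {π : ℕ → ℝ}
    (h : ∀ k, Summable fun x => π x * (newton (fun x => (x : ℝ)) k).eval (x : ℝ)) (p : ℝ[X]) :
    Summable fun x => π x * p.eval (x : ℝ) := by
  let M : Submodule ℝ ℝ[X] :=
    { carrier := {p | Summable fun x => π x * p.eval (x : ℝ)}
      add_mem' := by
        intro p q hp hq
        simpa [mul_add] using Summable.add hp hq
      zero_mem' := by simp
      smul_mem' := by
        intro c p hp
        simpa [mul_left_comm] using Summable.mul_left c hp }
  exact mem_submodule_of_degree_lt (fun j => (newton_natDegree _ j).le)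
    (fun j => by simp [newton_coeff_self]) M (n := p.natDegree + 1) (fun j _ => h j)
    (degree_le_natDegree.trans_lt (by exact_mod_cast Nat.lt_succ_self _))

/-- Up to the sign `(-1) ^ n` this is the `n`-th forward difference, which sends a polynomial of
degree at most `n` to `n !` times its coefficient of degree `n`. -/
theorem sum_alternating_shift {p : Polynomial ℝ} {n : ℕ} (hp : p.natDegree ≤ n) (x : ℝ) :
    ∑ k ∈ Finset.range (n + 1), (n.choose k : ℝ) * (-1) ^ k * p.eval (x + k) =
      (-1) ^ n * (n.factorial : ℝ) * p.coeff n := by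
  have h1 := fwdDiff_iter_eq_sum_shift (1 : ℝ) (fun x => p.eval x) n x
  have h2 : (fwdDiff (1 : ℝ))^[n] (fun x => p.eval x) x = (n.factorial : ℝ) * p.coeff n := by
    rcases hp.eq_or_lt with rfl | hlt
    · rw [Polynomial.fwdDiff_iter_degree_eq_factorial]
      simp [mul_comm]
    · rw [Polynomial.fwdDiff_iter_eq_zero_of_degree_lt hlt,
        Polynomial.coeff_eq_zero_of_natDegree_lt hlt]
      simp
  rw [mul_assoc, ← h2, h1, Finset.mul_sum]
  refine Finset.sum_congr rfl fun k hk => ?_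
  have hk' : k ≤ n := by simp at hk; omega
  obtain ⟨m, rfl⟩ := Nat.exists_eq_add_of_le hk'
  rw [Nat.add_sub_cancel_left, pow_add]
  have : ((-1 : ℝ) ^ m) ^ 2 = 1 := by rw [← pow_mul, mul_comm, pow_mul]; simp
  simp
  linear_combination (-((k + m).choose k : ℝ) * (-1) ^ k * p.eval (x + k)) * this

theorem hasSum_expSeq (p : ℝ) : HasSum (expSeq p) (Real.exp p) := by
  rw [Real.exp_eq_exp_ℝ]
  exact NormedSpace.expSeries_div_hasSum_exp p

theorem charlierMeasure_eq (p : ℝ) (x : ℕ) : charlierMeasure p x = expSeq p x / Real.exp p := by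
  rw [charlierMeasure, expSeq, Real.exp_neg]
  field_simp

theorem charlierMeasure_mul_newton (p : ℝ) (k z : ℕ) : charlierMeasure p (z + k) *
    (newton (fun x => (x : ℝ)) k).eval ((z + k : ℕ) : ℝ) = p ^ k * charlierMeasure p z := by
  have := expSeq_mul_newton p k z
  rw [charlierMeasure_eq, charlierMeasure_eq, div_mul_eq_mul_div, this, mul_div_assoc]

theorem hasSum_charlierMeasure (p : ℝ) : HasSum (charlierMeasure p) 1 := by
  have := (hasSum_expSeq p).div_const (Real.exp p)
  rw [div_self (Real.exp_pos p).ne'] at this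
  rwa [← funext (charlierMeasure_eq p)] at this

theorem summable_charlierMeasure (p : ℝ) (r : Polynomial ℝ) :
    Summable fun x : ℕ => charlierMeasure p x * r.eval (x : ℝ) := by
  refine summable_mul_polynomial (fun k => ?_) r
  refine (hasSum_of_hasSum_shift k (s := p ^ k) ?_ fun x hx => ?_).summable
  · simpa only [charlierMeasure_mul_newton, mul_one] using
      (hasSum_charlierMeasure p).mul_left (p ^ k)
  · rw [newton_eval_of_lt _ hx, mul_zero]

/-- The coefficients of the Charlier polynomials in the Newton basis. -/
def charlierCoeff (a : ℝ) (n k : ℕ) : ℝ := (n.choose k : ℝ) * (-1) ^ k * (a ^ k)⁻¹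

theorem charlierPoly_eq (a : ℝ) (n x : ℕ) :
    charlierPoly a n x =
      (newtonSum (fun x => (x : ℝ)) (charlierCoeff a n) n).eval (x : ℝ) := by
  rw [charlierPoly, hyper, tsum_eq_sum_of_lt (n := n), newtonSum_eval]
  · refine Finset.sum_congr rfl fun k _ => ?_
    simp only [List.map_cons, List.map_nil, List.prod_cons, List.prod_nil, mul_one]
    have h8 : ((-1 : ℝ) ^ k) ^ 2 = 1 := by rw [← pow_mul, mul_comm, pow_mul]; simp
    rw [poch_neg_natCast n k, poch_neg_eq_newton, charlierCoeff, neg_pow a⁻¹, inv_pow]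
    field_simp
    linear_combination ((n.choose k : ℝ) * (a⁻¹) ^ k *
      (newton (fun x => (x : ℝ)) k).eval (x : ℝ)) * h8
  · intro k hk
    simp [poch_neg_natCast_of_lt hk]

/-- Multiplying the Poisson weight by the `k`-th falling factorial shifts it, so the `k`-th term
becomes the mean of `p (z + k)` times `a ^ k`, which the coefficient cancels. The pairing is then
the mean of the `n`-th difference of `p`, a constant. -/
theorem isOrthogonalPolys_charlier {a : ℝ} (ha : 0 < a) :
    IsOrthogonalPolys (charlierMeasure a) (fun x => (x : ℝ)) id
      (fun n => newtonSum (fun x => (x : ℝ)) (charlierCoeff a n) n) (charlierNormSq a) := by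
  refine ⟨fun n => newtonSum_natDegree_le _ _ _, fun n => ?_, fun n => ?_, fun n p hp => ?_⟩
  · simp [newtonSum_coeff, charlierCoeff, ha.ne']
  · unfold charlierNormSq
    positivity
  · simp only [id_eq] at hp
    have h1 : ∀ k : ℕ, Summable fun z : ℕ => charlierMeasure a z * p.eval (z + k : ℝ) := fun k => by
      have := summable_charlierMeasure a (p.comp (Polynomial.X + Polynomial.C (k : ℝ)))
      simp only [Polynomial.eval_comp, Polynomial.eval_add, Polynomial.eval_X,
        Polynomial.eval_C] at this
      exact this
    have h2 : ∀ k : ℕ, HasSum (fun x : ℕ => charlierMeasure a x *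
        (newton (fun x => (x : ℝ)) k).eval (x : ℝ) * p.eval (x : ℝ))
        (a ^ k * ∑' z : ℕ, charlierMeasure a z * p.eval (z + k : ℝ)) := fun k => by
      refine hasSum_of_hasSum_shift k ?_ fun x hx => ?_
      · simp only [charlierMeasure_mul_newton]
        convert! (h1 k).hasSum.mul_left (a ^ k) using 2 with z
        rw [Nat.cast_add, mul_assoc]
      · rw [newton_eval_of_lt _ hx, mul_zero, zero_mul]
    have h3 := hasSum_sum (s := Finset.range (n + 1)) fun k _ =>
      (h2 k).mul_left (charlierCoeff a n k)
    have h4 := hasSum_sum (s := Finset.range (n + 1)) fun k _ =>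
      (h1 k).hasSum.mul_left ((n.choose k : ℝ) * (-1) ^ k)
    have h5 : HasSum (fun z : ℕ => ∑ k ∈ Finset.range (n + 1), (n.choose k : ℝ) * (-1) ^ k *
        (charlierMeasure a z * p.eval (z + k : ℝ))) ((-1) ^ n * (n.factorial : ℝ) * p.coeff n) := by
      have := (hasSum_charlierMeasure a).mul_right ((-1) ^ n * (n.factorial : ℝ) * p.coeff n)
      rw [one_mul] at this
      convert! this using 2 with z
      rw [← sum_alternating_shift hp z, Finset.mul_sum]
      exact Finset.sum_congr rfl fun k _ => by ring
    have h6 : ∑ k ∈ Finset.range (n + 1), charlierCoeff a n k *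
        (a ^ k * ∑' z : ℕ, charlierMeasure a z * p.eval (z + k : ℝ)) =
        (-1) ^ n * (n.factorial : ℝ) * p.coeff n := by
      rw [h5.unique h4]
      refine Finset.sum_congr rfl fun k _ => ?_
      rw [charlierCoeff]
      field_simp
    rw [h6] at h3
    convert! h3 using 1
    · ext x
      rw [newtonSum_eval, Finset.mul_sum, Finset.sum_mul]
      exact Finset.sum_congr rfl fun k _ => by ring
    · rw [id_eq, newtonSum_coeff, charlierCoeff, charlierNormSq, Nat.choose_self]
      have h8 : ((-1 : ℝ) ^ n) ^ 2 = 1 := by rw [← pow_mul, mul_comm, pow_mul]; simp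
      field_simp
      rw [h8]
      simp

/-- The negative binomial series; its generalised binomial coefficient is the shifted factorial of
`a` over `n !`. -/
theorem hasSum_hahnSeq (a : ℝ) {c : ℝ} (hc : 0 < c) (hc1 : c < 1) :
    HasSum (hahnSeq c a) ((1 - c) ^ (-a)) := by
  have h1 := (Real.one_div_one_sub_rpow_hasFPowerSeriesOnBall_zero a).hasSum (y := c) (by
    simpa [Real.enorm_eq_ofReal hc.le] using hc1)
  rw [zero_add, one_div, ← Real.rpow_neg (by linarith)] at h1
  convert! h1 using 2 with n
  simp only [FormalMultilinearSeries.ofScalars_apply_eq, smul_eq_mul]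
  have h2 := Ring.factorial_nsmul_multichoose_eq_ascPochhammer a n
  rw [Polynomial.ascPochhammer_smeval_eq_eval, nsmul_eq_mul] at h2
  rw [Ring.choose, show a + n - 1 - n + 1 = a by ring, hahnSeq, poch, ← h2]
  field_simp

theorem meixnerMeasure_eq (a : ℝ) {c : ℝ} (hc1 : c < 1) (x : ℕ) :
    meixnerMeasure a c x = hahnSeq c a x / (1 - c) ^ (-a) := by
  rw [meixnerMeasure, hahnSeq, Real.rpow_neg (by linarith)]
  field_simp

theorem hasSum_hahnSeq_mul_newton (a : ℝ) {c : ℝ} (hc : 0 < c) (hc1 : c < 1) (k : ℕ) :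
    HasSum (fun x : ℕ => hahnSeq c a x * (newton (fun x => (x : ℝ)) k).eval (x : ℝ))
      (c ^ k * poch a k * (1 - c) ^ (-(a + k))) := by
  refine hasSum_of_hasSum_shift k ?_ fun x hx => ?_
  · simpa only [hahnSeq_mul_newton] using (hasSum_hahnSeq (a + k) hc hc1).mul_left (c ^ k * poch a k)
  · rw [newton_eval_of_lt _ hx, mul_zero]

theorem summable_meixnerMeasure (a : ℝ) {c : ℝ} (hc : 0 < c) (hc1 : c < 1) (r : Polynomial ℝ) :
    Summable fun x : ℕ => meixnerMeasure a c x * r.eval (x : ℝ) := by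
  refine summable_mul_polynomial (fun k => ?_) r
  have := ((hasSum_hahnSeq_mul_newton a hc hc1 k).div_const ((1 - c) ^ (-a))).summable
  simpa only [meixnerMeasure_eq a hc1, div_mul_eq_mul_div] using this

/-- The coefficients of the Meixner polynomials in the Newton basis. -/
def meixnerCoeff (a c : ℝ) (n k : ℕ) : ℝ := (n.choose k : ℝ) * (1 - c⁻¹) ^ k / poch a k

theorem meixnerPoly_eq (a c : ℝ) (n x : ℕ) :
    meixnerPoly a c n x =
      (newtonSum (fun x => (x : ℝ)) (meixnerCoeff a c n) n).eval (x : ℝ) := by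
  rw [meixnerPoly, hyper, tsum_eq_sum_of_lt (n := n), newtonSum_eval]
  · refine Finset.sum_congr rfl fun k _ => ?_
    simp only [List.map_cons, List.map_nil, List.prod_cons, List.prod_nil, mul_one]
    have h8 : ((-1 : ℝ) ^ k) ^ 2 = 1 := by rw [← pow_mul, mul_comm, pow_mul]; simp
    rw [poch_neg_natCast n k, poch_neg_eq_newton, meixnerCoeff]
    have h9 : (k.factorial : ℝ) ≠ 0 := by positivity
    generalize 1 - c⁻¹ = s
    generalize (newton (fun x => (x : ℝ)) k).eval (x : ℝ) = e
    field_simp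
    rw [h8]
    ring
  · intro k hk
    simp [poch_neg_natCast_of_lt hk]

theorem isOrthogonalPolys_meixner {a c : ℝ} (ha : 0 < a) (hc : 0 < c) (hc1 : c < 1) :
    IsOrthogonalPolys (meixnerMeasure a c) (fun x => (x : ℝ)) id
      (fun n => newtonSum (fun x => (x : ℝ)) (meixnerCoeff a c n) n) (meixnerNormSq a c) := by
  have h1c : 0 < 1 - c := by linarith
  have hcc : 1 - c⁻¹ = -((1 - c) * c⁻¹) := by
    field_simp
    ring
  -- The test of degree `j` is the shifted factorial of `a + x`, which turns the weight with
  -- parameter `a` into the one with `a + j`. The Chu–Vandermonde numerator then has base `-j` and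
  -- vanishes for `j < n`.
  refine .of_tests (T := fun _ j => newton (fun i => -a - i) j)
    (fun n => newtonSum_natDegree_le _ _ _) (fun n => ?_) (fun n => ?_)
    (fun n j => (newton_natDegree _ j).le) (fun n j => by simp [newton_coeff_self])
    fun n j hj => ?_
  · rw [id_eq, newtonSum_coeff, meixnerCoeff, hcc, Nat.choose_self, Nat.cast_one, one_mul]
    exact div_ne_zero (pow_ne_zero _ (neg_ne_zero.mpr (by positivity))) (poch_pos n ha).ne'
  · have := poch_pos n ha
    unfold meixnerNormSq
    positivity
  · simp only [id_eq] at hj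
    simp only [newtonSum_coeff, newton_coeff_self, id_eq]
    have haj : 0 < a + j := by positivity
    have hT : ∀ x : ℕ, meixnerMeasure a c x * (newton (fun i => -a - (i : ℝ)) j).eval (x : ℝ) =
        poch a j * hahnSeq c (a + j) x / (1 - c) ^ (-a) := fun x => by
      rw [← hahnSeq_mul_poch, meixnerMeasure_eq a hc1, newton_eval, poch_eq_prod,
        div_mul_eq_mul_div]
      congr 2
      exact Finset.prod_congr rfl fun i _ => by ring
    have h2 := hasSum_sum (s := Finset.range (n + 1)) fun k _ =>
      (hasSum_hahnSeq_mul_newton (a + j) hc hc1 k).mul_left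
        (meixnerCoeff a c n k * (poch a j / (1 - c) ^ (-a)))
    have h3 := chuVandermonde_div (a + j) (poch_pos n ha).ne'
    have hr : ∀ k : ℕ, (1 - c) ^ (-(a + j + k)) = (1 - c) ^ (-a) / ((1 - c) ^ j * (1 - c) ^ k) :=
      fun k => by
        rw [← Real.rpow_natCast, ← Real.rpow_natCast, ← Real.rpow_add h1c, ← Real.rpow_sub h1c]
        congr 1
        ring
    have hz := (Real.rpow_pos_of_pos h1c (-a)).ne'
    have h4 : ∑ k ∈ Finset.range (n + 1), meixnerCoeff a c n k *
        (poch a j / (1 - c) ^ (-a)) * (c ^ k * poch (a + j) k * (1 - c) ^ (-(a + j + k))) =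
        poch a j / (1 - c) ^ j * (poch (a - (a + j)) n / poch a n) := by
      rw [← h3, Finset.mul_sum]
      refine Finset.sum_congr rfl fun k hk => ?_
      rw [meixnerCoeff, hr, hcc, neg_pow, mul_pow, inv_pow]
      field_simp
    rw [h4, show a - (a + j) = -(j : ℝ) by ring] at h2
    convert! h2 using 1
    · ext x
      rw [mul_right_comm, hT, newtonSum_eval, Finset.mul_sum]
      exact Finset.sum_congr rfl fun k _ => by ring
    · split_ifs with hjn
      · subst hjn
        have p1 := (poch_pos j ha).ne'
        rw [meixnerCoeff, meixnerNormSq, hcc, neg_pow, mul_pow, inv_pow, poch_neg_natCast,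
          Nat.choose_self]
        have h8 : ((-1 : ℝ) ^ j) ^ 2 = 1 := by rw [← pow_mul, mul_comm, pow_mul]; simp
        field_simp
        rw [h8]
        simp
      · rw [poch_neg_natCast_of_lt (by omega)]
        simp

/-! ### Exactly solvable convolutions -/

section Finite

variable {N : ℕ} {K K' : ℕ → ℕ → ℝ} {π π' κ l dsq : ℕ → ℝ} {P w : ℕ → ℕ → ℝ} {u : ℕ → ℝ}

/-- The stated kernel and measure agree with their `splitMeasure` forms only on `{0, …, N}`;
restriction to `Fin (N + 1)` is what allows the replacement. -/
theorem solvableFinite_of_eigen (hK : ∀ x ≤ N, ∀ y ≤ N, K x y = K' x y)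
    (hπ : ∀ x ≤ N, π x = π' x) (hpos : ∀ x ≤ N, ∀ y ≤ N, 0 < K' x y)
    (hrev : IsReversibleChain (V := Fin (N + 1)) (fun x y => K' x y) (fun x => π' x))
    (hQ : IsOrthogonalPolys (V := Fin (N + 1)) (fun x => π x) (fun x => u x) (fun n => n)
      (fun n => newtonSum u (w n) n) (fun n => dsq n))
    (heig : ∀ n y : Fin (N + 1), HasSum
      (fun x : Fin (N + 1) => K' x y * (newtonSum u (w n) n).eval (u x))
      (κ n * (newtonSum u (w n) n).eval (u y)))
    (hP : ∀ n x, P n x = (newtonSum u (w n) n).eval (u x)) (hw : ∀ n, w n 0 = 1) :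
    SolvableFinite N K π κ P dsq := by
  have hK' : (fun x y : Fin (N + 1) => K x y) = fun x y : Fin (N + 1) => K' x y :=
    funext fun x => funext fun y => hK x x.is_le y y.is_le
  have hπ' : (fun x : Fin (N + 1) => π x) = fun x : Fin (N + 1) => π' x :=
    funext fun x => hπ x x.is_le
  rw [SolvableFinite, hK']
  rw [hπ'] at hQ ⊢
  refine solvableChain_of_hasEigenbasis (fun x y => hpos x x.is_le y y.is_le) hrev
    (hasEigenbasis_of_fintype hQ Fin.val_injective hrev.pos (fun n x => hP n x) heig)
    (fun x => ?_) fun n => ?_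
  · simp [hP, newtonSum_eval, hw, newton]
  · rw [Fin.val_zero, hP, newtonSum_eval_zero, hw]

theorem solvableFinite_of_isTriangular (hK : ∀ x ≤ N, ∀ y ≤ N, K x y = K' x y)
    (hπ : ∀ x ≤ N, π x = π' x) (hpos : ∀ x ≤ N, ∀ y ≤ N, 0 < K' x y)
    (hrev : IsReversibleChain (V := Fin (N + 1)) (fun x y => K' x y) (fun x => π' x))
    (hl : IsTriangular (V := Fin (N + 1)) (fun x y => K' x y) (fun x => u x) l)
    (hκ : ∀ n, l n = κ n)
    (hQ : IsOrthogonalPolys (V := Fin (N + 1)) (fun x => π x) (fun x => u x) (fun n => n)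
      (fun n => newtonSum u (w n) n) (fun n => dsq n))
    (hP : ∀ n x, P n x = (newtonSum u (w n) n).eval (u x)) (hw : ∀ n, w n 0 = 1) :
    SolvableFinite N K π κ P dsq := by
  refine solvableFinite_of_eigen hK hπ hpos hrev hQ (fun n y => ?_) hP hw
  have hπ' : (fun x : Fin (N + 1) => π x) = fun x : Fin (N + 1) => π' x :=
    funext fun x => hπ x x.is_le
  rw [hπ'] at hQ
  have := hl.eigen hrev (fun p => Summable.of_finite) hQ n y
  rwa [hκ] at this

/-- The eigenvalues are determined by the action on the eigenvectors at `0`. -/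
theorem solvableFinite_of_isTriangular_zero (hK : ∀ x ≤ N, ∀ y ≤ N, K x y = K' x y)
    (hπ : ∀ x ≤ N, π x = π' x) (hpos : ∀ x ≤ N, ∀ y ≤ N, 0 < K' x y)
    (hrev : IsReversibleChain (V := Fin (N + 1)) (fun x y => K' x y) (fun x => π' x))
    (hl : IsTriangular (V := Fin (N + 1)) (fun x y => K' x y) (fun x => u x) l)
    (hκ : ∀ n ≤ N,
      ∑ x ∈ Finset.range (N + 1), K' x 0 * (newtonSum u (w n) n).eval (u x) = κ n)
    (hQ : IsOrthogonalPolys (V := Fin (N + 1)) (fun x => π x) (fun x => u x) (fun n => n)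
      (fun n => newtonSum u (w n) n) (fun n => dsq n))
    (hP : ∀ n x, P n x = (newtonSum u (w n) n).eval (u x)) (hw : ∀ n, w n 0 = 1) :
    SolvableFinite N K π κ P dsq := by
  refine solvableFinite_of_eigen hK hπ hpos hrev hQ (fun n y => ?_) hP hw
  have hπ' : (fun x : Fin (N + 1) => π x) = fun x : Fin (N + 1) => π' x :=
    funext fun x => hπ x x.is_le
  rw [hπ'] at hQ
  have h1 := hl.eigen hrev (fun p => Summable.of_finite) hQ n
  have h2 := (h1 0).unique
    (hasSum_fin (f := fun x => K' x 0 * (newtonSum u (w n) n).eval (u x)) (hκ n n.is_le))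
  rw [Fin.val_zero, newtonSum_eval_zero, hw, mul_one] at h2
  rw [← h2]
  exact h1 y

variable {α β γ c c' u' : ℕ → ℝ} {μ ν : ℕ → ℕ → ℝ}

theorem solvableFinite_convI (hα : ∀ n, 0 < α n) (hβ : ∀ n, 0 < β n) (hγ : ∀ n, 0 < γ n)
    (h : IsThinning u α β c) (h' : IsThinning u' γ β c') (hu : ∀ v ≤ N, u' v = u (N - v))
    (hμ : ∀ M x, x ≤ M → μ M x = splitMeasure β γ M x)
    (hν : ∀ M x, x ≤ M → ν M x = splitMeasure α β M x)
    (hπ : ∀ x ≤ N, π x = splitMeasure (cauchyProd α β) γ N x) (hκ : ∀ n, c n * c' n = κ n)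
    (hQ : IsOrthogonalPolys (V := Fin (N + 1)) (fun x => π x) (fun x => u x) (fun n => n)
      (fun n => newtonSum u (w n) n) (fun n => dsq n))
    (hP : ∀ n x, P n x = (newtonSum u (w n) n).eval (u x)) (hw : ∀ n, w n 0 = 1) :
    SolvableFinite N (convI μ ν N) π κ P dsq :=
  solvableFinite_of_isTriangular (fun _ hx _ _ => convI_congr hμ hν hx) hπ
    (fun x _ y _ => convI_pos hα hβ hγ N x y) (isReversibleChain_convI hα hβ hγ N)
    (isTriangular_convI hα hβ hγ h h' hu) hκ hQ hP hw

theorem solvableFinite_convIII (hα : ∀ n, 0 < α n) (hβ : ∀ n, 0 < β n) (hγ : ∀ n, 0 < γ n)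
    (h : IsThinning u α β c) (h' : IsThinning u' γ β c') (hu : ∀ v ≤ N, u' v = u (N - v))
    (hμ : ∀ M x, x ≤ M → μ M x = splitMeasure α β M x)
    (hν : ∀ M x, x ≤ M → ν M x = splitMeasure β γ M x)
    (hπ : ∀ x ≤ N, π x = splitMeasure α (cauchyProd β γ) N x) (hκ : ∀ n, c n * c' n = κ n)
    (hQ : IsOrthogonalPolys (V := Fin (N + 1)) (fun x => π x) (fun x => u x) (fun n => n)
      (fun n => newtonSum u (w n) n) (fun n => dsq n))
    (hP : ∀ n x, P n x = (newtonSum u (w n) n).eval (u x)) (hw : ∀ n, w n 0 = 1) :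
    SolvableFinite N (convIII μ ν N) π κ P dsq :=
  solvableFinite_of_isTriangular (fun _ _ _ _ => convIII_congr hμ hν) hπ
    (fun _ hx _ hy => convIII_pos hα hβ hγ hx hy) (isReversibleChain_convIII hα hβ hγ N)
    (isTriangular_convIII hα hβ hγ h h' hu) hκ hQ hP hw

theorem convII_zero_right (α β γ : ℕ → ℝ) (hα : ∀ n, 0 < α n) (hβ : ∀ n, 0 < β n) {x : ℕ}
    (hx : x ≤ N) : convII (splitMeasure β γ) (splitMeasure α β) N x 0 = splitMeasure β γ N x := by
  have h1 : splitMeasure α β 0 0 = 1 := by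
    simpa using sum_splitMeasure hα hβ 0
  simp [convII, Nat.sub_eq_zero_of_le hx, h1]

/-- From `y = 0` a step is a single draw from the second measure, so the eigenvalue is the mean of
`P n` under it. In the Newton basis this mean is computed by the thinning constants `c'`. -/
theorem solvableFinite_convII (hα : ∀ n, 0 < α n) (hβ : ∀ n, 0 < β n) (hγ : ∀ n, 0 < γ n)
    (h : IsThinning (fun x => (x : ℝ)) α β c) (h' : IsThinning (fun x => (x : ℝ)) β γ c')
    (hμ : ∀ M x, x ≤ M → μ M x = splitMeasure β γ M x)
    (hν : ∀ M x, x ≤ M → ν M x = splitMeasure α β M x)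
    (hπ : ∀ x ≤ N, π x = splitMeasure (cauchyProd α β) (cauchyProd β γ) N x)
    (hκ : ∀ n ≤ N, ∑ k ∈ Finset.range (n + 1),
      w n k * (c' k * (newton (fun x => (x : ℝ)) k).eval (N : ℝ)) = κ n)
    (hQ : IsOrthogonalPolys (V := Fin (N + 1)) (fun x => π x) (fun x => (x : ℕ)) (fun n => n)
      (fun n => newtonSum (fun x => (x : ℝ)) (w n) n) (fun n => dsq n))
    (hP : ∀ n x, P n x = (newtonSum (fun x => (x : ℝ)) (w n) n).eval (x : ℝ))
    (hw : ∀ n, w n 0 = 1) :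
    SolvableFinite N (convII μ ν N) π κ P dsq := by
  obtain ⟨l, hl⟩ := exists_isTriangular_convII (N := N) hα hβ hγ h h'
  refine solvableFinite_of_isTriangular_zero (fun _ _ _ hy => convII_congr hμ hν hy) hπ
    (fun _ hx _ hy => convII_pos hα hβ hγ hx hy) (isReversibleChain_convII hα hβ hγ N)
    hl (fun n hn => ?_) hQ hP hw
  rw [← hκ n hn]
  simp only [← h'.sum_splitMeasure hβ hγ, Finset.mul_sum]
  rw [Finset.sum_comm]
  refine Finset.sum_congr rfl fun x hx => ?_
  rw [convII_zero_right α β γ hα hβ (by simp at hx; omega), newtonSum_eval, Finset.mul_sum]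
  exact Finset.sum_congr rfl fun k _ => by ring

end Finite

theorem solvableInfinite_convInf {α β c μ π κ dsq : ℕ → ℝ} {P w ν : ℕ → ℕ → ℝ} {s t r : ℝ}
    (hα : ∀ n, 0 < α n) (hβ : ∀ n, 0 < β n) (hs : 0 < s) (ht : 0 < t)
    (h : IsThinning (fun x => (x : ℝ)) α β c) (hμ : ∀ x, μ x = β x / s)
    (hν : ∀ M x, x ≤ M → ν M x = splitMeasure α β M x) (hπ : ∀ x, π x = cauchyProd α β x / t)
    (hμ1 : HasSum β s) (hπ1 : HasSum (cauchyProd α β) t)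
    (hm : ∀ k : ℕ, Summable fun x => μ x * (x : ℝ) ^ k)
    (hsq : ∀ p : Polynomial ℝ, Summable fun x => π x * p.eval (x : ℝ) ^ 2)
    (hκ : ∀ n, c n = κ n)
    (hQ : IsOrthogonalPolys π (fun x => (x : ℝ)) id
      (fun n => newtonSum (fun x => (x : ℝ)) (w n) n) dsq)
    (hP : ∀ n x, P n x = (newtonSum (fun x => (x : ℝ)) (w n) n).eval (x : ℝ))
    (hw : ∀ n, w n 0 = 1) (hsymm : ∀ n x, P n x = P x n) (hdual : ∀ n, dsq n = r * π n) :
    SolvableInfinite (convInf μ ν) π κ P dsq := by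
  have hK : convInf μ ν = convInf (fun w => β w / s) (splitMeasure α β) :=
    funext fun x => funext fun y => by rw [convInf_congr hν, funext hμ]
  have hrev := isReversibleChain_convInf hα hβ hs ht hμ1 hπ1
  rw [← hK, ← funext hπ] at hrev
  have hl := isTriangular_convInf (μ := μ) hα hβ h
    (by
      have := hμ1.div_const s
      rw [div_self hs.ne'] at this
      rwa [← funext hμ] at this) hm
  rw [funext hμ, ← hK] at hl
  refine solvableChain_of_hasEigenbasis (fun x y => ?_) hrev
    (hasEigenbasis_of_selfDual hQ hrev.pos hP hsymm hdual fun n y => ?_) (fun x => ?_) fun n => ?_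
  · rw [hK]
    exact convInf_pos hα hβ hs x y
  · have := hl.eigen hrev hsq hQ n y
    rwa [id_eq, hκ] at this
  · simp [hP, newtonSum_eval, hw, newton]
  · have := newtonSum_eval_zero (fun x => (x : ℝ)) (w n) n
    rw [hP, this, hw]

/-! ### The Krawtchouk chains -/

section Krawtchouk

variable {a b p : ℝ}

theorem krawtchoukCoeff_zero (a : ℝ) (N n : ℕ) : krawtchoukCoeff a N n 0 = 1 := by
  simp [krawtchoukCoeff, newton]

theorem sum_choose_neg_one_pow (n : ℕ) (x : ℝ) :
    ∑ k ∈ Finset.range (n + 1), (n.choose k : ℝ) * (-1) ^ k * x ^ k = (1 - x) ^ n := by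
  rw [show 1 - x = -x + 1 by ring, add_pow]
  refine Finset.sum_congr rfl fun k _ => ?_
  rw [neg_pow x, one_pow]
  ring

/-- The three weights are `a * b`, `b * (1 - a)` and `(1 - a) * (1 - b)`: the first two are in the
ratio of `a` to `1 - a`, the last two in that of `b` to `1 - b`. The measure groups the first two,
with total `b`, against the third. -/
theorem solvableFinite_krawtchouk_convI (N : ℕ) (ha : 0 < a) (ha1 : a < 1) (hb : 0 < b)
    (hb1 : b < 1) (hp : p = b / (1 - a + a * b)) :
    SolvableFinite N (convI (krawtchoukMeasure b) (krawtchoukMeasure a) N)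
      (krawtchoukMeasure p N) (fun n => a ^ n * (1 - b) ^ n) (krawtchoukPoly p N)
      (krawtchoukNormSq p N) := by
  have ha' : 0 < 1 - a := by linarith
  have hb' : 0 < 1 - b := by linarith
  have hA : 0 < a * b := by positivity
  have hB : 0 < b * (1 - a) := by positivity
  have hC : 0 < (1 - a) * (1 - b) := by positivity
  have hD : 0 < 1 - a + a * b := by linarith
  have hp0 : 0 < p := by rw [hp]; positivity
  have hp1 : p < 1 := by rw [hp, div_lt_one hD]; nlinarith
  have e1 : a * b + b * (1 - a) = b := by ring
  have e2 : b * (1 - a) + (1 - a) * (1 - b) = 1 - a := by ring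
  have h' := (isThinning_expSeq hC hB).affine N (-1)
  refine solvableFinite_convI (expSeq_pos hA) (expSeq_pos hB) (expSeq_pos hC)
    (isThinning_expSeq hA hB) h' (fun v hv => ?_)
    (fun M x hx => krawtchoukMeasure_eq hB hC ?_ hx)
    (fun M x hx => krawtchoukMeasure_eq hA hB ?_ hx) (fun x hx => ?_) (fun n => ?_)
    (isOrthogonalPolys_krawtchouk hp0 hp1 N) (krawtchoukPoly_eq p N) (krawtchoukCoeff_zero p N)
  · rw [Nat.cast_sub hv]
    ring
  · rw [e2]
    field_simp
  · rw [e1]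
    field_simp
  · rw [cauchyProd_expSeq _ _, e1]
    refine krawtchoukMeasure_eq hb hC ?_ hx
    rw [hp]
    ring
  · rw [e1, add_comm ((1 - a) * (1 - b)), e2]
    congr 2 <;> field_simp

theorem solvableFinite_krawtchouk_convII (N : ℕ) (ha : 0 < a) (ha1 : a < 1) (hb : 0 < b)
    (hb1 : b < 1) (hp : p = b / (1 - a + b)) :
    SolvableFinite N (convII (krawtchoukMeasure b) (krawtchoukMeasure a) N)
      (krawtchoukMeasure p N) (fun n => (a - b) ^ n) (krawtchoukPoly p N)
      (krawtchoukNormSq p N) := by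
  have ha' : 0 < 1 - a := by linarith
  have hb' : 0 < 1 - b := by linarith
  have hA : 0 < a * b := by positivity
  have hB : 0 < b * (1 - a) := by positivity
  have hC : 0 < (1 - a) * (1 - b) := by positivity
  have hD : 0 < 1 - a + b := by linarith
  have hp0 : 0 < p := by rw [hp]; positivity
  have hp1 : p < 1 := by rw [hp, div_lt_one hD]; linarith
  have e1 : a * b + b * (1 - a) = b := by ring
  have e2 : b * (1 - a) + (1 - a) * (1 - b) = 1 - a := by ring
  refine solvableFinite_convII (expSeq_pos hA) (expSeq_pos hB) (expSeq_pos hC)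
    (isThinning_expSeq hA hB) (isThinning_expSeq hB hC)
    (fun M x hx => krawtchoukMeasure_eq hB hC ?_ hx)
    (fun M x hx => krawtchoukMeasure_eq hA hB ?_ hx) (fun x hx => ?_) (fun n hn => ?_)
    (isOrthogonalPolys_krawtchouk hp0 hp1 N) (krawtchoukPoly_eq p N) (krawtchoukCoeff_zero p N)
  · rw [e2]
    field_simp
  · rw [e1]
    field_simp
  · rw [cauchyProd_expSeq _ _, cauchyProd_expSeq _ _, e1, e2]
    refine krawtchoukMeasure_eq hb ha' ?_ hx
    rw [hp]
    ring
  -- The `k`-th factorial moment contributes `b ^ k` and the polynomial `(p⁻¹) ^ k`, so the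
  -- eigenvalue is a binomial expansion of `1 - p⁻¹ * b`.
  · have h1 : a - b = 1 - p⁻¹ * b := by
      rw [hp]
      field_simp
      ring
    rw [h1, ← sum_choose_neg_one_pow]
    refine Finset.sum_congr rfl fun k hk => ?_
    have h2 := (newton_id_pos (show k ≤ N by simp at hk; omega)).ne'
    have h3 : b * (1 - a) / (b * (1 - a) + (1 - a) * (1 - b)) = b := by
      rw [e2]
      field_simp
    rw [h3, krawtchoukCoeff, mul_pow]
    field_simp

/-- Now the ratio of the first two weights belongs to `b` and that of the last two to `a`, so the
middle weight is `a * (1 - b)`. The measure sets the first, `a * b`, against the others, with total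
`1 - b`. -/
theorem solvableFinite_krawtchouk_convIII (N : ℕ) (ha : 0 < a) (ha1 : a < 1) (hb : 0 < b)
    (hb1 : b < 1) (hp : p = a * b / (1 - b + a * b)) :
    SolvableFinite N (convIII (krawtchoukMeasure b) (krawtchoukMeasure a) N)
      (krawtchoukMeasure p N) (fun n => (1 - a) ^ n * b ^ n) (krawtchoukPoly p N)
      (krawtchoukNormSq p N) := by
  have ha' : 0 < 1 - a := by linarith
  have hb' : 0 < 1 - b := by linarith
  have hA : 0 < a * b := by positivity
  have hB : 0 < a * (1 - b) := by positivity
  have hC : 0 < (1 - a) * (1 - b) := by positivity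
  have hD : 0 < 1 - b + a * b := by linarith
  have hp0 : 0 < p := by rw [hp]; positivity
  have hp1 : p < 1 := by rw [hp, div_lt_one hD]; linarith
  have e1 : a * b + a * (1 - b) = a := by ring
  have e2 : a * (1 - b) + (1 - a) * (1 - b) = 1 - b := by ring
  have h' := (isThinning_expSeq hC hB).affine N (-1)
  refine solvableFinite_convIII (expSeq_pos hA) (expSeq_pos hB) (expSeq_pos hC)
    (isThinning_expSeq hA hB) h' (fun v hv => ?_)
    (fun M x hx => krawtchoukMeasure_eq hA hB ?_ hx)
    (fun M x hx => krawtchoukMeasure_eq hB hC ?_ hx) (fun x hx => ?_) (fun n => ?_)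
    (isOrthogonalPolys_krawtchouk hp0 hp1 N) (krawtchoukPoly_eq p N) (krawtchoukCoeff_zero p N)
  · rw [Nat.cast_sub hv]
    ring
  · rw [e1]
    field_simp
  · rw [e2]
    field_simp
  · rw [cauchyProd_expSeq _ _, e2]
    refine krawtchoukMeasure_eq hA hb' ?_ hx
    rw [hp]
    ring
  · rw [e1, add_comm ((1 - a) * (1 - b)), e2, mul_comm]
    congr 2 <;> field_simp

theorem krawtchoukPoly_last (p : ℝ) {N n : ℕ} (hn : n ≤ N) :
    krawtchoukPoly p N n N = (-1) ^ n * (p⁻¹ - 1) ^ n := by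
  rw [krawtchoukPoly_eq, newtonSum_eval, ← mul_pow, show -1 * (p⁻¹ - 1) = 1 - p⁻¹ by ring,
    ← sum_choose_neg_one_pow]
  refine Finset.sum_congr rfl fun k hk => ?_
  have h2 := (newton_id_pos (show k ≤ N by simp at hk; omega)).ne'
  rw [krawtchoukCoeff]
  field_simp

theorem krawtchouk_amplitude (N : ℕ) (ha : 0 < a) (ha1 : a < 1) (hb : 0 < b)
    (hb1 : b < 1) (hp : p = a * b / (1 - b + a * b))
    (H : L2 (Fin (N + 1)) →L[ℂ] L2 (Fin (N + 1)))
    (hH : IsHamiltonian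
      (fun x y : Fin (N + 1) => convIII (krawtchoukMeasure b) (krawtchoukMeasure a) N x y)
      (fun x : Fin (N + 1) => krawtchoukMeasure p N x) H) (ℓ : ℕ) :
    amplitude H (Fin.last N) 0 ℓ =
      (((a * b * (1 - b)) ^ ((N : ℝ) / 2) / (1 - b + a * b) ^ N : ℝ) : ℂ) *
        ∑ n ∈ Finset.range (N + 1),
          (-1) ^ n * phase ((1 - a) ^ n * b ^ n) ℓ * (N.choose n : ℂ) := by
  have hb' : 0 < 1 - b := by linarith
  have hD : 0 < 1 - b + a * b := by positivity
  have hp0 : 0 < p := by rw [hp]; positivity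
  have hp' : 1 - p = (1 - b) / (1 - b + a * b) := by
    rw [hp]
    field_simp
    ring
  have hp1 : 0 < 1 - p := by rw [hp']; positivity
  have h1 := ((solvableFinite_krawtchouk_convIII N ha ha1 hb hb1 hp).amplitude_from_zero H hH
    (Fin.last N) ℓ).2
  rw [h1, tsum_fintype, Finset.sum_range]
  congr 1
  · congr 1
    have h2 : krawtchoukMeasure p N (Fin.last N : Fin (N + 1)) *
        krawtchoukMeasure p N ((0 : Fin (N + 1)) : ℕ) =
          (a * b * (1 - b)) ^ N / ((1 - b + a * b) ^ N) ^ 2 := by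
      rw [← pow_mul, mul_comm N 2, pow_mul, ← div_pow]
      simp only [krawtchoukMeasure, Fin.val_last, Fin.val_zero]
      simp only [Nat.choose_self, Nat.sub_self, pow_zero, Nat.choose_zero_right, Nat.sub_zero,
        Nat.cast_one, one_mul, mul_one]
      rw [← mul_pow, hp', hp]
      congr 1
      field_simp
    rw [h2, Real.sqrt_div (by positivity), Real.sqrt_sq (by positivity), Real.sqrt_eq_rpow,
      ← Real.rpow_natCast, ← Real.rpow_mul (by positivity)]
    congr 2
    ring
  · refine Finset.sum_congr rfl fun n _ => ?_
    -- At the far end the powers in the norming constant and in the polynomial are reciprocal,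
    -- leaving a signed binomial coefficient.
    have h3 : Real.sqrt (krawtchoukNormSq p N n) ^ 2 * krawtchoukPoly p N n N =
        (-1) ^ (n : ℕ) * (N.choose n : ℝ) := by
      rw [Real.sq_sqrt (by unfold krawtchoukNormSq; positivity), krawtchoukPoly_last p n.is_le,
        krawtchoukNormSq]
      have h4 : p / (1 - p) * (p⁻¹ - 1) = 1 := by
        field_simp
      have h5 : (p / (1 - p)) ^ (n : ℕ) * (p⁻¹ - 1) ^ (n : ℕ) = 1 := by
        rw [← mul_pow, h4, one_pow]
      linear_combination ((N.choose n : ℝ) * (-1) ^ (n : ℕ)) * h5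
    rw [Fin.val_last, h3]
    push_cast
    ring

end Krawtchouk

/-! ### The Hahn chains -/

section Hahn

variable {a b c : ℝ}

theorem hahnCoeff_zero (a b : ℝ) (N n : ℕ) : hahnCoeff a b N n 0 = 1 := by
  simp [hahnCoeff, newton]

theorem solvableFinite_hahn_convI (N : ℕ) (ha : 0 < a) (hb : 0 < b) (hc : 0 < c) :
    SolvableFinite N (convI (hahnMeasure b c) (hahnMeasure a b) N) (hahnMeasure (a + b) c N)
      (hahnEigenvalue a b c) (hahnPoly (a + b) c N) (hahnNormSq (a + b) c N) := by
  have h' := (isThinning_hahnSeq one_pos hc hb).affine N (-1)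
  refine solvableFinite_convI (hahnSeq_pos one_pos ha) (hahnSeq_pos one_pos hb)
    (hahnSeq_pos one_pos hc) (isThinning_hahnSeq one_pos ha hb) h' (fun v hv => ?_)
    (fun M x hx => hahnMeasure_eq one_pos hx) (fun M x hx => hahnMeasure_eq one_pos hx)
    (fun x hx => ?_) (fun n => ?_) (isOrthogonalPolys_hahn (add_pos ha hb) hc N)
    (hahnPoly_eq (a + b) c N) (hahnCoeff_zero (a + b) c N)
  · rw [Nat.cast_sub hv]
    ring
  · rw [cauchyProd_hahnSeq 1 a b]
    exact hahnMeasure_eq one_pos hx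
  · rw [hahnEigenvalue, add_comm c b]
    ring

theorem solvableFinite_hahn_convIII (N : ℕ) (ha : 0 < a) (hb : 0 < b) (hc : 0 < c) :
    SolvableFinite N (convIII (hahnMeasure a b) (hahnMeasure b c) N) (hahnMeasure a (b + c) N)
      (hahnEigenvalue a b c) (hahnPoly a (b + c) N) (hahnNormSq a (b + c) N) := by
  have h' := (isThinning_hahnSeq one_pos hc hb).affine N (-1)
  refine solvableFinite_convIII (hahnSeq_pos one_pos ha) (hahnSeq_pos one_pos hb)
    (hahnSeq_pos one_pos hc) (isThinning_hahnSeq one_pos ha hb) h' (fun v hv => ?_)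
    (fun M x hx => hahnMeasure_eq one_pos hx) (fun M x hx => hahnMeasure_eq one_pos hx)
    (fun x hx => ?_) (fun n => ?_) (isOrthogonalPolys_hahn ha (add_pos hb hc) N)
    (hahnPoly_eq a (b + c) N) (hahnCoeff_zero a (b + c) N)
  · rw [Nat.cast_sub hv]
    ring
  · rw [cauchyProd_hahnSeq 1 b c]
    exact hahnMeasure_eq one_pos hx
  · rw [hahnEigenvalue, add_comm c b]
    ring

theorem hahnEigenvalueII_eq (a b c : ℝ) (n : ℕ) :
    hahnEigenvalueII a b c n =
      ∑ k ∈ Finset.range (n + 1), (n.choose k : ℝ) * (-1) ^ k *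
        (poch b k * poch (n + a + 2 * b + c - 1) k / (poch (a + b) k * poch (b + c) k)) := by
  rw [hahnEigenvalueII, hyper, tsum_eq_sum_of_lt (n := n)]
  · refine Finset.sum_congr rfl fun k _ => ?_
    simp only [List.map_cons, List.map_nil, List.prod_cons, List.prod_nil, mul_one]
    rw [poch_neg_natCast n k]
    field_simp
    simp
  · intro k hk
    simp [poch_neg_natCast_of_lt hk]

theorem solvableFinite_hahn_convII (N : ℕ) (ha : 0 < a) (hb : 0 < b) (hc : 0 < c) :
    SolvableFinite N (convII (hahnMeasure b c) (hahnMeasure a b) N)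
      (hahnMeasure (a + b) (b + c) N) (hahnEigenvalueII a b c) (hahnPoly (a + b) (b + c) N)
      (hahnNormSq (a + b) (b + c) N) := by
  refine solvableFinite_convII (hahnSeq_pos one_pos ha) (hahnSeq_pos one_pos hb)
    (hahnSeq_pos one_pos hc) (isThinning_hahnSeq one_pos ha hb) (isThinning_hahnSeq one_pos hb hc)
    (fun M x hx => hahnMeasure_eq one_pos hx) (fun M x hx => hahnMeasure_eq one_pos hx)
    (fun x hx => ?_) (fun n hn => ?_) (isOrthogonalPolys_hahn (add_pos ha hb) (add_pos hb hc) N)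
    (hahnPoly_eq (a + b) (b + c) N) (hahnCoeff_zero (a + b) (b + c) N)
  · rw [cauchyProd_hahnSeq 1 a b, cauchyProd_hahnSeq 1 b c]
    exact hahnMeasure_eq one_pos hx
  · rw [hahnEigenvalueII_eq]
    refine Finset.sum_congr rfl fun k hk => ?_
    have h2 := (newton_id_pos (show k ≤ N by simp at hk; omega)).ne'
    rw [hahnCoeff, show (n : ℝ) + (a + b) + (b + c) - 1 = n + a + 2 * b + c - 1 by ring]
    field_simp

theorem poch_reflect (b : ℝ) (n : ℕ) : poch (1 - n - b) n = (-1) ^ n * poch b n := by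
  rw [poch_eq_prod, poch_eq_prod, ← Finset.prod_range_reflect, ← Finset.card_range n,
    ← Finset.prod_const, Finset.card_range, ← Finset.prod_mul_distrib]
  refine Finset.prod_congr rfl fun i hi => ?_
  simp only [Finset.mem_range] at hi
  rw [Nat.cast_sub (by omega), Nat.cast_sub (by omega)]
  push_cast
  ring

/-- At `x = N` the upper parameter `-x` cancels the lower `-N`, and a Chu–Vandermonde sum remains;
its numerator has base `1 - n - b` and is reflected to base `b`. -/
theorem hahnPoly_last (b : ℝ) (ha : 0 < a) {N n : ℕ} (hn : n ≤ N) :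
    hahnPoly a b N n N = (-1) ^ n * (poch b n / poch a n) := by
  rw [hahnPoly_eq, newtonSum_eval, ← mul_div_assoc, ← poch_reflect,
    show (1 : ℝ) - n - b = a - (n + a + b - 1) by ring, ← chuVandermonde_div _ (poch_pos n ha).ne']
  refine Finset.sum_congr rfl fun k hk => ?_
  have h2 := (newton_id_pos (show k ≤ N by simp at hk; omega)).ne'
  rw [hahnCoeff]
  field_simp

end Hahn

/-! ### The `q`-Hahn chains -/

section QHahn

variable {q a b c : ℝ}

theorem qHahnCoeff_zero (q a b : ℝ) (N n : ℕ) : qHahnCoeff q a b N n 0 = 1 := by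
  simp [qHahnCoeff, newton, qVandermondeCoeff]

theorem solvableFinite_qHahn_convI (N : ℕ) (hq : 0 < q) (hq1 : q < 1) (ha : 0 < a) (ha1 : a < 1)
    (hb : 0 < b) (hb1 : b < 1) (hc : c < 1) :
    SolvableFinite N (convI (qHahnMeasure q b c) (qHahnMeasure q a b) N)
      (qHahnMeasure q (a * b) c N) (qHahnEigenvalue q a b c) (qHahnPoly q (a * b) c N)
      (qHahnNormSq q (a * b) c N) := by
  have hab : 0 < a * b := mul_pos ha hb
  have hab1 : a * b < 1 := mul_lt_one_of_lt ha ha1 hb1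
  have h := isThinning_qHahnSeq (t := 1) hq hq1 one_pos hab1
  -- The reflected lattice `(q ^ (N - v))⁻¹` is `(q ^ N)⁻¹ * q ^ v`, a multiple of the lattice of
  -- the reverse thinning; scaling a lattice does not change its constants.
  have h' := (isThinning_qHahnSeq_reverse hq hq1 ha (mul_lt_one_of_lt hb hb1 hc)).affine 0
    (q ^ N)⁻¹
  rw [one_mul] at h
  refine solvableFinite_convI (qHahnSeq_pos hq hq1 one_pos ha1) (qHahnSeq_pos hq hq1 ha hb1)
    (qHahnSeq_pos hq hq1 hab hc) h h' (fun v hv => ?_)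
    (fun M x hx => qHahnMeasure_eq hq hq1 ha hx) (fun M x hx => ?_)
    (fun x hx => ?_) (fun n => ?_) (isOrthogonalPolys_qHahn hq hq1 hab hab1 hc N)
    (qHahnPoly_eq hq (a * b) c N) (qHahnCoeff_zero q (a * b) c N)
  · rw [pow_sub₀ q hq.ne' hv, mul_inv, inv_inv, zero_add]
  · simpa using qHahnMeasure_eq hq hq1 one_pos hx
  · have h1 := cauchyProd_qHahnSeq hq hq1 1 a b
    rw [one_mul] at h1
    rw [h1]
    simpa using qHahnMeasure_eq hq hq1 one_pos hx
  · rw [qHahnEigenvalue]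
    ring

theorem solvableFinite_qHahn_convIII (N : ℕ) (hq : 0 < q) (hq1 : q < 1) (ha : 0 < a) (ha1 : a < 1)
    (hb : 0 < b) (hb1 : b < 1) (hc : c < 1) :
    SolvableFinite N (convIII (qHahnMeasure q a b) (qHahnMeasure q b c) N)
      (qHahnMeasure q a (b * c) N) (qHahnEigenvalue q a b c) (qHahnPoly q a (b * c) N)
      (qHahnNormSq q a (b * c) N) := by
  have hab : 0 < a * b := mul_pos ha hb
  have hab1 : a * b < 1 := mul_lt_one_of_lt ha ha1 hb1
  have hbc1 := mul_lt_one_of_lt hb hb1 hc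
  have h := isThinning_qHahnSeq (t := 1) hq hq1 one_pos hab1
  have h' := (isThinning_qHahnSeq_reverse hq hq1 ha hbc1).affine 0 (q ^ N)⁻¹
  rw [one_mul] at h
  refine solvableFinite_convIII (qHahnSeq_pos hq hq1 one_pos ha1) (qHahnSeq_pos hq hq1 ha hb1)
    (qHahnSeq_pos hq hq1 hab hc) h h' (fun v hv => ?_)
    (fun M x hx => ?_) (fun M x hx => qHahnMeasure_eq hq hq1 ha hx)
    (fun x hx => ?_) (fun n => ?_) (isOrthogonalPolys_qHahn hq hq1 ha ha1 hbc1 N)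
    (qHahnPoly_eq hq a (b * c) N) (qHahnCoeff_zero q a (b * c) N)
  · rw [pow_sub₀ q hq.ne' hv, mul_inv, inv_inv, zero_add]
  · simpa using qHahnMeasure_eq hq hq1 one_pos hx
  · rw [cauchyProd_qHahnSeq hq hq1]
    simpa using qHahnMeasure_eq hq hq1 one_pos hx
  · rw [qHahnEigenvalue]
    ring

/-- The eigenvalues are positive with successive ratio below `1`: writing `Q = q ^ n`, denominator
minus numerator of the ratio is `(1 - b) * (1 - a * b * c * Q ^ 2)`. -/
theorem qHahnEigenvalue_strictAnti (hq : 0 < q) (hq1 : q < 1) (ha : 0 < a) (ha1 : a < 1)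
    (hb : 0 < b) (hb1 : b < 1) (hc : c < 1) : StrictAnti (qHahnEigenvalue q a b c) := by
  have hab1 : a * b < 1 := mul_lt_one_of_lt ha ha1 hb1
  have hbc1 := mul_lt_one_of_lt hb hb1 hc
  refine strictAnti_nat_of_succ_lt fun n => ?_
  have h1 := qPoch_pos n hq hq1 ha1
  have h2 := qPoch_pos n hq hq1 hc
  have h3 := qPoch_pos n hq hq1 hab1
  have h4 := qPoch_pos n hq hq1 hbc1
  have h5 := one_sub_mul_pow_pos hq hq1 hab1 n
  have h6 := one_sub_mul_pow_pos hq hq1 hbc1 n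
  have h7 := mul_pow_lt_one hq hq1 ha1 n
  have h8 := mul_pow_lt_one hq hq1 hc n
  have h9 : 0 < a * q ^ n := by positivity
  have h10 := mul_lt_one_of_lt h9 h7 h8
  have h11 := mul_lt_one_of_lt hb hb1 h10
  have h12 : 0 < qHahnEigenvalue q a b c n := by
    unfold qHahnEigenvalue
    positivity
  have h13 : qHahnEigenvalue q a b c (n + 1) = qHahnEigenvalue q a b c n *
      (b * (1 - a * q ^ n) * (1 - c * q ^ n) / ((1 - a * b * q ^ n) * (1 - b * c * q ^ n))) := by
    unfold qHahnEigenvalue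
    rw [qPoch_succ, qPoch_succ, qPoch_succ, qPoch_succ, pow_succ]
    field_simp
  rw [h13]
  refine mul_lt_of_lt_one_right h12 ((div_lt_one (mul_pos h5 h6)).mpr ?_)
  have h14 := mul_pos (sub_pos.mpr hb1) (sub_pos.mpr h11)
  linear_combination h14

theorem qHahnMeasure_zero (hq : 0 < q) (hq1 : q < 1) (a b : ℝ) (N : ℕ) :
    qHahnMeasure q a b N 0 = qPoch b q N * a ^ N / qPoch (a * b) q N := by
  have := (qPoch_pos N hq hq1 hq1).ne'
  simp [qHahnMeasure, qBinom, this]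

theorem qHahnMeasure_last (hq : 0 < q) (hq1 : q < 1) (a b : ℝ) (N : ℕ) :
    qHahnMeasure q a b N N = qPoch a q N / qPoch (a * b) q N := by
  have := (qPoch_pos N hq hq1 hq1).ne'
  simp [qHahnMeasure, qBinom, this]

/-- The parameters `q ^ (-x)` and `q ^ (-N)` cancel at `x = N`, so `qChuVandermonde_div` applies;
reversing the order of the factors brings its product to the stated form. -/
theorem qHahnPoly_last (hq : 0 < q) (hq1 : q < 1) (ha1 : a < 1) (b : ℝ) {N n : ℕ} (hn : n ≤ N) :
    qHahnPoly q a b N n N = (-a) ^ n * q ^ (n * (n - 1) / 2) * (qPoch b q n / qPoch a q n) := by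
  have h1 : (-a) ^ n * q ^ (n * (n - 1) / 2) * qPoch b q n =
      ∏ i ∈ Finset.range n, (a * b * q ^ ((n : ℤ) - 1) - a * q ^ i) := by
    rw [← Finset.sum_range_id, ← Finset.prod_pow_eq_pow_sum, qPoch,
      ← Finset.prod_range_reflect (fun k => 1 - b * q ^ k), show (-a) ^ n =
      ∏ _i ∈ Finset.range n, -a by simp, ← Finset.prod_mul_distrib, ← Finset.prod_mul_distrib]
    refine Finset.prod_congr rfl fun i hi => ?_
    simp only [Finset.mem_range] at hi
    obtain ⟨m, rfl⟩ := Nat.exists_eq_add_of_lt hi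
    rw [show ((i + m + 1 : ℕ) : ℤ) - 1 = ((i + m : ℕ) : ℤ) by push_cast; ring, zpow_natCast,
      show i + m + 1 - 1 - i = m by omega, pow_add]
    ring
  rw [qHahnPoly_eq hq, newtonSum_eval, ← mul_div_assoc, h1,
    ← qChuVandermonde_div hq hq1 _ (qPoch_pos n hq hq1 ha1).ne']
  refine Finset.sum_congr rfl fun k hk => ?_
  have h2 := (newton_inv_pow_pos hq hq1 (show k ≤ N by simp at hk; omega)).ne'
  rw [qHahnCoeff]
  generalize (newton (fun x => (q ^ x)⁻¹) k).eval ((q ^ N)⁻¹) = A at h2 ⊢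
  field_simp

end QHahn

/-! ### The Charlier and Meixner chains -/

section Infinite

variable {a b c p : ℝ}

/-- The series is symmetric in its upper parameters `-n` and `-x`; this is the self-duality behind
completeness. -/
theorem charlierPoly_symm (a : ℝ) (n x : ℕ) : charlierPoly a n x = charlierPoly a x n := by
  unfold charlierPoly hyper
  simp [mul_comm]

theorem meixnerPoly_symm (a c : ℝ) (n x : ℕ) : meixnerPoly a c n x = meixnerPoly a c x n := by
  unfold meixnerPoly hyper
  simp [mul_comm]

theorem solvableInfinite_charlier (ha : 0 < a) (ha1 : a < 1) (hb : 0 < b)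
    (hp : p = b / (1 - a)) :
    SolvableInfinite (convInf (charlierMeasure b) (krawtchoukMeasure a)) (charlierMeasure p)
      (fun n => a ^ n) (charlierPoly p) (charlierNormSq p) := by
  have ha' : 0 < 1 - a := by linarith
  have hp0 : 0 < p := by rw [hp]; positivity
  have hA : 0 < a * p := by positivity
  have e1 : a * p + b = p := by
    rw [hp]
    field_simp
    ring
  have e2 : a * p / p = a := by field_simp
  -- The weights are `a * p` and `b`, with sum `p`: thinning a Poisson variable of mean `p` by `a`
  -- and adding an independent one of mean `b` restores the mean.
  refine solvableInfinite_convInf (s := Real.exp b) (t := Real.exp p) (r := Real.exp p)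
    (expSeq_pos hA) (expSeq_pos hb) (Real.exp_pos b) (Real.exp_pos p) (isThinning_expSeq hA hb)
    (charlierMeasure_eq b) (fun M x hx => krawtchoukMeasure_eq hA hb (by rw [e1, e2]) hx)
    (fun x => ?_) (hasSum_expSeq b) ?_ (fun k => ?_) (fun r => ?_) (fun n => by rw [e1, e2])
    (isOrthogonalPolys_charlier hp0) (charlierPoly_eq p) (fun n => by simp [charlierCoeff])
    (charlierPoly_symm p) fun n => ?_
  · rw [cauchyProd_expSeq, e1, charlierMeasure_eq]
  · rw [cauchyProd_expSeq _ _, e1]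
    exact hasSum_expSeq p
  · simpa using summable_charlierMeasure b (Polynomial.X ^ k)
  · exact (summable_charlierMeasure p (r ^ 2)).congr fun x => by rw [Polynomial.eval_pow]
  · rw [charlierMeasure_eq, charlierNormSq, expSeq]
    have := (Real.exp_pos p).ne'
    field_simp

theorem solvableInfinite_meixner (ha : 0 < a) (hb : 0 < b) (hc : 0 < c) (hc1 : c < 1) :
    SolvableInfinite (convInf (meixnerMeasure b c) (hahnMeasure a b)) (meixnerMeasure (a + b) c)
      (fun n => poch a n / poch (a + b) n) (meixnerPoly (a + b) c) (meixnerNormSq (a + b) c) := by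
  have h1c : 0 < 1 - c := by linarith
  have hz := fun s : ℝ => Real.rpow_pos_of_pos h1c s
  have hab := add_pos ha hb
  -- The Hahn measure does not depend on the common base `t` of its two weights, so the choice `t =
  -- c` lets it share the weight `hahnSeq c b` with the Meixner measure.
  refine solvableInfinite_convInf (s := (1 - c) ^ (-b)) (t := (1 - c) ^ (-(a + b)))
    (r := (1 - c) ^ (-(a + b)))
    (hahnSeq_pos hc ha) (hahnSeq_pos hc hb) (hz _) (hz _) (isThinning_hahnSeq hc ha hb)
    (meixnerMeasure_eq b hc1) (fun M x hx => hahnMeasure_eq hc hx)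
    (fun x => ?_) (hasSum_hahnSeq b hc hc1) ?_ (fun k => ?_) (fun r => ?_) (fun n => rfl)
    (isOrthogonalPolys_meixner hab hc hc1) (meixnerPoly_eq (a + b) c)
    (fun n => by simp [meixnerCoeff]) (meixnerPoly_symm (a + b) c) fun n => ?_
  · rw [cauchyProd_hahnSeq, meixnerMeasure_eq _ hc1]
  · rw [cauchyProd_hahnSeq _ _ _]
    exact hasSum_hahnSeq (a + b) hc hc1
  · simpa using summable_meixnerMeasure b hc hc1 (Polynomial.X ^ k)
  · exact (summable_meixnerMeasure (a + b) hc hc1 (r ^ 2)).congr fun x => by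
      rw [Polynomial.eval_pow]
  · have := (hz (-(a + b))).ne'
    rw [meixnerMeasure_eq _ hc1, meixnerNormSq, hahnSeq]
    field_simp

theorem poch_div_poch_strictAnti (ha : 0 < a) (hb : 0 < b) :
    StrictAnti fun n : ℕ => poch a n / poch (a + b) n := by
  refine strictAnti_nat_of_succ_lt fun n => ?_
  have h1 := poch_pos n ha
  have h2 := poch_pos n (add_pos ha hb)
  have h3 : (0 : ℝ) < a + n := by positivity
  have h4 : (0 : ℝ) < a + b + n := by positivity
  simp only [poch_succ]
  rw [mul_div_mul_comm]
  refine mul_lt_of_lt_one_right (div_pos h1 h2) ((div_lt_one h4).mpr ?_)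
  linarith

end Infinite

end QMC

end

theorem theorem3 :
    -- every reversible chain whose complete orthogonal system of left eigenvectors is known
    (∀ (V : Type) [LinearOrder V] (K : V → V → ℝ) (π κ : V → ℝ) (v : V → V → ℝ) (d : V → ℝ),
      QMC.IsReversibleChain K π → QMC.HasEigenbasis K π κ v d →
        QMC.QuantumSolvable K π κ (QMC.phiHat π v d)) ∧
    -- q-Hahn, type (i)
    (∀ (N : ℕ) (q a b c : ℝ), 0 < q → q < 1 → 0 < a → a < 1 → 0 < b → b < 1 → c < 1 →
      QMC.SolvableFinite N
        (QMC.convI (QMC.qHahnMeasure q b c) (QMC.qHahnMeasure q a b) N)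
        (QMC.qHahnMeasure q (a * b) c N)
        (QMC.qHahnEigenvalue q a b c)
        (QMC.qHahnPoly q (a * b) c N)
        (QMC.qHahnNormSq q (a * b) c N) ∧
      Function.Injective (QMC.qHahnEigenvalue q a b c) ∧
      QMC.qHahnMeasure q (a * b) c N 0 =
        QMC.qPoch c q N * (a * b) ^ N / QMC.qPoch (a * b * c) q N ∧
      QMC.qHahnMeasure q (a * b) c N N =
        QMC.qPoch (a * b) q N / QMC.qPoch (a * b * c) q N ∧
      ∀ n ≤ N, QMC.qHahnPoly q (a * b) c N n N =
        (-(a * b)) ^ n * q ^ (n * (n - 1) / 2) * (QMC.qPoch c q n / QMC.qPoch (a * b) q n)) ∧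
    -- Hahn, type (ii)
    (∀ (N : ℕ) (a b c : ℝ), 0 < a → 0 < b → 0 < c →
      QMC.SolvableFinite N
        (QMC.convII (QMC.hahnMeasure b c) (QMC.hahnMeasure a b) N)
        (QMC.hahnMeasure (a + b) (b + c) N)
        (QMC.hahnEigenvalueII a b c)
        (QMC.hahnPoly (a + b) (b + c) N)
        (QMC.hahnNormSq (a + b) (b + c) N) ∧
      (∀ n : ℕ, QMC.hahnEigenvalueII a b c n =
        ∑ k ∈ Finset.range (n + 1), (n.choose k : ℝ) * (-1) ^ k *
          (QMC.poch b k * QMC.poch (n + a + 2 * b + c - 1) k /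
            (QMC.poch (a + b) k * QMC.poch (b + c) k))) ∧
      QMC.hahnMeasure (a + b) (b + c) N 0 =
        QMC.poch (b + c) N / QMC.poch (a + 2 * b + c) N ∧
      QMC.hahnMeasure (a + b) (b + c) N N =
        QMC.poch (a + b) N / QMC.poch (a + 2 * b + c) N ∧
      ∀ n ≤ N, QMC.hahnPoly (a + b) (b + c) N n N =
        (-1) ^ n * (QMC.poch (b + c) n / QMC.poch (a + b) n)) ∧
    -- Krawtchouk, type (iii)
    (∀ (N : ℕ) (a b p : ℝ), 0 < a → a < 1 → 0 < b → b < 1 → p = a * b / (1 - b + a * b) →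
      QMC.SolvableFinite N
        (QMC.convIII (QMC.krawtchoukMeasure b) (QMC.krawtchoukMeasure a) N)
        (QMC.krawtchoukMeasure p N)
        (fun n => (1 - a) ^ n * b ^ n)
        (QMC.krawtchoukPoly p N)
        (QMC.krawtchoukNormSq p N) ∧
      Function.Injective (fun n : ℕ => (1 - a) ^ n * b ^ n) ∧
      QMC.krawtchoukMeasure p N 0 = (1 - p) ^ N ∧
      QMC.krawtchoukMeasure p N N = p ^ N ∧
      (∀ n ≤ N, QMC.krawtchoukPoly p N n N = (-1) ^ n * (p⁻¹ - 1) ^ n) ∧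
      ∀ H : QMC.L2 (Fin (N + 1)) →L[ℂ] QMC.L2 (Fin (N + 1)),
        QMC.IsHamiltonian
          (fun x y : Fin (N + 1) =>
            QMC.convIII (QMC.krawtchoukMeasure b) (QMC.krawtchoukMeasure a) N x y)
          (fun x : Fin (N + 1) => QMC.krawtchoukMeasure p N x) H →
        ∀ ℓ : ℕ, QMC.amplitude H (Fin.last N) 0 ℓ =
          (((a * b * (1 - b)) ^ ((N : ℝ) / 2) / (1 - b + a * b) ^ N : ℝ) : ℂ) *
            ∑ n ∈ Finset.range (N + 1),
              (-1) ^ n * QMC.phase ((1 - a) ^ n * b ^ n) ℓ * (N.choose n : ℂ)) ∧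
    -- Charlier, type (i)
    (∀ (a b p : ℝ), 0 < a → a < 1 → 0 < b → p = b / (1 - a) →
      QMC.SolvableInfinite
        (QMC.convInf (QMC.charlierMeasure b) (QMC.krawtchoukMeasure a))
        (QMC.charlierMeasure p)
        (fun n => a ^ n)
        (QMC.charlierPoly p)
        (QMC.charlierNormSq p) ∧
      Function.Injective (fun n : ℕ => a ^ n) ∧
      QMC.charlierMeasure p 0 = Real.exp (-p)) ∧
    -- Meixner, type (ii)
    (∀ (a b c : ℝ), 0 < a → 0 < b → 0 < c → c < 1 →
      QMC.SolvableInfinite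
        (QMC.convInf (QMC.meixnerMeasure b c) (QMC.hahnMeasure a b))
        (QMC.meixnerMeasure (a + b) c)
        (fun n => QMC.poch a n / QMC.poch (a + b) n)
        (QMC.meixnerPoly (a + b) c)
        (QMC.meixnerNormSq (a + b) c) ∧
      Function.Injective (fun n : ℕ => QMC.poch a n / QMC.poch (a + b) n) ∧
      QMC.meixnerMeasure (a + b) c 0 = (1 - c) ^ (a + b)) ∧
    -- Krawtchouk, types (i) and (ii)
    (∀ (N : ℕ) (a b p : ℝ), 0 < a → a < 1 → 0 < b → b < 1 → p = b / (1 - a + a * b) →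
      QMC.SolvableFinite N
        (QMC.convI (QMC.krawtchoukMeasure b) (QMC.krawtchoukMeasure a) N)
        (QMC.krawtchoukMeasure p N)
        (fun n => a ^ n * (1 - b) ^ n)
        (QMC.krawtchoukPoly p N)
        (QMC.krawtchoukNormSq p N)) ∧
    (∀ (N : ℕ) (a b p : ℝ), 0 < a → a < 1 → 0 < b → b < 1 → p = b / (1 - a + b) →
      QMC.SolvableFinite N
        (QMC.convII (QMC.krawtchoukMeasure b) (QMC.krawtchoukMeasure a) N)
        (QMC.krawtchoukMeasure p N)
        (fun n => (a - b) ^ n)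
        (QMC.krawtchoukPoly p N)
        (QMC.krawtchoukNormSq p N)) ∧
    -- Hahn, types (i) and (iii)
    (∀ (N : ℕ) (a b c : ℝ), 0 < a → 0 < b → 0 < c →
      QMC.SolvableFinite N
        (QMC.convI (QMC.hahnMeasure b c) (QMC.hahnMeasure a b) N)
        (QMC.hahnMeasure (a + b) c N)
        (QMC.hahnEigenvalue a b c)
        (QMC.hahnPoly (a + b) c N)
        (QMC.hahnNormSq (a + b) c N)) ∧
    (∀ (N : ℕ) (a b c : ℝ), 0 < a → 0 < b → 0 < c →
      QMC.SolvableFinite N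
        (QMC.convIII (QMC.hahnMeasure a b) (QMC.hahnMeasure b c) N)
        (QMC.hahnMeasure a (b + c) N)
        (QMC.hahnEigenvalue a b c)
        (QMC.hahnPoly a (b + c) N)
        (QMC.hahnNormSq a (b + c) N)) ∧
    -- q-Hahn, type (iii)
    (∀ (N : ℕ) (q a b c : ℝ), 0 < q → q < 1 → 0 < a → a < 1 → 0 < b → b < 1 → c < 1 →
      QMC.SolvableFinite N
        (QMC.convIII (QMC.qHahnMeasure q a b) (QMC.qHahnMeasure q b c) N)
        (QMC.qHahnMeasure q a (b * c) N)
        (QMC.qHahnEigenvalue q a b c)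
        (QMC.qHahnPoly q a (b * c) N)
        (QMC.qHahnNormSq q a (b * c) N)) := by
  refine ⟨?_, ?_, ?_, ?_, ?_, ?_, ?_, ?_, ?_, ?_, ?_⟩
  · intro V _ K π κ v d h hE
    exact hE.quantumSolvable h
  · intro N q a b c hq hq1 ha ha1 hb hb1 hc
    exact ⟨QMC.solvableFinite_qHahn_convI N hq hq1 ha ha1 hb hb1 hc,
      (QMC.qHahnEigenvalue_strictAnti hq hq1 ha ha1 hb hb1 hc).injective,
      QMC.qHahnMeasure_zero hq hq1 (a * b) c N, QMC.qHahnMeasure_last hq hq1 (a * b) c N,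
      fun n hn => QMC.qHahnPoly_last hq hq1 (QMC.mul_lt_one_of_lt ha ha1 hb1) c hn⟩
  · intro N a b c ha hb hc
    refine ⟨QMC.solvableFinite_hahn_convII N ha hb hc, QMC.hahnEigenvalueII_eq a b c, ?_, ?_,
      fun n hn => QMC.hahnPoly_last (b + c) (add_pos ha hb) hn⟩
    · simp [QMC.hahnMeasure, show a + b + (b + c) = a + 2 * b + c by ring]
    · simp [QMC.hahnMeasure, show a + b + (b + c) = a + 2 * b + c by ring]
  · intro N a b p ha ha1 hb hb1 hp
    refine ⟨QMC.solvableFinite_krawtchouk_convIII N ha ha1 hb hb1 hp, ?_, ?_, ?_,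
      fun n hn => QMC.krawtchoukPoly_last p hn, QMC.krawtchouk_amplitude N ha ha1 hb hb1 hp⟩
    · simp only [← mul_pow]
      exact (pow_right_strictAnti₀ (mul_pos (by linarith) hb) (by nlinarith)).injective
    · simp [QMC.krawtchoukMeasure]
    · simp [QMC.krawtchoukMeasure]
  · intro a b p ha ha1 hb hp
    refine ⟨QMC.solvableInfinite_charlier ha ha1 hb hp,
      (pow_right_strictAnti₀ ha ha1).injective, ?_⟩
    simp [QMC.charlierMeasure]
  · intro a b c ha hb hc hc1
    refine ⟨QMC.solvableInfinite_meixner ha hb hc hc1,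
      (QMC.poch_div_poch_strictAnti ha hb).injective, ?_⟩
    simp [QMC.meixnerMeasure]
  · intro N a b p ha ha1 hb hb1 hp
    exact QMC.solvableFinite_krawtchouk_convI N ha ha1 hb hb1 hp
  · intro N a b p ha ha1 hb hb1 hp
    exact QMC.solvableFinite_krawtchouk_convII N ha ha1 hb hb1 hp
  · intro N a b c ha hb hc
    exact QMC.solvableFinite_hahn_convI N ha hb hc
  · intro N a b c ha hb hc
    exact QMC.solvableFinite_hahn_convIII N ha hb hc
  · intro N q a b c hq hq1 ha ha1 hb hb1 hc
    exact QMC.solvableFinite_qHahn_convIII N hq hq1 ha ha1 hb hb1 hc
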